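/- Let $\mathrm{Sp}_4(\mathbb R)=\{g\in \mathrm{GL}_4(\mathbb R) : g^{T}Jg=J\}$ with $J=\begin{pmatrix}0&I_2\\-I_2&0\end{pmatrix}$, let $\mathfrak{sp}_4(\mathbb R)=\{M\in \mathrm{Mat}_4(\mathbb R) : M^TJ+JM=0\}$ be its Lie algebra, let $\widetilde{\mathrm{Sp}}_4(\mathbb R)$ be the universal covering group of $\mathrm{Sp}_4(\mathbb R)$, and let $\exp\colon\mathfrak{sp}_4(\mathbb R)\to\widetilde{\mathrm{Sp}}_4(\mathbb R)$ be its exponential map. Let $\mathfrak X_{2\beta}\in\mathfrak{sp}_4(\mathbb R)$ be the matrix whose only non-zero entry is a $1$ in row $2$ and column $4$. **Theorem.** Let $E$ be a uniformly convex real Banach space, and let $\widetilde{\mathrm{Sp}}_4(\mathbb R)$ act on $E$ by isometries such that the action map $\widetilde{\mathrm{Sp}}_4(\mathbb R)\times E\to E$ is continuous. Then there is a point $\xi\in E$ with $\exp(t\,\mathfrak X_{2\beta})\cdot \xi=\xi$ for all $t\in\mathbb R$. -/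

import Mathlib

open scoped unitInterval

section UniversalCover

variable (G : Type*) [Group G] [TopologicalSpace G] [IsTopologicalGroup G]

/-- The topological group of continuous paths `[0,1] → G` starting at `1`, under pointwise
multiplication and with the compact-open topology. -/
def basedPaths : Subgroup C(I, G) where
  carrier := {γ | γ 0 = 1}
  mul_mem' := by
    intro a b ha hb
    simp only [Set.mem_ofPred_eq] at ha hb ⊢
    simp [ha, hb]
  one_mem' := by simp
  inv_mem' := by
    intro a ha
    simp only [Set.mem_ofPred_eq] at ha ⊢
    simp [ha]

instance basedPaths_isTopologicalGroup : IsTopologicalGroup (basedPaths G) := by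
  have : IsTopologicalGroup C(I, G) :=
    { continuous_inv := ContinuousMap.continuous_postcomp (X := I)
        (⟨fun g => g⁻¹, continuous_inv⟩ : C(G, G)) }
  infer_instance

/-- The based paths that are homotopic, relative to the end points, to the constant path `1`. -/
def nullHomotopicLoops : Subgroup (basedPaths G) where
  carrier := {γ | ContinuousMap.HomotopicRel (γ : C(I, G)) 1 {0, 1}}
  mul_mem' := by
    rintro a b ⟨F⟩ ⟨H⟩
    refine ⟨⟨⟨F.toContinuousMap * H.toContinuousMap, ?_, ?_⟩, ?_⟩⟩
    · intro x
      simp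
    · intro x
      simp
    · intro t x hx
      have h1 := F.eq_fst t hx
      have h2 := H.eq_fst t hx
      simpa using congrArg₂ (· * ·) h1 h2
  one_mem' := ContinuousMap.HomotopicRel.refl _
  inv_mem' := by
    rintro a ⟨F⟩
    refine ⟨⟨⟨F.toContinuousMap⁻¹, ?_, ?_⟩, ?_⟩⟩
    · intro x
      simp
    · intro x
      simp
    · intro t x hx
      have h1 := F.eq_fst t hx
      simpa using congrArg (·⁻¹) h1

instance nullHomotopicLoops_normal : (nullHomotopicLoops G).Normal where
  conj_mem := by
    rintro a ⟨F⟩ g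
    let g' : C(I × I, G) := (g : C(I, G)).comp ContinuousMap.snd
    refine ⟨⟨⟨g' * F.toContinuousMap * g'⁻¹, ?_, ?_⟩, ?_⟩⟩
    · intro x
      simp [g']
    · intro x
      simp [g']
    · intro t x hx
      have h1 := F.eq_fst t hx
      simpa [g'] using h1

/-- The universal covering group of a connected, locally path connected and semilocally simply
connected topological group `G` (for instance, of a connected Lie group): the group of homotopy
classes, relative to the end points, of paths in `G` starting at `1`, with the quotient topology;
the covering homomorphism sends the class of `γ` to `γ 1`.
(Two based paths `γ`, `δ` are homotopic relative to the end points if and only if `γ⁻¹ * δ` is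
a null-homotopic loop, so the homotopy classes are the cosets.) -/
abbrev UniversalCover : Type _ := basedPaths G ⧸ nullHomotopicLoops G

end UniversalCover

section Symplectic

attribute [local instance] LieRing.ofAssociativeRing

/-- The group `Sp₄(ℝ)`, with the topology induced by that of the space of `4 × 4` matrices. -/
abbrev Sp4 : Type := Matrix.symplecticGroup (Fin 2) ℝ

/-- The Lie algebra `𝔰𝔭₄(ℝ)`, that is, all `4 × 4` matrices `M` with `Mᵀ J + J M = 0`. -/
abbrev sp4 : LieSubalgebra ℝ (Matrix (Fin 2 ⊕ Fin 2) (Fin 2 ⊕ Fin 2) ℝ) :=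
  LieAlgebra.Symplectic.sp (Fin 2) ℝ

instance Sp4.instIsTopologicalGroup : IsTopologicalGroup Sp4 where
  continuous_inv := by
    refine Continuous.subtype_mk (f := fun A : Sp4 =>
      (-Matrix.J (Fin 2) ℝ) * (A : Matrix _ _ ℝ).transpose * Matrix.J (Fin 2) ℝ) ?_ _
    fun_prop

theorem mem_sp4_iff (M : Matrix (Fin 2 ⊕ Fin 2) (Fin 2 ⊕ Fin 2) ℝ) :
    M ∈ sp4 ↔ M.transpose * Matrix.J (Fin 2) ℝ + Matrix.J (Fin 2) ℝ * M = 0 := by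
  rw [sp4, LieAlgebra.Symplectic.sp, mem_skewAdjointMatricesLieSubalgebra,
    mem_skewAdjointMatricesSubmodule, Matrix.IsSkewAdjoint, Matrix.IsAdjointPair,
    Matrix.mul_neg, eq_neg_iff_add_eq_zero]

theorem exp_mem_symplecticGroup (M : sp4) :
    NormedSpace.exp (M : Matrix (Fin 2 ⊕ Fin 2) (Fin 2 ⊕ Fin 2) ℝ) ∈
      Matrix.symplecticGroup (Fin 2) ℝ := by
  obtain ⟨M, hM⟩ := M
  have hdet : IsUnit (Matrix.J (Fin 2) ℝ).det := Matrix.isUnit_det_J (Fin 2) ℝ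
  have hJ : IsUnit (Matrix.J (Fin 2) ℝ) := (Matrix.isUnit_iff_isUnit_det _).mpr hdet
  have h1 : M.transpose = Matrix.J (Fin 2) ℝ * (-M) * (Matrix.J (Fin 2) ℝ)⁻¹ := by
    rw [Matrix.mul_neg, ← eq_neg_of_add_eq_zero_left ((mem_sp4_iff M).1 hM),
      Matrix.mul_nonsing_inv_cancel_right _ _ hdet]
  have hE : IsUnit (NormedSpace.exp M).det :=
    (Matrix.isUnit_iff_isUnit_det _).mp (Matrix.isUnit_exp M)
  rw [SymplecticGroup.mem_iff', ← Matrix.exp_transpose, h1, Matrix.exp_conj _ _ hJ,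
    Matrix.exp_neg, Matrix.nonsing_inv_mul_cancel_right _ _ hdet,
    Matrix.nonsing_inv_mul_cancel_right _ _ hE]

/-- The exponential map `𝔰𝔭₄(ℝ) → Sp₄(ℝ)`, which is the matrix exponential. -/
noncomputable def Sp4.exp (M : sp4) : Sp4 := ⟨NormedSpace.exp M.1, exp_mem_symplecticGroup M⟩

theorem Sp4.continuous_exp : Continuous Sp4.exp := by
  refine Continuous.subtype_mk ?_ _
  have h : Continuous
      (NormedSpace.exp : Matrix (Fin 2 ⊕ Fin 2) (Fin 2 ⊕ Fin 2) ℝ → Matrix _ _ ℝ) := by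
    let _ : NormedRing (Matrix (Fin 2 ⊕ Fin 2) (Fin 2 ⊕ Fin 2) ℝ) := Matrix.linftyOpNormedRing
    let _ : NormedAlgebra ℝ (Matrix (Fin 2 ⊕ Fin 2) (Fin 2 ⊕ Fin 2) ℝ) :=
      Matrix.linftyOpNormedAlgebra
    let _ : NormedAlgebra ℚ (Matrix (Fin 2 ⊕ Fin 2) (Fin 2 ⊕ Fin 2) ℝ) :=
      NormedAlgebra.restrictScalars ℚ ℝ _
    exact NormedSpace.exp_continuous
  exact h.comp continuous_subtype_val

/-- The path `s ↦ exp (s M)` in `Sp₄(ℝ)`, starting at `1`. -/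
noncomputable def Sp4.expPath (M : sp4) : basedPaths Sp4 :=
  ⟨⟨fun s => Sp4.exp ((s : ℝ) • M), by
      have := Sp4.continuous_exp
      fun_prop⟩, by
    refine Subtype.ext ?_
    simp [Sp4.exp]⟩

/-- The universal cover of `Sp₄(ℝ)`. -/
abbrev Sp4Tilde : Type := UniversalCover Sp4

/-- The exponential map from `𝔰𝔭₄(ℝ)` to the universal cover of `Sp₄(ℝ)`: the one-parameter group
`t ↦ exp (t M)` of the universal cover is the lift of the one of `Sp₄(ℝ)`, so its value at `1` is
the class of the path `s ↦ exp (s M)`. -/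
noncomputable def Sp4Tilde.exp (M : sp4) : Sp4Tilde := (Sp4.expPath M : Sp4Tilde)

/-- The root vector for the root `2β`: the `4 × 4` matrix whose only non-zero entry is a `1` in
row `2` and column `4`. -/
def rootVector2Beta : sp4 :=
  ⟨Matrix.fromBlocks 0 !![0, 0; 0, 1] 0 0, by
    rw [mem_sp4_iff]
    simp [Matrix.J, Matrix.fromBlocks_transpose, Matrix.fromBlocks_multiply,
      Matrix.fromBlocks_add]
    ext i j
    fin_cases i <;> fin_cases j <;> simp⟩

end Symplectic

-- By Mazur–Ulam the isometries are affine, so every one-parameter subgroup `x` of the group has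
-- orbit averages A(l)v = ∫ φ(t) x(lt)v dt at each time scale l. Number the roots β - α, 2β, α + β,
-- 2α, α - β as 3, 2, 1, 0, 7. The fixed point is a limit of A₃A₂A₁v along scales l₃, l₂, l₁ tending
-- to infinity: `x₂` commutes with `x₁` and `x₃` and moves an average over `x₂` at scale l₂ by only
-- O(log l₂ / l₂), so a limit is fixed by it. The whole difficulty is that these averages converge,
-- although orbits of an affine action may be unbounded.
--
-- The source of convergence is uniform convexity. If isometries X, Y have the commutator z(a), and
-- u has frequency of order 1 for the flow z, then (1 + X)/2 · (1 + Y)/2 shortens u by a definite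
-- factor: otherwise X and Y, and with them z(a), would almost fix u, against its frequency
-- (`ConvexAt.norm_half_half_le`). Applied at n scales in geometric progression, this makes averages
-- over x and y exponentially small in n on differences of averages over z at successive scales
-- (`exists_norm_op_mul_op_mul_diff_le`). The estimate tolerates small errors in the Heisenberg
-- relations.
--
-- Doubling the scale of an affine average changes it by such a linear difference applied to a
-- difference of two averages of v (`affAvg_sub_affAvg_two_mul`). The latter grows only
-- logarithmically with the scale, because a torus element conjugates x(t) to x(2t)
-- (`ActionFlow.exists_logGrowth`). Exponential decay beats this loss.
--
-- Doubling l₂ uses the Heisenberg group of the roots 3, 2, 1. For l₁ one uses that the commutator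
-- of `x₃` and `x₀` is `x₁` up to `x₂`, a small error on vectors already averaged over `x₂`. This
-- needs a further average over `x₀`, which can be inserted at little cost by means of a short
-- average over `x₇` and the Heisenberg group of 1, 0, 7, provided that `x₇` is Lipschitz at v.
-- Doubling l₃ is the same problem after the reflection α ↦ -α, which exchanges the roots 1 and 3;
-- the order of the averages may be reversed as long as l₁l₃ is much smaller than l₂. The scales
-- 2^(13m), 2^(27m), 2^(13m) satisfy all these conditions, and the steps from m to m + 1 are
-- summable (`ChainEstimate.cauchySeq_avg`).

universe u

/-! ### A band-limited averaging kernel -/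

section Kernel

open MeasureTheory FourierTransform SchwartzMap

/-- The weight `(1 + |t|)⁻⁴` on the real line. -/
noncomputable def polyWeight (t : ℝ) : ℝ := ((1 + |t|) ^ 4)⁻¹

/-- The exponent 4 is chosen so that an integrable `(1 + |t|)⁻²` is left when the averaged functions
grow quadratically. -/
theorem integrable_sq_mul_polyWeight : Integrable fun t : ℝ => (1 + |t|) ^ 2 * polyWeight t := by
  have h := integrable_one_add_norm (E := ℝ) (μ := volume) (r := 2) (by simp)
  refine h.congr (Filter.Eventually.of_forall fun t => ?_)
  have h1 : 0 < 1 + |t| := by positivity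
  simp only [Real.norm_eq_abs, polyWeight]
  rw [Real.rpow_neg h1.le]
  norm_cast
  field_simp

/-- A continuous averaging kernel of polynomial decay whose Fourier transform is `1` near `0` and
has so small a support that `φ` is reproduced by convolution with `s ↦ 2 φ (2 s)`. -/
structure AveragingKernel (φ : ℝ → ℝ) : Prop where
  continuous : Continuous φ
  integral_eq_one : ∫ t, φ t = 1
  reproducing : ∀ t, ∫ s, 2 * φ (2 * s) * φ (t - s) = φ t
  decay : ∃ C, ∀ t, |φ t| ≤ C * polyWeight t
  lipschitz : ∃ C, ∀ s h, |h| ≤ 1 → |φ (s - h) - φ s| ≤ C * |h| * polyWeight s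

theorem polyWeight_le_of_abs_sub_le {s u : ℝ} (h : |u - s| ≤ 1) :
    polyWeight u ≤ 16 * polyWeight s := by
  unfold polyWeight
  have h1 : 1 + |s| ≤ 2 * (1 + |u|) := by
    have := abs_sub_abs_le_abs_sub s u
    rw [abs_sub_comm] at this
    linarith [abs_nonneg u]
  rw [← div_eq_mul_inv, inv_eq_one_div, div_le_div_iff₀ (by positivity) (by positivity)]
  calc 1 * (1 + |s|) ^ 4 ≤ (2 * (1 + |u|)) ^ 4 := by rw [one_mul]; gcongr
    _ = 16 * (1 + |u|) ^ 4 := by ring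

theorem SchwartzMap.exists_iteratedFDeriv_le_polyWeight (f : 𝓢(ℝ, ℂ)) (n : ℕ) :
    ∃ C, 0 ≤ C ∧ ∀ t, ‖iteratedFDeriv ℝ n f t‖ ≤ C * polyWeight t := by
  refine ⟨2 ^ 4 * (Finset.Iic (4, n)).sup (fun m => SchwartzMap.seminorm ℝ m.1 m.2) f,
    by positivity, fun t => ?_⟩
  have h := one_add_le_sup_seminorm_apply (𝕜 := ℝ) (m := (4, n)) (k := 4) (n := n) le_rfl le_rfl f t
  rw [polyWeight, ← div_eq_mul_inv, le_div_iff₀ (by positivity), mul_comm]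
  simpa using h

/-- Mean value inequality on the unit ball about `s`, where the weight varies at most by the factor
16. -/
theorem SchwartzMap.exists_lipschitz_polyWeight (f : 𝓢(ℝ, ℂ)) :
    ∃ C, ∀ s h, |h| ≤ 1 → ‖f (s - h) - f s‖ ≤ C * |h| * polyWeight s := by
  obtain ⟨C, hC, hf⟩ := f.exists_iteratedFDeriv_le_polyWeight 1
  refine ⟨C * 16, fun s h hh => ?_⟩
  have key := (convex_closedBall s 1).norm_image_sub_le_of_norm_fderiv_le (𝕜 := ℝ) (f := f)
    (C := C * (16 * polyWeight s)) (x := s) (y := s - h)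
    (fun x _ => f.differentiableAt) (fun x hx => ?_) (by simp) (by simpa using hh)
  · refine key.trans (le_of_eq ?_)
    simp
    ring
  · have := hf x
    rw [norm_iteratedFDeriv_one] at this
    exact this.trans (mul_le_mul_of_nonneg_left (polyWeight_le_of_abs_sub_le
      (by simpa [Real.dist_eq] using hx)) hC)

theorem fourierInv_dilation_two (χ : ℝ → ℂ) (s : ℝ) :
    𝓕⁻ (fun ξ : ℝ => χ (ξ / 2)) s = 2 * 𝓕⁻ χ (2 * s) := by
  rw [Real.fourierInv_eq', Real.fourierInv_eq']
  have h := Measure.integral_comp_div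
    (fun ξ : ℝ => Complex.exp ((↑(2 * Real.pi * inner ℝ ξ (2 * s)) * Complex.I)) • χ ξ) (2 : ℝ)
  simp only [abs_two] at h
  calc _ = _ := ?_
    _ = _ := h
    _ = _ := by simp
  refine integral_congr_ae (Filter.Eventually.of_forall fun ξ => ?_)
  simp only
  congr 4
  simp
  ring

theorem fourierInv_conj_of_even (b : ℝ → ℝ) (hb : ∀ x, b (-x) = b x) (s : ℝ) :
    (starRingEnd ℂ) (𝓕⁻ (fun ξ : ℝ => (b ξ : ℂ)) s) = 𝓕⁻ (fun ξ : ℝ => (b ξ : ℂ)) s := by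
  rw [Real.fourierInv_eq', ← integral_conj, ← integral_neg_eq_self]
  refine integral_congr_ae (Filter.Eventually.of_forall fun ξ => ?_)
  simp [hb, ← Complex.exp_conj, Complex.conj_ofNat]

/-- Take for φ the inverse Fourier transform of an even bump function b that is 1 on [-1, 1] and
vanishes outside [-2, 2]. Since b(ξ/2) = 1 wherever b(ξ) ≠ 0, the product b(ξ/2)b(ξ) is b(ξ), and
this is the reproducing identity on the Fourier side. Evenness makes φ real, and b(0) = 1 is its
integral. -/
theorem exists_averagingKernel : ∃ φ : ℝ → ℝ, AveragingKernel φ := by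
  let b : ContDiffBump (0 : ℝ) := ⟨1, 2, by norm_num, by norm_num⟩
  have hb2 (ξ : ℝ) : b (ξ / 2) * b ξ = b ξ := by
    by_cases h : |ξ| < 2
    · rw [b.one_of_mem_closedBall, one_mul]
      rw [mem_closedBall_zero_iff, Real.norm_eq_abs, abs_div, abs_two]
      change _ ≤ (1 : ℝ)
      linarith
    · rw [b.zero_of_le_dist (x := ξ), mul_zero]
      simpa using h
  have hsmooth : ContDiff ℝ (⊤ : ℕ∞) (fun ξ : ℝ => (b ξ : ℂ)) :=
    Complex.ofRealCLM.contDiff.comp b.contDiff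
  have hsupp : HasCompactSupport (fun ξ : ℝ => (b ξ : ℂ)) :=
    b.hasCompactSupport.comp_left (g := fun x : ℝ => (x : ℂ)) Complex.ofReal_zero
  let χ : 𝓢(ℝ, ℂ) := hsupp.toSchwartzMap hsmooth
  have hsmooth' : ContDiff ℝ (⊤ : ℕ∞) (fun ξ : ℝ => (b (ξ / 2) : ℂ)) :=
    hsmooth.comp (contDiff_id.div_const 2)
  have hsupp' : HasCompactSupport (fun ξ : ℝ => (b (ξ / 2) : ℂ)) := by
    have := hsupp.comp_homeomorph (Homeomorph.mulRight₀ (2⁻¹ : ℝ) (by norm_num))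
    simpa [Function.comp_def, div_eq_mul_inv] using this
  let χ' : 𝓢(ℝ, ℂ) := hsupp'.toSchwartzMap hsmooth'
  let g : 𝓢(ℝ, ℂ) := 𝓕⁻ χ
  let g' : 𝓢(ℝ, ℂ) := 𝓕⁻ χ'
  have hg : ∀ t, g t = 𝓕⁻ (fun ξ : ℝ => (b ξ : ℂ)) t := fun t => by
    change (𝓕⁻ χ : 𝓢(ℝ, ℂ)) t = _
    rw [fourierInv_coe]; rfl
  have hg' : ∀ t, g' t = 2 * g (2 * t) := fun t => by
    rw [hg, ← fourierInv_dilation_two]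
    change (𝓕⁻ χ' : 𝓢(ℝ, ℂ)) t = _
    rw [fourierInv_coe]; rfl
  have hreal : ∀ t, ((g t).re : ℂ) = g t := fun t => by
    rw [← Complex.conj_eq_iff_re, hg]
    exact fourierInv_conj_of_even b (fun x => b.neg x) t
  have hconv : convolution (ContinuousLinearMap.mul ℂ ℂ) g' g = g := by
    have : 𝓕 (convolution (ContinuousLinearMap.mul ℂ ℂ) g' g) = 𝓕 g := by
      rw [fourier_convolution]
      ext ξ
      have h1 : 𝓕 g = χ := by simp [g]
      have h2 : 𝓕 g' = χ' := by simp [g']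
      rw [h1, h2]
      change (b (ξ / 2) : ℂ) * (b ξ : ℂ) = (b ξ : ℂ)
      exact_mod_cast hb2 ξ
    have h := congrArg (fun f : 𝓢(ℝ, ℂ) => (𝓕⁻ f : 𝓢(ℝ, ℂ))) this
    simpa using h
  refine ⟨fun t => (g t).re, ?_, ?_, ?_, ?_, ?_⟩
  · exact Complex.continuous_re.comp g.continuous
  · have h1 : 𝓕 g = χ := by simp [g]
    have h2 : 𝓕 (g : ℝ → ℂ) 0 = χ 0 := by rw [← fourier_coe, h1]
    rw [Real.fourier_eq'] at h2
    have h3 : χ 0 = 1 := by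
      change ((b 0 : ℝ) : ℂ) = 1
      rw [b.one_of_mem_closedBall (by simp [b.rIn_pos.le])]
      simp
    have h4 : ∫ t, ((g t).re : ℂ) = 1 := by
      rw [← h3, ← h2]
      refine integral_congr_ae (Filter.Eventually.of_forall fun t => ?_)
      simp [hreal]
    rw [integral_complex_ofReal] at h4
    exact_mod_cast h4
  · intro t
    have h := DFunLike.congr_fun hconv t
    rw [convolution_apply, MeasureTheory.convolution_def] at h
    have h4 : ∫ s, ((2 * (g (2 * s)).re * (g (t - s)).re : ℝ) : ℂ) = ((g t).re : ℂ) := by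
      rw [hreal, ← h]
      refine integral_congr_ae (Filter.Eventually.of_forall fun s => ?_)
      simp [hreal, hg']
    rw [integral_complex_ofReal] at h4
    exact_mod_cast h4
  · obtain ⟨C, -, hC⟩ := g.exists_iteratedFDeriv_le_polyWeight 0
    refine ⟨C, fun t => (Complex.abs_re_le_norm _).trans ?_⟩
    simpa using hC t
  · obtain ⟨C, hC⟩ := g.exists_lipschitz_polyWeight
    refine ⟨C, fun s h hh => ?_⟩
    rw [← Complex.sub_re]
    exact (Complex.abs_re_le_norm _).trans (hC s h hh)

end Kernel

/-! ### Averages of functions of quadratic growth -/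

section KernelAverage

open MeasureTheory

theorem one_add_abs_add_sq_le (s t : ℝ) :
    (1 + |s + t|) ^ 2 ≤ (1 + |s|) ^ 2 * (1 + |t|) ^ 2 := by
  rw [← mul_pow]
  have := abs_add_le s t
  have h := mul_nonneg (abs_nonneg s) (abs_nonneg t)
  gcongr
  nlinarith

/-- `c` bounds the weighted `L¹`-norm of `φ` and its modulus of continuity in the weighted
`L¹`-norm. -/
structure KernelBound (φ : ℝ → ℝ) (c : ℝ) : Prop where
  one_le : 1 ≤ c
  moment : ∫ t, (1 + |t|) ^ 2 * |φ t| ≤ c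
  lipschitz : ∀ h, |h| ≤ 1 → ∫ t, (1 + |t|) ^ 2 * |φ (t - h) - φ t| ≤ c * |h|

namespace AveragingKernel

variable {φ : ℝ → ℝ} (K : AveragingKernel φ)

include K

theorem integrable_sq_mul : Integrable fun t => (1 + |t|) ^ 2 * |φ t| := by
  obtain ⟨C, hC⟩ := K.decay
  refine (integrable_sq_mul_polyWeight.const_mul C).mono' ?_ (Filter.Eventually.of_forall fun t => ?_)
  · have := K.continuous
    exact (by fun_prop : Continuous fun t => (1 + |t|) ^ 2 * |φ t|).aestronglyMeasurable
  · rw [Real.norm_eq_abs, abs_of_nonneg (by positivity)]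
    calc (1 + |t|) ^ 2 * |φ t| ≤ (1 + |t|) ^ 2 * (C * polyWeight t) := by gcongr; exact hC t
      _ = _ := by ring

theorem integrable_sq_mul_sub {h : ℝ} (hh : |h| ≤ 1) :
    Integrable fun t => (1 + |t|) ^ 2 * |φ (t - h) - φ t| := by
  obtain ⟨C, hC⟩ := K.lipschitz
  refine (integrable_sq_mul_polyWeight.const_mul (C * |h|)).mono' ?_
    (Filter.Eventually.of_forall fun t => ?_)
  · have := K.continuous
    exact (by fun_prop :
      Continuous fun t => (1 + |t|) ^ 2 * |φ (t - h) - φ t|).aestronglyMeasurable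
  · rw [Real.norm_eq_abs, abs_of_nonneg (by positivity)]
    calc (1 + |t|) ^ 2 * |φ (t - h) - φ t| ≤ (1 + |t|) ^ 2 * (C * |h| * polyWeight t) := by
          gcongr; exact hC t h hh
      _ = _ := by ring

theorem exists_kernelBound : ∃ c, KernelBound φ c := by
  obtain ⟨C, hC⟩ := K.lipschitz
  set A := ∫ t, (1 + |t|) ^ 2 * |φ t|
  set B := ∫ t, (1 + |t|) ^ 2 * polyWeight t
  refine ⟨max 1 (max A (C * B)), le_max_left _ _, (le_max_left _ _).trans (le_max_right _ _),
    fun h hh => ?_⟩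
  have h1 : ∫ t, (1 + |t|) ^ 2 * |φ (t - h) - φ t| ≤ ∫ t, C * |h| * ((1 + |t|) ^ 2 * polyWeight t) := by
    refine integral_mono (K.integrable_sq_mul_sub hh) (integrable_sq_mul_polyWeight.const_mul _)
      fun t => ?_
    calc (1 + |t|) ^ 2 * |φ (t - h) - φ t| ≤ (1 + |t|) ^ 2 * (C * |h| * polyWeight t) := by
          gcongr; exact hC t h hh
      _ = _ := by ring
  rw [integral_const_mul] at h1
  calc _ ≤ C * |h| * B := h1
    _ = C * B * |h| := by ring
    _ ≤ _ := by gcongr; exact (le_max_right _ _).trans (le_max_right _ _)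

end AveragingKernel

variable {E : Type*} [NormedAddCommGroup E] [NormedSpace ℝ E]

/-- The average of `f` with respect to the kernel `φ`. -/
noncomputable def kavg (φ : ℝ → ℝ) (f : ℝ → E) : E := ∫ t, φ t • f t

section QuadGrowth

variable {E : Type*} [NormedAddCommGroup E]

/-- Continuous functions of at most quadratic growth, with a constant. -/
structure QuadGrowth (f : ℝ → E) (B : ℝ) : Prop where
  continuous : Continuous f
  norm_le : ∀ t, ‖f t‖ ≤ B * (1 + |t|) ^ 2

theorem one_le_one_add_abs_sq (t : ℝ) : 1 ≤ (1 + |t|) ^ 2 :=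
  one_le_pow₀ (by linarith [abs_nonneg t])

theorem one_add_abs_le_sq (t : ℝ) : 1 + |t| ≤ (1 + |t|) ^ 2 :=
  le_self_pow₀ (by linarith [abs_nonneg t]) two_ne_zero

theorem QuadGrowth.nonneg {f : ℝ → E} {B : ℝ} (h : QuadGrowth f B) : 0 ≤ B := by
  have := (norm_nonneg _).trans (h.norm_le 0)
  simpa using this

theorem QuadGrowth.of_bounded {f : ℝ → E} {B : ℝ} (hf : Continuous f) (h : ∀ t, ‖f t‖ ≤ B) :
    QuadGrowth f B :=
  ⟨hf, fun t => (h t).trans (le_mul_of_one_le_right ((norm_nonneg _).trans (h t))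
    (one_le_one_add_abs_sq t))⟩

theorem QuadGrowth.of_linear {f : ℝ → E} {B : ℝ} (hf : Continuous f)
    (h : ∀ t, ‖f t‖ ≤ B * (1 + |t|)) : QuadGrowth f B := by
  have hB : 0 ≤ B := by simpa using (norm_nonneg _).trans (h 0)
  exact ⟨hf, fun t => (h t).trans (mul_le_mul_of_nonneg_left (one_add_abs_le_sq t) hB)⟩

end QuadGrowth

namespace AveragingKernel

variable {φ : ℝ → ℝ} (K : AveragingKernel φ) {c : ℝ} (hc : KernelBound φ c)

include K

theorem integrable_smul {f : ℝ → E} {B : ℝ} (hf : QuadGrowth f B) :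
    Integrable fun t => φ t • f t := by
  refine (K.integrable_sq_mul.const_mul B).mono'
    (K.continuous.smul hf.continuous).aestronglyMeasurable (Filter.Eventually.of_forall fun t => ?_)
  rw [norm_smul, Real.norm_eq_abs]
  calc |φ t| * ‖f t‖ ≤ |φ t| * (B * (1 + |t|) ^ 2) := by gcongr; exact hf.norm_le t
    _ = _ := by ring

theorem kavg_const [CompleteSpace E] (v : E) : kavg φ (fun _ => v) = v := by
  rw [kavg, integral_smul_const, K.integral_eq_one, one_smul]

theorem kavg_sub {f g : ℝ → E} {A B : ℝ} (hf : QuadGrowth f A) (hg : QuadGrowth g B) :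
    kavg φ (fun t => f t - g t) = kavg φ f - kavg φ g := by
  simp only [kavg, smul_sub]
  exact integral_sub (K.integrable_smul hf) (K.integrable_smul hg)

theorem kavg_add {f g : ℝ → E} {A B : ℝ} (hf : QuadGrowth f A) (hg : QuadGrowth g B) :
    kavg φ (fun t => f t + g t) = kavg φ f + kavg φ g := by
  simp only [kavg, smul_add]
  exact integral_add (K.integrable_smul hf) (K.integrable_smul hg)

omit K in
theorem kavg_smul (r : ℝ) (f : ℝ → E) : kavg φ (fun t => r • f t) = r • kavg φ f := by
  simp only [kavg, smul_comm _ r]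
  exact integral_smul _ _

theorem map_kavg [CompleteSpace E] {F : Type*} [NormedAddCommGroup F] [NormedSpace ℝ F]
    [CompleteSpace F] (T : E →L[ℝ] F)
    {f : ℝ → E} {B : ℝ} (hf : QuadGrowth f B) : T (kavg φ f) = kavg φ (fun t => T (f t)) := by
  simp only [kavg]
  rw [← T.integral_comp_comm (K.integrable_smul hf)]
  simp

include hc in
theorem norm_kavg_le {f : ℝ → E} {B : ℝ} (hf : ∀ t, ‖f t‖ ≤ B * (1 + |t|) ^ 2) :
    ‖kavg φ f‖ ≤ B * c := by
  have hB : 0 ≤ B := by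
    have := (norm_nonneg _).trans (hf 0)
    simpa using this
  have h := norm_integral_le_of_norm_le (f := fun t => φ t • f t) (K.integrable_sq_mul.const_mul B)
    (Filter.Eventually.of_forall fun t => ?_)
  · refine h.trans ?_
    rw [integral_const_mul]
    exact mul_le_mul_of_nonneg_left hc.moment hB
  · rw [norm_smul, Real.norm_eq_abs]
    calc |φ t| * ‖f t‖ ≤ |φ t| * (B * (1 + |t|) ^ 2) := by gcongr; exact hf t
      _ = _ := by ring

include hc in
theorem norm_kavg_le_of_bounded {f : ℝ → E} {B : ℝ} (hf : ∀ t, ‖f t‖ ≤ B) :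
    ‖kavg φ f‖ ≤ B * c :=
  K.norm_kavg_le hc fun t => (hf t).trans (le_mul_of_one_le_right ((norm_nonneg _).trans (hf t))
    (one_le_one_add_abs_sq t))

include hc in
-- The translation is moved onto the kernel, whose modulus of continuity is linear. Thus averages
-- are Lipschitz in the shift although `f` is merely continuous.
theorem norm_kavg_shift_sub_le {f : ℝ → E} {B : ℝ} (hf : QuadGrowth f B) {h : ℝ} (hh : |h| ≤ 1) :
    ‖kavg φ (fun t => f (t + h)) - kavg φ f‖ ≤ B * c * |h| := by
  have h1 : kavg φ (fun t => f (t + h)) = ∫ t, φ (t - h) • f t := by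
    rw [kavg, ← integral_sub_right_eq_self _ h]
    simp
  have hint : Integrable fun t => φ (t - h) • f t := by
    have hg : QuadGrowth (fun t => f (t + h)) (B * (1 + |h|) ^ 2) :=
      ⟨hf.continuous.comp (by fun_prop), fun t => (hf.norm_le _).trans (by
        have := one_add_abs_add_sq_le t h
        have := mul_le_mul_of_nonneg_left this hf.nonneg
        linarith)⟩
    simpa using (K.integrable_smul hg).comp_sub_right h
  rw [h1, kavg, ← integral_sub hint (K.integrable_smul hf)]
  have h2 := norm_integral_le_of_norm_le (f := fun t => φ (t - h) • f t - φ t • f t)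
    ((K.integrable_sq_mul_sub hh).const_mul B) (Filter.Eventually.of_forall fun t => ?_)
  · refine h2.trans ?_
    rw [integral_const_mul, mul_assoc]
    exact mul_le_mul_of_nonneg_left (hc.lipschitz h hh) hf.nonneg
  · rw [← sub_smul, norm_smul, Real.norm_eq_abs]
    calc |φ (t - h) - φ t| * ‖f t‖ ≤ |φ (t - h) - φ t| * (B * (1 + |t|) ^ 2) := by
          gcongr; exact hf.norm_le t
      _ = _ := by ring

theorem kavg_comm {F : ℝ → ℝ → E} (hF : Continuous (Function.uncurry F)) {B : ℝ}
    (hB : ∀ s t, ‖F s t‖ ≤ B * ((1 + |s|) ^ 2 * (1 + |t|) ^ 2)) :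
    kavg φ (fun s => kavg φ (fun t => F s t)) = kavg φ (fun t => kavg φ (fun s => F s t)) := by
  have hint : Integrable (Function.uncurry fun s t => φ s • φ t • F s t) (volume.prod volume) := by
    refine ((K.integrable_sq_mul.mul_prod K.integrable_sq_mul).const_mul B).mono' ?_
      (Filter.Eventually.of_forall fun p => ?_)
    · have := K.continuous
      exact Continuous.aestronglyMeasurable ((this.comp continuous_fst).smul
        ((this.comp continuous_snd).smul hF))
    · simp only [Function.uncurry, norm_smul, Real.norm_eq_abs]
      calc |φ p.1| * (|φ p.2| * ‖F p.1 p.2‖)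
          ≤ |φ p.1| * (|φ p.2| * (B * ((1 + |p.1|) ^ 2 * (1 + |p.2|) ^ 2))) := by
            gcongr; exact hB _ _
        _ = _ := by ring
  have h := integral_integral_swap hint
  simp only [kavg, ← integral_smul]
  rw [h]
  refine integral_congr_ae (Filter.Eventually.of_forall fun t =>
    integral_congr_ae (Filter.Eventually.of_forall fun s => ?_))
  exact smul_comm _ _ _

/-- With u = s/2 and Fubini, the double average is the integral of `f` against the convolution of
2φ(2·) with φ, which is φ again by `reproducing`. -/
theorem kavg_kavg_half [CompleteSpace E] {f : ℝ → E} {B : ℝ} (hf : QuadGrowth f B) :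
    kavg φ (fun s => kavg φ (fun r => f (s / 2 + r))) = kavg φ f := by
  have h1 : kavg φ (fun s => kavg φ (fun r => f (s / 2 + r))) =
      ∫ u, (2 * φ (2 * u)) • kavg φ (fun r => f (u + r)) := by
    have := Measure.integral_comp_mul_left
      (fun s => φ s • kavg φ (fun r => f (s / 2 + r))) (2 : ℝ)
    rw [kavg]
    simp only [mul_div_cancel_left₀ _ (two_ne_zero' ℝ)] at this
    simp only [mul_smul, integral_smul]
    rw [this, smul_smul]
    norm_num
  have h2 (u : ℝ) : kavg φ (fun r => f (u + r)) = ∫ t, φ (t - u) • f t := by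
    rw [kavg, ← integral_sub_right_eq_self _ u]
    simp
  have hk : Integrable fun u => (1 + |u|) ^ 2 * |2 * φ (2 * u)| := by
    have h3 := (K.integrable_sq_mul.comp_mul_left' (two_ne_zero' ℝ)).const_mul 2
    refine h3.mono' ?_ (Filter.Eventually.of_forall fun u => ?_)
    · have := K.continuous
      exact (by fun_prop : Continuous fun u => (1 + |u|) ^ 2 * |2 * φ (2 * u)|).aestronglyMeasurable
    · rw [Real.norm_eq_abs, abs_of_nonneg (by positivity), abs_mul, abs_two]
      have : (1 + |u|) ^ 2 ≤ (1 + |2 * u|) ^ 2 := by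
        refine pow_le_pow_left₀ (by positivity) ?_ 2
        rw [abs_mul, abs_two]; linarith [abs_nonneg u]
      have := mul_le_mul_of_nonneg_right this (by positivity : 0 ≤ 2 * |φ (2 * u)|)
      linarith
  have hint : Integrable (Function.uncurry fun t u => (2 * φ (2 * u)) • φ (t - u) • f t)
      (volume.prod volume) := by
    have h3 := Integrable.convolution_integrand (ContinuousLinearMap.mul ℝ ℝ)
      hk K.integrable_sq_mul
    refine (h3.const_mul B).mono' ?_ (Filter.Eventually.of_forall fun p => ?_)
    · have := K.continuous
      have := hf.continuous
      exact Continuous.aestronglyMeasurable (by unfold Function.uncurry; fun_prop)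
    · simp only [Function.uncurry, norm_smul, Real.norm_eq_abs, ContinuousLinearMap.mul_apply']
      have h4 := one_add_abs_add_sq_le p.2 (p.1 - p.2)
      rw [add_sub_cancel] at h4
      calc |2 * φ (2 * p.2)| * (|φ (p.1 - p.2)| * ‖f p.1‖)
          ≤ |2 * φ (2 * p.2)| * (|φ (p.1 - p.2)| *
              (B * ((1 + |p.2|) ^ 2 * (1 + |p.1 - p.2|) ^ 2))) := by
            gcongr
            exact (hf.norm_le _).trans (mul_le_mul_of_nonneg_left h4 hf.nonneg)
        _ = _ := by ring
  rw [h1]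
  simp only [h2, ← integral_smul]
  rw [← integral_integral_swap hint, kavg]
  refine integral_congr_ae (Filter.Eventually.of_forall fun t => ?_)
  simp only [smul_smul]
  rw [integral_smul_const, K.reproducing t]

end AveragingKernel

end KernelAverage

/-! ### Isometric flows, spectral cut-offs and uniform convexity -/

section IsometricFlow

open MeasureTheory

/-- A strongly continuous one-parameter group of linear isometries. -/
structure IsomFlow (E : Type*) [NormedAddCommGroup E] [NormedSpace ℝ E] where
  toFun : ℝ → E →L[ℝ] E
  map_add : ∀ s t, toFun (s + t) = toFun s * toFun t
  map_zero : toFun 0 = 1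
  norm_map : ∀ t v, ‖toFun t v‖ = ‖v‖
  continuous : ∀ v, Continuous fun t => toFun t v

variable {E : Type*} [NormedAddCommGroup E] [NormedSpace ℝ E]

instance : CoeFun (IsomFlow E) fun _ => ℝ → E →L[ℝ] E := ⟨IsomFlow.toFun⟩

namespace IsomFlow

/-- Change of the time scale. -/
def scale (x : IsomFlow E) (μ : ℝ) : IsomFlow E where
  toFun t := x (μ * t)
  map_add s t := by rw [mul_add, x.map_add]
  map_zero := by rw [mul_zero, x.map_zero]
  norm_map t v := x.norm_map _ v
  continuous _ := (x.continuous _).comp (by fun_prop)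

@[simp] theorem scale_apply (x : IsomFlow E) (μ t : ℝ) : x.scale μ t = x (μ * t) := rfl

theorem commute (x : IsomFlow E) (s t : ℝ) : Commute (x s) (x t) := by
  rw [Commute, SemiconjBy, ← x.map_add, ← x.map_add, add_comm]

theorem norm_le_one (x : IsomFlow E) (t : ℝ) : ‖x t‖ ≤ 1 :=
  ContinuousLinearMap.opNorm_le_bound _ zero_le_one fun v => by rw [x.norm_map, one_mul]

theorem norm_sub_le_nat (x : IsomFlow E) (n : ℕ) (t : ℝ) (v : E) :
    ‖x (n * t) v - v‖ ≤ n * ‖x t v - v‖ := by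
  induction n with
  | zero => simp [x.map_zero]
  | succ n ih =>
    have h : x ((n + 1 : ℕ) * t) v - v = x (n * t) (x t v - v) + (x (n * t) v - v) := by
      push_cast
      rw [add_mul, one_mul, x.map_add, map_sub, mul_apply_eq_comp]
      abel
    rw [h]
    refine (norm_add_le _ _).trans ?_
    rw [x.norm_map]
    push_cast
    linarith

theorem norm_neg_sub (x : IsomFlow E) (t : ℝ) (v : E) : ‖x (-t) v - v‖ = ‖x t v - v‖ := by
  rw [← x.norm_map t (x (-t) v - v), map_sub, ← mul_apply_eq_comp, ← x.map_add,
    add_neg_cancel, x.map_zero, norm_sub_rev]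
  rfl

/-- The displacement at time `t` in terms of that at time `a` and of those at times below `a`. -/
theorem norm_sub_le_of_small (x : IsomFlow E) {a b : ℝ} (ha : 0 < a) (v : E)
    (hb : ∀ s, |s| ≤ a → ‖x s v - v‖ ≤ b) (t : ℝ) :
    ‖x t v - v‖ ≤ |t| / a * ‖x a v - v‖ + b := by
  wlog ht : 0 ≤ t generalizing t
  · have := this (-t) (by linarith)
    rwa [x.norm_neg_sub, abs_neg] at this
  rw [abs_of_nonneg ht]
  -- Split t into n full steps of length a, each costing the displacement at time a, and a remainder
  -- in [0, a], which costs at most b.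
  set n := ⌊t / a⌋₊ with hn
  have hn1 : (n : ℝ) ≤ t / a := Nat.floor_le (by positivity)
  have hn2 : t / a < n + 1 := Nat.lt_floor_add_one _
  have h1 : n * a ≤ t := by rwa [le_div_iff₀ ha] at hn1
  have h2 : t - n * a ≤ a := by
    rw [div_lt_iff₀ ha] at hn2
    linarith
  have h : x t v - v = x (n * a) (x (t - n * a) v - v) + (x (n * a) v - v) := by
    rw [map_sub, ← mul_apply_eq_comp, ← x.map_add, add_sub_cancel]
    abel
  rw [h]
  refine (norm_add_le _ _).trans ?_
  rw [x.norm_map, add_comm]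
  refine add_le_add ((x.norm_sub_le_nat n a v).trans ?_) (hb _ ?_)
  · gcongr
  · rw [abs_of_nonneg (by linarith)]
    exact h2

end IsomFlow

namespace AveragingKernel

variable {φ : ℝ → ℝ} (K : AveragingKernel φ) {c : ℝ} (hc : KernelBound φ c)

omit K in
theorem quadGrowth_flow (x : IsomFlow E) (l : ℝ) (v : E) :
    QuadGrowth (fun t => x (l * t) v) ‖v‖ :=
  .of_bounded ((x.scale l).continuous v) fun _ => (x.norm_map _ v).le

/-- The average of a flow at the time scale `l`. -/
noncomputable def op (x : IsomFlow E) (l : ℝ) : E →L[ℝ] E :=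
  LinearMap.mkContinuousOfExistsBound
    { toFun := fun v => kavg φ fun t => x (l * t) v
      map_add' := fun v w => by
        simp only [map_add]
        exact K.kavg_add (quadGrowth_flow x l v) (quadGrowth_flow x l w)
      map_smul' := fun r v => by
        simp only [map_smul]
        exact kavg_smul r _ }
    (by
      obtain ⟨c, hc⟩ := K.exists_kernelBound
      refine ⟨c, fun v => ?_⟩
      rw [mul_comm]
      exact K.norm_kavg_le_of_bounded hc fun t => (x.norm_map _ v).le)

theorem op_apply (x : IsomFlow E) (l : ℝ) (v : E) :
    K.op x l v = kavg φ fun t => x (l * t) v := rfl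

theorem op_scale (x : IsomFlow E) (μ l : ℝ) : K.op (x.scale μ) l = K.op x (μ * l) := by
  ext v
  simp only [op_apply, IsomFlow.scale_apply, mul_assoc]

include hc in
theorem norm_op_le (x : IsomFlow E) (l : ℝ) : ‖K.op x l‖ ≤ c := by
  refine ContinuousLinearMap.opNorm_le_bound _ (zero_le_one.trans hc.one_le) fun v => ?_
  rw [mul_comm, op_apply]
  exact K.norm_kavg_le_of_bounded hc fun t => (x.norm_map _ v).le

variable [CompleteSpace E]

include hc in
-- A commutator bound that is linear in the time integrates to the same bound at time `l`, times a
-- moment of the kernel.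
theorem norm_mul_op_sub_le (T : E →L[ℝ] E) (x : IsomFlow E) (l : ℝ) {η : ℝ} (hη : 0 ≤ η)
    (h : ∀ t, ‖T * x t - x t * T‖ ≤ η * |t|) :
    ‖T * K.op x l - K.op x l * T‖ ≤ η * |l| * c := by
  have hc0 := zero_le_one.trans hc.one_le
  refine ContinuousLinearMap.opNorm_le_bound _ (by positivity) fun v => ?_
  simp only [sub_apply, mul_apply_eq_comp, op_apply]
  rw [K.map_kavg T (quadGrowth_flow x l v), ← K.kavg_sub
    (f := fun t => T (x (l * t) v)) (A := ‖T‖ * ‖v‖)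
    (QuadGrowth.of_bounded (T.continuous.comp ((x.scale l).continuous v))
      fun t => (T.le_opNorm _).trans (by rw [x.norm_map]))
    (quadGrowth_flow x l (T v))]
  refine (K.norm_kavg_le hc (B := η * |l| * ‖v‖) fun t => ?_).trans (le_of_eq (by ring))
  have h1 := (T * x (l * t) - x (l * t) * T).le_opNorm v
  simp only [sub_apply, mul_apply_eq_comp] at h1
  refine h1.trans ((mul_le_mul_of_nonneg_right (h _) (norm_nonneg v)).trans ?_)
  rw [abs_mul]
  have h2 : |t| ≤ (1 + |t|) ^ 2 := by nlinarith [abs_nonneg t]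
  calc η * (|l| * |t|) * ‖v‖ = η * |l| * ‖v‖ * |t| := by ring
    _ ≤ _ := by gcongr

theorem commute_op (T : E →L[ℝ] E) (x : IsomFlow E) (l : ℝ) (h : ∀ t, Commute T (x t)) :
    Commute T (K.op x l) := by
  obtain ⟨c, hc⟩ := K.exists_kernelBound
  have := K.norm_mul_op_sub_le hc T x l le_rfl fun t => by
    rw [(h t).eq, sub_self]; simp
  rw [zero_mul, zero_mul, norm_le_zero_iff, sub_eq_zero] at this
  exact this

theorem op_commute_op (x : IsomFlow E) (l m : ℝ) : Commute (K.op x l) (K.op x m) :=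
  K.commute_op _ _ _ fun t => (K.commute_op _ _ _ fun s => x.commute t s).symm

/-- In spectral terms `op x l` is the multiplier b(lξ): it keeps the frequencies up to 1/l and kills
those beyond 2/l. So the cut-off at scale l/2 is the identity on everything that the one at scale l
lets through. -/
theorem op_half_mul_op (x : IsomFlow E) (l : ℝ) : K.op x (l / 2) * K.op x l = K.op x l := by
  ext v
  have h := K.kavg_kavg_half (f := fun t => x (l * t) v) (quadGrowth_flow x l v)
  rw [op_apply, ← h, mul_apply_eq_comp, op_apply]
  congr 1
  funext s
  rw [op_apply, K.map_kavg _ (quadGrowth_flow x l v)]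
  congr 1
  funext r
  rw [← mul_apply_eq_comp, ← x.map_add]
  congr 2
  ring

theorem op_mul_op_of_lt (x : IsomFlow E) (l : ℝ) (k : ℕ) :
    K.op x (l / 2 ^ (k + 1)) * K.op x l = K.op x l := by
  induction k with
  | zero => simpa using K.op_half_mul_op x l
  | succ k ih =>
    have h := K.op_half_mul_op x (l / 2 ^ (k + 1))
    rw [div_div, ← pow_succ] at h
    rw [← ih, ← mul_assoc, h]

theorem op_mul_op (x : IsomFlow E) (l : ℝ) (k : ℕ) {m : ℝ} (h : l = m * 2 ^ (k + 1)) :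
    K.op x m * K.op x l = K.op x l ∧ K.op x l * K.op x m = K.op x l := by
  have h1 := K.op_mul_op_of_lt x l k
  have h2 : l / 2 ^ (k + 1) = m := by rw [h]; field_simp
  rw [h2] at h1
  exact ⟨h1, by rw [(K.op_commute_op x l m).eq, h1]⟩

include hc in
-- A Bernstein inequality: vectors of frequency at most of order 1/|l| move slowly. For |h| ≤ |l|
-- the shift falls on the kernel; for larger |h| the trivial bound 2c is enough, whence the factor
-- 2.
theorem norm_flow_sub_one_mul_op_le (x : IsomFlow E) {l : ℝ} (hl : l ≠ 0) (h : ℝ) :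
    ‖(x h - 1) * K.op x l‖ ≤ 2 * c * |h| / |l| := by
  have hc0 := zero_le_one.trans hc.one_le
  have hl' := abs_pos.2 hl
  by_cases hh : |h / l| ≤ 1
  · refine ContinuousLinearMap.opNorm_le_bound _ (by positivity) fun v => ?_
    have h1 := K.norm_kavg_shift_sub_le hc (quadGrowth_flow x l v) hh
    have h2 : ((x h - 1) * K.op x l) v =
        kavg φ (fun t => x (l * (t + h / l)) v) - kavg φ (fun t => x (l * t) v) := by
      rw [mul_apply_eq_comp, sub_apply, op_apply,
        K.map_kavg _ (quadGrowth_flow x l v)]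
      congr 2
      funext t
      rw [← mul_apply_eq_comp, ← x.map_add]
      congr 2
      field_simp
      ring
    rw [h2]
    refine h1.trans ?_
    rw [abs_div]
    have : 0 ≤ c * |h| / |l| * ‖v‖ := by positivity
    calc ‖v‖ * c * (|h| / |l|) = c * |h| / |l| * ‖v‖ := by ring
      _ ≤ 2 * (c * |h| / |l| * ‖v‖) := by linarith
      _ = _ := by ring
  · rw [abs_div, not_le, one_lt_div hl'] at hh
    calc ‖(x h - 1) * K.op x l‖ ≤ ‖x h - 1‖ * ‖K.op x l‖ := norm_mul_le _ _
      _ ≤ (1 + 1) * c := by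
        gcongr
        · refine (norm_sub_le _ _).trans (add_le_add (x.norm_le_one h) ?_)
          exact ContinuousLinearMap.norm_id_le
        · exact K.norm_op_le hc x l
      _ ≤ (1 + 1) * c * (|h| / |l|) := by
        refine le_mul_of_one_le_right (by positivity) ?_
        rw [one_le_div hl']; exact hh.le
      _ = _ := by ring

end AveragingKernel

/-- Uniform convexity at the single parameter `ε`. -/
def ConvexAt (E : Type*) [NormedAddCommGroup E] (ε δ : ℝ) : Prop :=
  ∀ u v : E, ‖u‖ ≤ 1 → ‖v‖ ≤ 1 → ε ≤ ‖u - v‖ → ‖u + v‖ ≤ 2 - δ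

theorem ConvexAt.norm_sub_le_of_lt {ε δ : ℝ} (hE : ConvexAt E ε δ) {u v : E} {r : ℝ} (hu : ‖u‖ ≤ r)
    (hv : ‖v‖ ≤ r) (h : (2 - δ) * r < ‖u + v‖) : ‖u - v‖ ≤ ε * r := by
  rcases (norm_nonneg u |>.trans hu).eq_or_lt with hr | hr
  · subst hr
    have h1 : u = 0 := by simpa using hu
    have h2 : v = 0 := by simpa using hv
    simp [h1, h2]
  by_contra hcon
  push Not at hcon
  have hs (w : E) : ‖r⁻¹ • w‖ = r⁻¹ * ‖w‖ := by
    rw [norm_smul, Real.norm_eq_abs, abs_of_pos (inv_pos.2 hr)]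
  have := hE (r⁻¹ • u) (r⁻¹ • v) (by rw [hs, inv_mul_le_iff₀ hr, mul_one]; exact hu)
    (by rw [hs, inv_mul_le_iff₀ hr, mul_one]; exact hv)
    (by rw [← smul_sub, hs, le_inv_mul_iff₀ hr]; linarith)
  rw [← smul_add, hs, inv_mul_le_iff₀ hr] at this
  linarith

theorem ConvexAt.norm_half_add_le {ε δ : ℝ} (hE : ConvexAt E ε δ) {T : E →L[ℝ] E} {u : E}
    (hT : ‖T u‖ = ‖u‖) (h : (1 - δ / 2) * ‖u‖ < ‖(1 / 2 : ℝ) • (u + T u)‖) :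
    ‖T u - u‖ ≤ ε * ‖u‖ := by
  rw [norm_sub_rev]
  refine hE.norm_sub_le_of_lt le_rfl hT.le ?_
  rw [norm_smul] at h
  norm_num at h
  linarith

/-- In a uniformly convex space, a vector that is moved by the commutator of two isometries
is shortened by averaging. -/
theorem ConvexAt.norm_half_half_le [CompleteSpace E] {φ : ℝ → ℝ} (K : AveragingKernel φ) {c : ℝ}
    (hc : KernelBound φ c) {a ε δ : ℝ} (ha : a = 1 / (32 * c ^ 2)) (hε : ε = a / (192 * c))
    (hδ : δ ≤ 1) (hE : ConvexAt E ε δ) (z : IsomFlow E) {X Y : E →L[ℝ] E}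
    (hX : ∀ v, ‖X v‖ = ‖v‖) (hY : ∀ v, ‖Y v‖ = ‖v‖) {u : E} {e : ℝ}
    (hXY : ‖X (Y u) - Y (X (z a u))‖ ≤ e) (h8 : ‖K.op z 8 u‖ ≤ e)
    (h4 : ‖u - K.op z (1 / 4) u‖ ≤ e) :
    ‖(1 / 2 : ℝ) • ((1 / 2 : ℝ) • (u + Y u) + X ((1 / 2 : ℝ) • (u + Y u)))‖ ≤
      (1 - δ / 2) * ‖u‖ + 2 * (1 + 8 * c / a + 2 * c) * e := by
  have hc1 := hc.one_le
  have hc0 : 0 < c := by linarith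
  have ha0 : 0 < a := by rw [ha]; positivity
  have hε0 : 0 < ε := by rw [hε]; positivity
  have he : 0 ≤ e := (norm_nonneg _).trans h8
  set w := (1 / 2 : ℝ) • (u + Y u) with hw
  have hwu : ‖w‖ ≤ ‖u‖ := by
    rw [hw, norm_smul]
    have := norm_add_le u (Y u)
    rw [hY] at this
    norm_num
    linarith
  have hww : ‖(1 / 2 : ℝ) • (w + X w)‖ ≤ ‖w‖ := by
    rw [norm_smul]
    have := norm_add_le w (X w)
    rw [hX] at this
    norm_num
    linarith
  -- If the double mean lost less than claimed, uniform convexity would force `Y u` to be close to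
  -- `u`, and `X w` to be close to `w`, hence `X u` to be close to `u`.
  by_contra hcon
  push Not at hcon
  have hC : 0 ≤ 2 * (1 + 8 * c / a + 2 * c) * e := by positivity
  have hbig : (1 - δ / 2) * ‖u‖ < ‖(1 / 2 : ℝ) • (w + X w)‖ := by linarith
  have h1 : ‖Y u - u‖ ≤ ε * ‖u‖ := hE.norm_half_add_le (hY u) (by linarith)
  have h2 : ‖X w - w‖ ≤ ε * ‖w‖ := by
    refine hE.norm_half_add_le (hX w) (lt_of_le_of_lt ?_ hbig)
    exact mul_le_mul_of_nonneg_left hwu (by linarith)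
  have h3 : ‖u - w‖ ≤ ε / 2 * ‖u‖ := by
    have : u - w = (1 / 2 : ℝ) • (u - Y u) := by rw [hw]; module
    rw [this, norm_smul, norm_sub_rev]
    norm_num
    linarith
  have h4' : ‖X u - u‖ ≤ 2 * ε * ‖u‖ := by
    have : X u - u = X (u - w) + (X w - w) - (u - w) := by rw [map_sub]; abel
    rw [this]
    refine (norm_sub_le _ _).trans ?_
    have := norm_add_le (X (u - w)) (X w - w)
    rw [hX] at this
    have := mul_le_mul_of_nonneg_left hwu hε0.le
    linarith
  have h5 : ‖X (Y u) - u‖ ≤ 3 * ε * ‖u‖ := by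
    have : X (Y u) - u = X (Y u - u) + (X u - u) := by rw [map_sub]; abel
    rw [this]
    refine (norm_add_le _ _).trans ?_
    rw [hX]; linarith
  have h6 : ‖Y (X u) - u‖ ≤ 3 * ε * ‖u‖ := by
    have : Y (X u) - u = Y (X u - u) + (Y u - u) := by rw [map_sub]; abel
    rw [this]
    refine (norm_add_le _ _).trans ?_
    rw [hY]; linarith
  -- Both `X (Y u)` and `Y (X u)` are near `u`, so the commutator, up to the error `e`, also nearly
  -- fixes `u`.
  have hβ : ‖z a u - u‖ ≤ 6 * ε * ‖u‖ + e := by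
    have h7 : ‖z a u - u‖ = ‖Y (X (z a u)) - Y (X u)‖ := by
      rw [← map_sub, ← map_sub, hY, hX]
    have h9 : Y (X (z a u)) - Y (X u) =
        (X (Y u) - u) - (X (Y u) - Y (X (z a u))) - (Y (X u) - u) := by abel
    rw [h7, h9]
    refine (norm_sub_le _ _).trans ?_
    have := norm_sub_le (X (Y u) - u) (X (Y u) - Y (X (z a u)))
    linarith
  have hsmall (s : ℝ) (hs : |s| ≤ a) : ‖z s u - u‖ ≤ 2 * e + 8 * c * a * ‖u‖ := by
    have h7 : z s u - u = z s (u - K.op z (1 / 4) u) - (u - K.op z (1 / 4) u) +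
        ((z s - 1) * K.op z (1 / 4)) u := by
      rw [map_sub, mul_apply_eq_comp, sub_apply,
        one_apply_eq_self]
      abel
    rw [h7]
    refine (norm_add_le _ _).trans (add_le_add ?_ ?_)
    · refine (norm_sub_le _ _).trans ?_
      rw [z.norm_map]; linarith
    · refine (ContinuousLinearMap.le_opNorm _ _).trans ?_
      gcongr
      refine (K.norm_flow_sub_one_mul_op_le hc z (by norm_num) s).trans ?_
      rw [abs_of_pos (by norm_num : (0 : ℝ) < 1 / 4)]
      have := mul_le_mul_of_nonneg_left hs hc0.le
      calc 2 * c * |s| / (1 / 4) = 8 * (c * |s|) := by ring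
        _ ≤ 8 * (c * a) := by gcongr
        _ = _ := by ring
  -- A small displacement at time `a` gives one growing slowly at all times. Hence the average of
  -- `u` at scale 8 is near `u`; but it is also nearly 0 by `h8`.
  have hall := fun t => z.norm_sub_le_of_small ha0 u hsmall t
  have hsub : ‖K.op z 8 u - u‖ ≤
      (8 / a * (6 * ε * ‖u‖ + e) + (2 * e + 8 * c * a * ‖u‖)) * c := by
    have h7 : K.op z 8 u - u = kavg φ fun t => z (8 * t) u - u := by
      rw [K.kavg_sub (AveragingKernel.quadGrowth_flow z 8 u)
        (QuadGrowth.of_bounded continuous_const fun _ => le_rfl), K.kavg_const, K.op_apply]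
    rw [h7]
    refine K.norm_kavg_le hc fun t => (hall (8 * t)).trans ?_
    rw [abs_mul, abs_of_pos (by norm_num : (0 : ℝ) < 8), add_mul]
    have h10 : |t| ≤ (1 + |t|) ^ 2 := by nlinarith [abs_nonneg t]
    refine add_le_add ?_ (le_mul_of_one_le_right (by positivity) (one_le_one_add_abs_sq t))
    calc 8 * |t| / a * ‖z a u - u‖ = 8 / a * ‖z a u - u‖ * |t| := by ring
      _ ≤ _ := by gcongr
  have hu : ‖u‖ ≤ e + (8 / a * (6 * ε * ‖u‖ + e) + (2 * e + 8 * c * a * ‖u‖)) * c := by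
    have : u = K.op z 8 u - (K.op z 8 u - u) := by abel
    calc ‖u‖ = ‖K.op z 8 u - (K.op z 8 u - u)‖ := by rw [← this]
      _ ≤ _ := (norm_sub_le _ _).trans (add_le_add h8 hsub)
  -- The values of `ε` and `a` are made so that each of the two terms proportional to ‖u‖ is a
  -- quarter of it. Both are absorbed on the left, which leaves ‖u‖ = O(e).
  have e1 : 8 / a * (6 * ε * ‖u‖) * c = 1 / 4 * ‖u‖ := by
    rw [hε]; field_simp; ring
  have e2 : 8 * c * a * ‖u‖ * c = 1 / 4 * ‖u‖ := by
    rw [ha]; field_simp; ring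
  have e3 : 8 / a * e * c = 8 * c / a * e := by ring
  have hfin : ‖u‖ ≤ 2 * (1 + 8 * c / a + 2 * c) * e := by nlinarith
  have : 0 ≤ (1 - δ / 2) * ‖u‖ := mul_nonneg (by linarith) (norm_nonneg u)
  linarith

end IsometricFlow

/-! ### Telescoping for products of contractions -/

section OperatorProducts

variable {E : Type*} [NormedAddCommGroup E] [NormedSpace ℝ E] {ι : Type*}

theorem norm_list_map_prod_le_one {f : ι → E →L[ℝ] E} (hf : ∀ i, ‖f i‖ ≤ 1) (l : List ι) :
    ‖(l.map f).prod‖ ≤ 1 := by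
  induction l with
  | nil => exact ContinuousLinearMap.norm_id_le
  | cons i l ih =>
    rw [List.map_cons, List.prod_cons]
    exact (norm_mul_le _ _).trans (mul_le_one₀ (hf i) (norm_nonneg _) ih)

theorem norm_list_prod_mul_sub_le {f g : ι → E →L[ℝ] E} (hf : ∀ i, ‖f i‖ ≤ 1)
    (hg : ∀ i, ‖g i‖ ≤ 1) (B : E →L[ℝ] E) {e : ℝ} (l : List ι)
    (h : ∀ i ∈ l, ‖f i * B - B * g i‖ ≤ e) :
    ‖(l.map f).prod * B - B * (l.map g).prod‖ ≤ l.length * e := by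
  induction l with
  | nil => simp
  | cons i l ih =>
    have h1 := ih fun i hi => h i (List.mem_cons_of_mem _ hi)
    have h2 := h i List.mem_cons_self
    simp only [List.map_cons, List.prod_cons, List.length_cons]
    set F := (l.map f).prod
    set G := (l.map g).prod
    have key : f i * F * B - B * (g i * G) = f i * (F * B - B * G) + (f i * B - B * g i) * G := by
      noncomm_ring
    have hG : ‖G‖ ≤ 1 := norm_list_map_prod_le_one hg l
    have he : 0 ≤ e := (norm_nonneg _).trans h2
    rw [key]
    calc _ ≤ ‖f i‖ * ‖F * B - B * G‖ + ‖f i * B - B * g i‖ * ‖G‖ :=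
          (norm_add_le _ _).trans (add_le_add (norm_mul_le _ _) (norm_mul_le _ _))
      _ ≤ 1 * (l.length * e) + e * 1 := by gcongr; exact hf i
      _ = _ := by push_cast; ring

/-- Telescoping in which the factors before the changed one are still those of `f` and those after
it are already those of `g`. The complete product with `W` is kept in each term, so that its
smallness can be used and not only that of `g p - f p`. -/
theorem norm_list_prod_sub_mul_le {f g : ι → E →L[ℝ] E} (W : E →L[ℝ] E) (τ : ι → ℝ)
    (l : List ι) (h : ∀ l₁ p l₂, l = l₁ ++ p :: l₂ →
      ‖(l₁.map f).prod * (g p - f p) * (l₂.map g).prod * W‖ ≤ τ p) :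
    ‖((l.map g).prod - (l.map f).prod) * W‖ ≤ (l.map τ).sum := by
  -- The factors already passed must be remembered in the induction, since the hypothesis speaks of
  -- complete products.
  suffices H : ∀ pre : List ι, (∀ l₁ p l₂, l = l₁ ++ p :: l₂ →
      ‖((pre ++ l₁).map f).prod * (g p - f p) * (l₂.map g).prod * W‖ ≤ τ p) →
      ‖(pre.map f).prod * ((l.map g).prod - (l.map f).prod) * W‖ ≤ (l.map τ).sum by
    simpa using H [] (by simpa using h)
  clear h
  induction l with
  | nil => intro pre _; simp
  | cons p l ih =>
    intro pre h
    have h1 := h [] p l rfl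
    have h2 := ih (pre ++ [p]) fun l₁ q l₂ hl => by
      have := h (p :: l₁) q l₂ (by rw [hl]; rfl)
      simpa [mul_assoc] using this
    simp only [List.append_nil, List.map_append, List.prod_append, List.map_cons, List.map_nil,
      List.prod_cons, List.prod_nil, mul_one, List.sum_cons] at h1 h2 ⊢
    set A := (pre.map f).prod
    set F := (l.map f).prod
    set G := (l.map g).prod
    have key : A * (g p * G - f p * F) * W =
        A * (g p - f p) * G * W + A * f p * (G - F) * W := by noncomm_ring
    rw [key]
    exact (norm_add_le _ _).trans (add_le_add h1 h2)

/-- The mean `(1 + T) / 2`. -/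
noncomputable def halfAdd (T : E →L[ℝ] E) : E →L[ℝ] E := (1 / 2 : ℝ) • (1 + T)

theorem norm_halfAdd_le {T : E →L[ℝ] E} (hT : ∀ v, ‖T v‖ = ‖v‖) : ‖halfAdd T‖ ≤ 1 := by
  refine ContinuousLinearMap.opNorm_le_bound _ zero_le_one fun v => ?_
  have : halfAdd T v = (1 / 2 : ℝ) • (v + T v) := rfl
  rw [this, norm_smul]
  have := norm_add_le v (T v)
  rw [hT] at this
  norm_num
  linarith

theorem Commute.halfAdd_right {S T : E →L[ℝ] E} (h : Commute S T) : Commute S (halfAdd T) :=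
  ((Commute.one_right S).add_right h).smul_right _

theorem halfAdd_mul_sub_mul_halfAdd (S T B : E →L[ℝ] E) :
    halfAdd S * B - B * halfAdd T = (1 / 2 : ℝ) • (S * B - B * T) := by
  simp only [halfAdd, smul_mul_assoc, mul_smul_comm, ← smul_sub]
  congr 1
  noncomm_ring

theorem norm_halfAdd_mul_sub_le {S T B : E →L[ℝ] E} {e : ℝ} (h : ‖S * B - B * T‖ ≤ e) :
    ‖halfAdd S * B - B * halfAdd T‖ ≤ e := by
  rw [halfAdd_mul_sub_mul_halfAdd, norm_smul]
  have := norm_nonneg (S * B - B * T)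
  norm_num
  linarith

end OperatorProducts

/-! ### Approximate Heisenberg groups and products of means -/

section ApproximateHeisenberg

variable {E : Type*} [NormedAddCommGroup E] [NormedSpace ℝ E]

/-- Isometries `x i`, `y i` for `i < n` and a flow `z` such that, up to an error `η`, the flow `z`
is central and `x i`, `y j` have the commutator `z (a / R ^ (j - i))`, for `i ≤ j`. -/
structure ApproxHeisenberg (z : IsomFlow E) (x y : ℕ → E →L[ℝ] E) (a R η : ℝ) (n : ℕ) : Prop where
  norm_x : ∀ i v, ‖x i v‖ = ‖v‖
  norm_y : ∀ i v, ‖y i v‖ = ‖v‖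
  commute_yz : ∀ i t, Commute (y i) (z t)
  commute_yy : ∀ i j, Commute (y i) (y j)
  comm_xz : ∀ i t, i < n → ‖x i * z t - z t * x i‖ ≤ η * |t|
  comm_xy : ∀ i j, i ≤ j → j < n → ‖x i * y j - y j * x i * z (a / R ^ (j - i))‖ ≤ η

namespace ApproxHeisenberg

variable {z : IsomFlow E} {x y : ℕ → E →L[ℝ] E} {a R η : ℝ} {n : ℕ}

/-- The product of the means of `x i * z α` over a list of pairs `(i, α)`. -/
noncomputable def prodX (x : ℕ → E →L[ℝ] E) (z : IsomFlow E) (l : List (ℕ × ℝ)) : E →L[ℝ] E :=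
  (l.map fun p => halfAdd (x p.1 * z p.2)).prod

/-- The product of the means of `y i` over a list of pairs `(i, α)`. -/
noncomputable def prodY (y : ℕ → E →L[ℝ] E) (l : List (ℕ × ℝ)) : E →L[ℝ] E :=
  (l.map fun p => halfAdd (y p.1)).prod

/-- The change of the phases under conjugation with `y j`. -/
noncomputable def shift (a R : ℝ) (j : ℕ) (p : ℕ × ℝ) : ℕ × ℝ := (p.1, p.2 + a / R ^ (j - p.1))

theorem prodX_append (l₁ l₂ : List (ℕ × ℝ)) :
    prodX x z (l₁ ++ l₂) = prodX x z l₁ * prodX x z l₂ := by simp [prodX]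

theorem prodX_cons (p : ℕ × ℝ) (l : List (ℕ × ℝ)) :
    prodX x z (p :: l) = halfAdd (x p.1 * z p.2) * prodX x z l := by simp [prodX]

theorem prodY_append (l₁ l₂ : List (ℕ × ℝ)) :
    prodY y (l₁ ++ l₂) = prodY y l₁ * prodY y l₂ := by simp [prodY]

theorem prodY_cons (p : ℕ × ℝ) (l : List (ℕ × ℝ)) :
    prodY y (p :: l) = halfAdd (y p.1) * prodY y l := by simp [prodY]

theorem prodY_map_shift (j : ℕ) (l : List (ℕ × ℝ)) :
    prodY y (l.map (shift a R j)) = prodY y l := by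
  simp [prodY, shift, Function.comp_def]

variable (H : ApproxHeisenberg z x y a R η n)

include H

theorem norm_xz (i : ℕ) (t : ℝ) (v : E) : ‖(x i * z t) v‖ = ‖v‖ := by
  rw [mul_apply_eq_comp, H.norm_x, z.norm_map]

theorem norm_halfAdd_xz_le (i : ℕ) (t : ℝ) : ‖halfAdd (x i * z t)‖ ≤ 1 :=
  norm_halfAdd_le (T := x i * z t) fun v => H.norm_xz i t v

theorem norm_halfAdd_y_le (i : ℕ) : ‖halfAdd (y i)‖ ≤ 1 :=
  norm_halfAdd_le (T := y i) fun v => H.norm_y i v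

theorem norm_prodX_le (l : List (ℕ × ℝ)) : ‖prodX x z l‖ ≤ 1 :=
  norm_list_map_prod_le_one (f := fun p : ℕ × ℝ => halfAdd (x p.1 * z p.2))
    (fun p => H.norm_halfAdd_xz_le p.1 p.2) l

theorem norm_prodY_le (l : List (ℕ × ℝ)) : ‖prodY y l‖ ≤ 1 :=
  norm_list_map_prod_le_one (f := fun p : ℕ × ℝ => halfAdd (y p.1))
    (fun p => H.norm_halfAdd_y_le p.1) l

theorem norm_y_le (i : ℕ) : ‖y i‖ ≤ 1 :=
  ContinuousLinearMap.opNorm_le_bound _ zero_le_one fun v => by rw [H.norm_y, one_mul]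

omit H in
theorem commute_prodY {T : E →L[ℝ] E} (h : ∀ i, Commute T (y i)) (l : List (ℕ × ℝ)) :
    Commute T (prodY y l) := by
  refine Commute.list_prod_right _ _ fun S hS => ?_
  obtain ⟨p, -, rfl⟩ := List.mem_map.1 hS
  exact (h p.1).halfAdd_right

theorem norm_prodX_mul_flow_sub_le (l : List (ℕ × ℝ)) (hl : ∀ p ∈ l, p.1 < n) (t : ℝ) :
    ‖prodX x z l * z t - z t * prodX x z l‖ ≤ l.length * η * |t| := by
  rw [mul_assoc]
  refine norm_list_prod_mul_sub_le (f := fun p : ℕ × ℝ => halfAdd (x p.1 * z p.2))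
    (g := fun p : ℕ × ℝ => halfAdd (x p.1 * z p.2)) (fun p => H.norm_halfAdd_xz_le p.1 p.2)
    (fun p => H.norm_halfAdd_xz_le p.1 p.2) _ l fun p hp => norm_halfAdd_mul_sub_le ?_
  have h : x p.1 * z p.2 * z t - z t * (x p.1 * z p.2) = (x p.1 * z t - z t * x p.1) * z p.2 := by
    rw [mul_assoc, (z.commute p.2 t).eq, sub_mul, mul_assoc, mul_assoc]
  rw [h]
  calc _ ≤ ‖x p.1 * z t - z t * x p.1‖ * ‖z p.2‖ := norm_mul_le _ _
    _ ≤ η * |t| * 1 :=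
      mul_le_mul (H.comm_xz _ _ (hl p hp)) (z.norm_le_one _) (norm_nonneg _)
        ((norm_nonneg _).trans (H.comm_xz _ _ (hl p hp)))
    _ = _ := mul_one _

/-- Moving `y j` to the left past `x i` creates the commutator z(a / R^(j - i)), which is a change
of phase of that factor. The phases themselves cause no error, since `y j` commutes exactly with
`z`. -/
theorem norm_prodX_mul_y_sub_le (l : List (ℕ × ℝ)) {j : ℕ} (hj : j < n) (hl : ∀ p ∈ l, p.1 < j) :
    ‖prodX x z l * y j - y j * prodX x z (l.map (shift a R j))‖ ≤ l.length * η := by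
  have h0 : prodX x z (l.map (shift a R j)) =
      (l.map fun p => halfAdd (x p.1 * z (p.2 + a / R ^ (j - p.1)))).prod := by
    simp [prodX, shift, Function.comp_def]
  rw [h0]
  refine norm_list_prod_mul_sub_le (f := fun p : ℕ × ℝ => halfAdd (x p.1 * z p.2))
    (g := fun p : ℕ × ℝ => halfAdd (x p.1 * z (p.2 + a / R ^ (j - p.1))))
    (fun p => H.norm_halfAdd_xz_le p.1 p.2) (fun p => H.norm_halfAdd_xz_le p.1 _) _ l fun p hp => norm_halfAdd_mul_sub_le ?_
  have h : x p.1 * z p.2 * y j - y j * (x p.1 * z (p.2 + a / R ^ (j - p.1))) =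
      (x p.1 * y j - y j * x p.1 * z (a / R ^ (j - p.1))) * z p.2 := by
    rw [add_comm, z.map_add, mul_assoc, ← (H.commute_yz j p.2).eq]
    noncomm_ring
  rw [h]
  calc _ ≤ ‖x p.1 * y j - y j * x p.1 * z (a / R ^ (j - p.1))‖ * ‖z p.2‖ := norm_mul_le _ _
    _ ≤ η * 1 :=
      mul_le_mul (H.comm_xy _ _ (hl p hp).le hj) (z.norm_le_one _) (norm_nonneg _)
        ((norm_nonneg _).trans (H.comm_xy _ _ (hl p hp).le hj))
    _ = _ := mul_one _

end ApproxHeisenberg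

end ApproximateHeisenberg

/-! ### The cost of changing phases -/

section ApproximateHeisenberg

variable {E : Type*} [NormedAddCommGroup E] [NormedSpace ℝ E]

/-- The indices decrease strictly and stay below `j`, so the exponents are distinct and positive,
and the sum is dominated by a geometric series. -/
theorem sum_inv_pow_le {R : ℝ} (hR : 2 ≤ R) {a : ℝ} (ha : 0 ≤ a) (l : List (ℕ × ℝ))
    (hl : l.Pairwise fun p q => q.1 < p.1) (j : ℕ) (hj : ∀ p ∈ l, p.1 < j) :
    (l.map fun p => a / R ^ (j - p.1)).sum ≤ a / (R - 1) := by
  induction l generalizing j with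
  | nil => simpa using div_nonneg ha (by linarith)
  | cons p l ih =>
    have hp := hj p List.mem_cons_self
    rw [List.pairwise_cons] at hl
    have h1 := ih hl.2 p.1 hl.1
    have hR0 : 0 < R := by linarith
    have h2 : (l.map fun q => a / R ^ (j - q.1)).sum =
        (1 / R ^ (j - p.1)) * (l.map fun q => a / R ^ (p.1 - q.1)).sum := by
      rw [← List.sum_map_mul_left]
      congr 1
      refine List.map_congr_left fun q hq => ?_
      have := hl.1 q hq
      have h3 : j - q.1 = (j - p.1) + (p.1 - q.1) := by omega
      rw [h3, pow_add]
      field_simp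
    rw [List.map_cons, List.sum_cons, h2]
    have h4 : R ≤ R ^ (j - p.1) := le_self_pow₀ (by linarith) (by omega)
    have h5 : 0 < R ^ (j - p.1) := by positivity
    have hR1 : 0 < R - 1 := by linarith
    calc a / R ^ (j - p.1) + 1 / R ^ (j - p.1) * (l.map fun q => a / R ^ (p.1 - q.1)).sum
        ≤ a / R ^ (j - p.1) + 1 / R ^ (j - p.1) * (a / (R - 1)) := by gcongr
      _ = (1 / R ^ (j - p.1)) * (a * R / (R - 1)) := by field_simp; ring
      _ ≤ (1 / R) * (a * R / (R - 1)) := by gcongr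
      _ = a / (R - 1) := by field_simp

namespace AveragingKernel

variable {φ : ℝ → ℝ} (K : AveragingKernel φ) {c : ℝ} (hc : KernelBound φ c)

include K

/-- A spectral localization of a flow to frequencies of order `1`. -/
noncomputable def band (z : IsomFlow E) : E →L[ℝ] E := K.op z (1 / 2) - K.op z 4

include hc in
theorem norm_band_le (z : IsomFlow E) : ‖K.band z‖ ≤ 2 * c :=
  (norm_sub_le _ _).trans (by linarith [K.norm_op_le hc z (1 / 2), K.norm_op_le hc z 4])

variable [CompleteSpace E]

/-- The three identities on `band` in spectral terms: its multiplier b(ξ/2) - b(4ξ) lives on 1/4 ≤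
|ξ| ≤ 4, where scale 1/4 is the identity and scale 8 vanishes. It equals 1 on 1/2 ≤ |ξ| ≤ 2, which
contains the support of the difference of scales 1 and 2. -/
theorem op_quarter_mul_band (z : IsomFlow E) : K.op z (1 / 4) * K.band z = K.band z := by
  rw [band, mul_sub, (K.op_mul_op z (1 / 2) 0 (m := 1 / 4) (by norm_num)).1,
    (K.op_mul_op z 4 3 (m := 1 / 4) (by norm_num)).1]

theorem op_eight_mul_band (z : IsomFlow E) : K.op z 8 * K.band z = 0 := by
  rw [band, mul_sub, (K.op_mul_op z 8 3 (m := 1 / 2) (by norm_num)).2,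
    (K.op_mul_op z 8 0 (m := 4) (by norm_num)).2, sub_self]

theorem band_mul_diff (z : IsomFlow E) :
    K.band z * (K.op z 1 - K.op z 2) = K.op z 1 - K.op z 2 := by
  rw [band, sub_mul, mul_sub, mul_sub, (K.op_mul_op z 1 0 (m := 1 / 2) (by norm_num)).1,
    (K.op_mul_op z 2 1 (m := 1 / 2) (by norm_num)).1,
    (K.op_mul_op z 4 1 (m := 1) (by norm_num)).2,
    (K.op_mul_op z 4 0 (m := 2) (by norm_num)).2, sub_self, sub_zero]

theorem commute_band (T : E →L[ℝ] E) (z : IsomFlow E) (h : ∀ t, Commute T (z t)) :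
    Commute T (K.band z) := (K.commute_op T z _ h).sub_right (K.commute_op T z _ h)

theorem band_mul_op_quarter (z : IsomFlow E) : K.band z * K.op z (1 / 4) = K.band z := by
  rw [← (K.commute_band _ z fun t => (K.commute_op _ z _ fun s => z.commute t s).symm).eq,
    K.op_quarter_mul_band]

end AveragingKernel

namespace ApproxHeisenberg

variable {z : IsomFlow E} {x y : ℕ → E →L[ℝ] E} {a R η : ℝ} {n : ℕ}
  {φ : ℝ → ℝ} (K : AveragingKernel φ) {c : ℝ} (hc : KernelBound φ c)

variable (H : ApproxHeisenberg z x y a R η n) [CompleteSpace E]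

include H K hc

/-- Changing one phase by `s` produces a factor z(s) - 1. Commuted to the far right it meets the
band, where the Bernstein inequality makes it O(s); `Err` pays for `x` not commuting with `z`. The
bare isometry X/2 left behind would spoil the product of means, so it is written as (1 + X)/2 - 1/2:
the first part completes the product (bound `A`), the second omits the index `i` altogether (bound
`B`), after the mean of `y i` is moved to the right as well. -/
theorem norm_prodX_shift_sub_term_le (hη : 0 ≤ η) {N A B s t : ℝ} (hs : 0 ≤ s)
    (l₁ l₂ l₂' : List (ℕ × ℝ)) (i : ℕ) (hl : l₂'.length ≤ N) (hl₂ : ∀ p ∈ l₂', p.1 < n)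
    (hA : ‖prodX x z (l₁ ++ (i, t) :: l₂') * (prodY y (l₁ ++ (i, t) :: l₂) * K.band z)‖ ≤ A)
    (hB : ‖prodX x z (l₁ ++ l₂') * (prodY y (l₁ ++ l₂) * K.band z)‖ ≤ B) :
    ‖prodX x z l₁ * (halfAdd (x i * z (t + s)) - halfAdd (x i * z t)) * prodX x z l₂' *
      (prodY y (l₁ ++ (i, t) :: l₂) * K.band z)‖ ≤
      ((A + B) * (8 * c) + 2 * c * N * η) * s := by
  have hc0 : 0 < c := by linarith [hc.one_le]
  set S := K.band z
  set X := x i * z t with hXdef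
  set P₁ := prodX x z l₁
  set P₂ := prodX x z l₂'
  set Q := prodY y (l₁ ++ (i, t) :: l₂) with hQ
  set T := (z s - 1) * K.op z (1 / 4) with hT
  have hQz : ∀ r, Commute Q (z r) := fun r =>
    (commute_prodY (fun j => (H.commute_yz j r).symm) _).symm
  have hyS : Commute (halfAdd (y i)) S := K.commute_band _ z fun r =>
    (H.commute_yz i r).symm.halfAdd_right.symm
  have hQ' : Q * S = prodY y (l₁ ++ l₂) * S * halfAdd (y i) := by
    rw [mul_assoc, ← hyS.eq, ← mul_assoc]
    congr 1
    rw [hQ, prodY_append, prodY_cons, prodY_append, mul_assoc]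
    congr 1
    exact (commute_prodY (fun j => (H.commute_yy j i).halfAdd_right.symm) l₂).eq
  have hzQ : (z s - 1) * (Q * S) = Q * S * T := by
    have h1 : Commute (z s - 1) (Q * S) :=
      Commute.sub_left (((hQz s).symm).mul_right
        (K.commute_band _ z fun r => z.commute s r)) (Commute.one_left _)
    rw [h1.eq, hT, mul_assoc, mul_assoc]
    congr 1
    have h2 : Commute (z s - 1) (K.op z (1 / 4)) :=
      Commute.sub_left (K.commute_op _ z _ fun r => z.commute s r) (Commute.one_left _)
    rw [h2.eq, ← mul_assoc, K.band_mul_op_quarter]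
  have hdiff : halfAdd (x i * z (t + s)) - halfAdd X = (1 / 2 : ℝ) • X * (z s - 1) := by
    rw [hXdef, z.map_add]
    simp only [halfAdd, ← smul_sub, smul_mul_assoc]
    congr 1
    noncomm_ring
  have hX2 : (1 / 2 : ℝ) • X = halfAdd X - (1 / 2 : ℝ) • 1 := by
    simp only [halfAdd, ← smul_sub]
    congr 1
    abel
  set Err := z s * P₂ - P₂ * z s
  have key : P₁ * (halfAdd (x i * z (t + s)) - halfAdd X) * P₂ * (Q * S) =
      P₁ * halfAdd X * P₂ * (Q * S) * T
        - (1 / 2 : ℝ) • (P₁ * P₂ * (prodY y (l₁ ++ l₂) * S) * (halfAdd (y i) * T))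
        + P₁ * ((1 / 2 : ℝ) • X) * Err * (Q * S) := by
    have e1 : (z s - 1) * P₂ = P₂ * (z s - 1) + Err := by simp only [Err]; noncomm_ring
    calc P₁ * (halfAdd (x i * z (t + s)) - halfAdd X) * P₂ * (Q * S)
        = P₁ * ((1 / 2 : ℝ) • X) * ((z s - 1) * P₂) * (Q * S) := by
          rw [hdiff]; simp only [mul_assoc]
      _ = P₁ * ((1 / 2 : ℝ) • X) * P₂ * ((z s - 1) * (Q * S))
          + P₁ * ((1 / 2 : ℝ) • X) * Err * (Q * S) := by
          rw [e1]; noncomm_ring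
      _ = P₁ * halfAdd X * P₂ * (Q * S) * T
          - (1 / 2 : ℝ) • (P₁ * P₂ * (Q * S) * T)
          + P₁ * ((1 / 2 : ℝ) • X) * Err * (Q * S) := by
          rw [hzQ, hX2]
          simp only [mul_sub, sub_mul, mul_smul_comm, smul_mul_assoc, mul_one, mul_assoc]
      _ = _ := by
          have : P₁ * P₂ * (Q * S) * T =
              P₁ * P₂ * (prodY y (l₁ ++ l₂) * S) * (halfAdd (y i) * T) := by
            rw [hQ']; simp only [mul_assoc]
          rw [this]
  have hTn : ‖T‖ ≤ 8 * c * s := by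
    refine (K.norm_flow_sub_one_mul_op_le hc z (by norm_num) s).trans (le_of_eq ?_)
    rw [abs_of_nonneg hs, abs_of_pos (by norm_num : (0 : ℝ) < 1 / 4)]
    ring
  have hErr : ‖Err‖ ≤ N * η * s := by
    rw [norm_sub_rev]
    refine (H.norm_prodX_mul_flow_sub_le l₂' hl₂ s).trans ?_
    rw [abs_of_nonneg hs]
    gcongr
  have hXn : ‖(1 / 2 : ℝ) • X‖ ≤ 1 := by
    have : ‖X‖ ≤ 1 := ContinuousLinearMap.opNorm_le_bound _ zero_le_one fun v => by
      rw [H.norm_xz, one_mul]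
    rw [norm_smul]
    norm_num
    linarith
  have hA' : ‖P₁ * halfAdd X * P₂ * (Q * S)‖ ≤ A := by
    simpa only [prodX_append, prodX_cons, mul_assoc] using hA
  have hB' : ‖P₁ * P₂ * (prodY y (l₁ ++ l₂) * S)‖ ≤ B := by
    simpa only [prodX_append, mul_assoc] using hB
  have hA0 := (norm_nonneg _).trans hA'
  have hB0 := (norm_nonneg _).trans hB'
  have hP₁ : ‖P₁‖ ≤ 1 := H.norm_prodX_le l₁
  have hS : ‖S‖ ≤ 2 * c := K.norm_band_le hc z
  have hQn : ‖Q‖ ≤ 1 := H.norm_prodY_le _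
  have hy : ‖halfAdd (y i)‖ ≤ 1 := H.norm_halfAdd_y_le i
  rw [key]
  have t1 : ‖P₁ * halfAdd X * P₂ * (Q * S) * T‖ ≤ A * (8 * c * s) :=
    (norm_mul_le _ _).trans (mul_le_mul hA' hTn (norm_nonneg _) hA0)
  have t2 : ‖(1 / 2 : ℝ) • (P₁ * P₂ * (prodY y (l₁ ++ l₂) * S) * (halfAdd (y i) * T))‖ ≤
      B * (8 * c * s) := by
    rw [norm_smul]
    have h1 : ‖halfAdd (y i) * T‖ ≤ 1 * (8 * c * s) :=
      (norm_mul_le _ _).trans (mul_le_mul hy hTn (norm_nonneg _) zero_le_one)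
    have h2 : ‖P₁ * P₂ * (prodY y (l₁ ++ l₂) * S) * (halfAdd (y i) * T)‖ ≤ B * (1 * (8 * c * s)) :=
      (norm_mul_le _ _).trans (mul_le_mul hB' h1 (norm_nonneg _) hB0)
    have h3 : ‖(1 / 2 : ℝ)‖ = 1 / 2 := by norm_num
    rw [h3]
    have := norm_nonneg (P₁ * P₂ * (prodY y (l₁ ++ l₂) * S) * (halfAdd (y i) * T))
    linarith
  have t3 : ‖P₁ * ((1 / 2 : ℝ) • X) * Err * (Q * S)‖ ≤ 1 * 1 * (N * η * s) * (1 * (2 * c)) := by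
    have h0 := (norm_nonneg _).trans hErr
    refine (norm_mul_le _ _).trans (mul_le_mul ?_ ?_ (norm_nonneg _) (by linarith))
    · refine (norm_mul_le _ _).trans (mul_le_mul ?_ hErr (norm_nonneg _) (by norm_num))
      exact (norm_mul_le _ _).trans (mul_le_mul hP₁ hXn (norm_nonneg _) zero_le_one)
    · exact (norm_mul_le _ _).trans (mul_le_mul hQn hS (norm_nonneg _) zero_le_one)
  refine (norm_add_le _ _).trans ((add_le_add ((norm_sub_le _ _).trans (add_le_add t1 t2)) t3).trans
    (le_of_eq ?_))
  ring

/-- The phases change by a / R^(j - i), so the single costs sum to a multiple of 1 / (R - 1), which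
a large `R` makes small. -/
theorem norm_prodX_shift_sub_mul_le (hη : 0 ≤ η) (hR : 2 ≤ R) (ha : 0 ≤ a) (ha1 : a ≤ 1)
    {N A B : ℝ} (l : List (ℕ × ℝ)) (hl : l.Pairwise fun p q => q.1 < p.1) {j : ℕ} (hj : j < n)
    (hlj : ∀ p ∈ l, p.1 < j) (hN : l.length ≤ N) (hA0 : 0 ≤ A) (hB0 : 0 ≤ B)
    (hA : ∀ l₁ l₂, l = l₁ ++ l₂ →
      ‖prodX x z (l₁ ++ l₂.map (shift a R j)) *
        (prodY y (l₁ ++ l₂.map (shift a R j)) * K.band z)‖ ≤ A)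
    (hB : ∀ l₁ p l₂, l = l₁ ++ p :: l₂ →
      ‖prodX x z (l₁ ++ l₂.map (shift a R j)) *
        (prodY y (l₁ ++ l₂.map (shift a R j)) * K.band z)‖ ≤ B) :
    ‖(prodX x z (l.map (shift a R j)) - prodX x z l) * (prodY y l * K.band z)‖ ≤
      ((A + B) * (8 * c) + 2 * c * N * η) * (1 / (R - 1)) := by
  have hc0 : 0 < c := by linarith [hc.one_le]
  have hD0 : 0 ≤ (A + B) * (8 * c) + 2 * c * N * η := by
    have : 0 ≤ N := (Nat.cast_nonneg _).trans hN
    positivity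
  have h := norm_list_prod_sub_mul_le (f := fun p : ℕ × ℝ => halfAdd (x p.1 * z p.2))
    (g := fun p : ℕ × ℝ => halfAdd (x p.1 * z (p.2 + a / R ^ (j - p.1))))
    (prodY y l * K.band z)
    (fun p => ((A + B) * (8 * c) + 2 * c * N * η) * (a / R ^ (j - p.1))) l ?_
  · have e1 : prodX x z (l.map (shift a R j)) =
        (l.map fun p : ℕ × ℝ => halfAdd (x p.1 * z (p.2 + a / R ^ (j - p.1)))).prod := by
      simp [prodX, shift, Function.comp_def]
    rw [e1]
    refine h.trans ?_
    rw [List.sum_map_mul_left]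
    refine mul_le_mul_of_nonneg_left ((sum_inv_pow_le hR ha l hl j hlj).trans ?_) hD0
    have : 0 < R - 1 := by linarith
    gcongr
  · rintro l₁ ⟨i, t⟩ l₂ rfl
    have e1 : (l₂.map fun p : ℕ × ℝ => halfAdd (x p.1 * z (p.2 + a / R ^ (j - p.1)))).prod =
        prodX x z (l₂.map (shift a R j)) := by
      simp [prodX, shift, Function.comp_def]
    rw [e1]
    refine H.norm_prodX_shift_sub_term_le K hc hη (by positivity) l₁ l₂ (l₂.map (shift a R j)) i
      ?_ ?_ ?_ ?_
    · refine le_trans ?_ hN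
      simp
      linarith [Nat.cast_nonneg (α := ℝ) l₁.length]
    · intro p hp
      obtain ⟨q, hq, rfl⟩ := List.mem_map.1 hp
      exact (hlj q (by simp [hq])).trans hj
    · have := hA (l₁ ++ [(i, t)]) l₂ (by simp)
      simp only [prodY_append, prodY_map_shift, prodY_cons, List.append_assoc] at this ⊢
      simpa [prodY] using this
    · have := hB l₁ (i, t) l₂ rfl
      simpa only [prodY_append, prodY_map_shift] using this

end ApproxHeisenberg

end ApproximateHeisenberg

/-! ### Exponential decay of the products of means -/

section ApproximateHeisenberg

variable {E : Type*} [NormedAddCommGroup E] [NormedSpace ℝ E]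

namespace ApproxHeisenberg

variable {z : IsomFlow E} {x y : ℕ → E →L[ℝ] E} {a R η : ℝ} {n : ℕ}
  {φ : ℝ → ℝ} (K : AveragingKernel φ) {c : ℝ} (hc : KernelBound φ c)

variable (H : ApproxHeisenberg z x y a R η n) [CompleteSpace E]

include H K hc

theorem norm_op_mul_prodX_sub_le (hη : 0 ≤ η) {N : ℝ} (l : List (ℕ × ℝ))
    (hl : ∀ p ∈ l, p.1 < n) (hN : l.length ≤ N) (m : ℝ) :
    ‖prodX x z l * K.op z m - K.op z m * prodX x z l‖ ≤ N * η * |m| * c := by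
  have hN0 : 0 ≤ N := (Nat.cast_nonneg _).trans hN
  refine K.norm_mul_op_sub_le hc _ z m (by positivity) fun t => ?_
  exact (H.norm_prodX_mul_flow_sub_le l hl t).trans (by gcongr)

/-- The recursion. Moving the mean of `y j` left through the product `P` brings it next to the mean
of `x j`, at the cost of a phase change of `P` controlled by 1 / (R - 1). The vectors in the range
of `P * (Q * S)` still have frequency of order 1, up to the error, so the pair of means contracts
them by 1 - δ/2. -/
theorem norm_prod_cons_le (hη : 0 ≤ η) (hR : 2 ≤ R) (ha : a = 1 / (32 * c ^ 2)) {ε δ : ℝ}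
    (hε : ε = a / (192 * c)) (hδ : δ ≤ 1) (hE : ConvexAt E ε δ)
    {N A B : ℝ} (hN1 : 1 ≤ N) (l : List (ℕ × ℝ)) (hl : l.Pairwise fun p q => q.1 < p.1) {j : ℕ}
    (t : ℝ) (hj : j < n) (hlj : ∀ p ∈ l, p.1 < j) (hN : l.length ≤ N) (hA0 : 0 ≤ A) (hAB : A ≤ B)
    (hA : ∀ l₁ l₂, l = l₁ ++ l₂ →
      ‖prodX x z (l₁ ++ l₂.map (shift a R j)) *
        (prodY y (l₁ ++ l₂.map (shift a R j)) * K.band z)‖ ≤ A)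
    (hB : ∀ l₁ p l₂, l = l₁ ++ p :: l₂ →
      ‖prodX x z (l₁ ++ l₂.map (shift a R j)) *
        (prodY y (l₁ ++ l₂.map (shift a R j)) * K.band z)‖ ≤ B) :
    ‖prodX x z ((j, t) :: l) * (prodY y ((j, t) :: l) * K.band z)‖ ≤
      (1 - δ / 2) * A + 8 * c / (R - 1) * B +
        (2 * c + 2 * (1 + 8 * c / a + 2 * c) * (16 * c ^ 2)) * (N * η) := by
  have hc1 := hc.one_le
  have hc0 : 0 < c := by linarith
  have ha0 : 0 < a := by rw [ha]; positivity
  have ha1 : a ≤ 1 := by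
    rw [ha, div_le_one (by positivity)]; nlinarith
  have hR1 : 1 ≤ R - 1 := by linarith
  have hNη : 0 ≤ N * η := by positivity
  have hln : ∀ p ∈ l, p.1 < n := fun p hp => (hlj p hp).trans hj
  set S := K.band z
  set P := prodX x z l
  set P' := prodX x z (l.map (shift a R j))
  set Q := prodY y l with hQ
  have hS : ‖S‖ ≤ 2 * c := K.norm_band_le hc z
  have hQn : ‖Q‖ ≤ 1 := H.norm_prodY_le _
  have hQS : ‖Q * S‖ ≤ 2 * c := (norm_mul_le _ _).trans (by nlinarith [norm_nonneg S])
  have hP : ‖P‖ ≤ 1 := H.norm_prodX_le l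
  have hPQ : ‖P * (Q * S)‖ ≤ 2 * c := (norm_mul_le _ _).trans (by nlinarith [norm_nonneg (Q * S)])
  have hPA : ‖P * (Q * S)‖ ≤ A := by
    have := hA l [] (by simp)
    simpa using this
  have hQz : ∀ r, Commute (z r) Q := fun r =>
    commute_prodY (fun j => (H.commute_yz j r).symm) _
  have hdiff : ‖(P' - P) * (Q * S)‖ ≤ ((A + B) * (8 * c) + 2 * c * N * η) * (1 / (R - 1)) :=
    H.norm_prodX_shift_sub_mul_le K hc hη hR ha0.le ha1 l hl hj hlj hN hA0 (hA0.trans hAB) hA hB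
  have hErr : ‖P * y j - y j * P'‖ ≤ N * η :=
    (H.norm_prodX_mul_y_sub_le l hj hlj).trans (by gcongr)
  set X := x j * z t with hX
  set Y := y j
  have hXiso : ∀ v, ‖X v‖ = ‖v‖ := fun v => H.norm_xz j t v
  have hXn : ‖halfAdd X‖ ≤ 1 := H.norm_halfAdd_xz_le j t
  have hYn : ‖Y‖ ≤ 1 := H.norm_y_le j
  have key : prodX x z ((j, t) :: l) * (prodY y ((j, t) :: l) * S) =
      halfAdd X * halfAdd Y * (P * (Q * S)) +
        (1 / 2 : ℝ) • (halfAdd X * (Y * ((P' - P) * (Q * S)) +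
          (P * Y - Y * P') * (Q * S))) := by
    rw [prodX_cons, prodY_cons]
    have : P * halfAdd Y =
        halfAdd Y * P + (1 / 2 : ℝ) • (Y * (P' - P) + (P * Y - Y * P')) := by
      simp only [halfAdd, mul_smul_comm, smul_mul_assoc, ← smul_add]
      congr 1
      noncomm_ring
    calc halfAdd X * P * (halfAdd Y * Q * S) = halfAdd X * (P * halfAdd Y) * (Q * S) := by
          simp only [mul_assoc]
      _ = _ := by
          rw [this]
          simp only [mul_add, add_mul, mul_smul_comm, smul_mul_assoc, mul_assoc, smul_add]
  have hmain : ‖halfAdd X * halfAdd Y * (P * (Q * S))‖ ≤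
      (1 - δ / 2) * A + 2 * (1 + 8 * c / a + 2 * c) * (16 * c ^ 2 * (N * η)) := by
    have hδ0 : 0 ≤ 1 - δ / 2 := by linarith
    refine ContinuousLinearMap.opNorm_le_bound _ (by positivity) fun v => ?_
    set u := (P * (Q * S)) v with hu
    have hop (m : ℝ) : ‖(P * K.op z m - K.op z m * P) * (Q * S)‖ ≤ N * η * |m| * c * (2 * c) :=
      (norm_mul_le _ _).trans (mul_le_mul (H.norm_op_mul_prodX_sub_le K hc hη l hln hN m) hQS
        (norm_nonneg _) (by positivity))
    have hcom (m : ℝ) : Commute (K.op z m) Q := (K.commute_op _ z m fun r => (hQz r).symm).symm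
    have h8 : ‖K.op z 8 u‖ ≤ 16 * c ^ 2 * (N * η) * ‖v‖ := by
      have e1 : (K.op z 8 * (P * (Q * S))) =
          -((P * K.op z 8 - K.op z 8 * P) * (Q * S)) := by
        have : P * K.op z 8 * (Q * S) = 0 := by
          rw [mul_assoc, ← mul_assoc _ Q, (hcom 8).eq, mul_assoc Q, K.op_eight_mul_band]
          simp
        rw [sub_mul, this]
        simp only [mul_assoc, zero_sub, neg_neg]
      have e2 : K.op z 8 u = (K.op z 8 * (P * (Q * S))) v := rfl
      rw [e2, e1]
      refine (ContinuousLinearMap.le_opNorm _ _).trans ?_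
      rw [norm_neg]
      gcongr
      refine (hop 8).trans (le_of_eq ?_)
      norm_num
      ring
    have h4 : ‖u - K.op z (1 / 4) u‖ ≤ 16 * c ^ 2 * (N * η) * ‖v‖ := by
      have e1 : P * (Q * S) - K.op z (1 / 4) * (P * (Q * S)) =
          (P * K.op z (1 / 4) - K.op z (1 / 4) * P) * (Q * S) := by
        have : P * K.op z (1 / 4) * (Q * S) = P * (Q * S) := by
          rw [mul_assoc, ← mul_assoc _ Q, (hcom _).eq, mul_assoc Q, K.op_quarter_mul_band]
        rw [sub_mul, this]
        simp only [mul_assoc]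
      have e2 : u - K.op z (1 / 4) u =
        (P * (Q * S) - K.op z (1 / 4) * (P * (Q * S))) v := rfl
      rw [e2, e1]
      refine (ContinuousLinearMap.le_opNorm _ _).trans ?_
      gcongr
      refine (hop _).trans ?_
      rw [abs_of_pos (by norm_num : (0 : ℝ) < 1 / 4)]
      have : 0 ≤ N * η * c * c := by positivity
      linarith
    have hXY : ‖X (Y u) - Y (X (z a u))‖ ≤ 16 * c ^ 2 * (N * η) * ‖v‖ := by
      have e1 : X (Y u) - Y (X (z a u)) = (X * Y - Y * X * z a) u := rfl
      have e2 : X * Y - Y * X * z a = (x j * Y - Y * x j * z a) * z t := by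
        rw [hX, mul_assoc (x j), ← (H.commute_yz j t).eq, mul_assoc Y, mul_assoc (x j),
          (z.commute t a).eq]
        simp only [sub_mul, mul_assoc]
        rfl
      have e3 : ‖x j * Y - Y * x j * z a‖ ≤ η := by
        have := H.comm_xy j j le_rfl hj
        simpa using this
      rw [e1, e2]
      refine (ContinuousLinearMap.le_opNorm _ _).trans ?_
      have e4 : ‖(x j * Y - Y * x j * z a) * z t‖ ≤ η * 1 :=
        (norm_mul_le _ _).trans (mul_le_mul e3 (z.norm_le_one t) (norm_nonneg _) hη)
      have e5 : ‖u‖ ≤ 2 * c * ‖v‖ := (ContinuousLinearMap.le_opNorm _ _).trans (by gcongr)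
      calc _ ≤ η * 1 * (2 * c * ‖v‖) := mul_le_mul e4 e5 (norm_nonneg _) (by linarith)
        _ = 2 * c * (1 * η) * ‖v‖ := by ring
        _ ≤ 16 * c ^ 2 * (N * η) * ‖v‖ := by
          have : 2 * c ≤ 16 * c ^ 2 := by nlinarith
          gcongr
    have h := hE.norm_half_half_le K hc ha hε hδ z hXiso (H.norm_y j) hXY h8 h4
    have hu' : ‖u‖ ≤ A * ‖v‖ := (ContinuousLinearMap.le_opNorm _ _).trans (by gcongr)
    refine h.trans ?_
    have := mul_le_mul_of_nonneg_left hu' hδ0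
    linarith
  have hrest : ‖(1 / 2 : ℝ) • (halfAdd X * (Y * ((P' - P) * (Q * S)) +
      (P * Y - Y * P') * (Q * S)))‖ ≤ 8 * c / (R - 1) * B + 2 * c * (N * η) := by
    have e1 : ‖Y * ((P' - P) * (Q * S))‖ ≤
        1 * (((A + B) * (8 * c) + 2 * c * N * η) * (1 / (R - 1))) :=
      (norm_mul_le _ _).trans (mul_le_mul hYn hdiff (norm_nonneg _) zero_le_one)
    have e2 : ‖(P * Y - Y * P') * (Q * S)‖ ≤ N * η * (2 * c) :=
      (norm_mul_le _ _).trans (mul_le_mul hErr hQS (norm_nonneg _) hNη)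
    have e3 : ‖halfAdd X * (Y * ((P' - P) * (Q * S)) + (P * Y - Y * P') * (Q * S))‖ ≤
        1 * (1 * (((A + B) * (8 * c) + 2 * c * N * η) * (1 / (R - 1))) + N * η * (2 * c)) :=
      (norm_mul_le _ _).trans (mul_le_mul hXn ((norm_add_le _ _).trans (add_le_add e1 e2))
        (norm_nonneg _) zero_le_one)
    have h3 : ‖(1 / 2 : ℝ)‖ = 1 / 2 := by norm_num
    rw [norm_smul, h3]
    have e4 : ((A + B) * (8 * c) + 2 * c * N * η) * (1 / (R - 1)) ≤
        2 * (8 * c / (R - 1) * B) + 2 * c * (N * η) := by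
      have e5 : (A + B) * (8 * c) * (1 / (R - 1)) ≤ 2 * B * (8 * c) * (1 / (R - 1)) := by
        gcongr; linarith
      have e6 : 2 * c * N * η * (1 / (R - 1)) ≤ 2 * c * N * η * 1 := by
        gcongr
        rw [div_le_one (by linarith)]; exact hR1
      have e7 : 2 * B * (8 * c) * (1 / (R - 1)) = 2 * (8 * c / (R - 1) * B) := by ring
      linarith
    linarith
  rw [key]
  refine (norm_add_le _ _).trans ((add_le_add hmain hrest).trans (le_of_eq ?_))
  ring

/-- The products of many means are small on vectors of frequency of order `1`. -/
theorem norm_prod_le (hη : 0 ≤ η) (ha : a = 1 / (32 * c ^ 2)) {ε δ : ℝ}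
    (hε : ε = a / (192 * c)) (hδ0 : 0 < δ) (hδ : δ ≤ 1) (hE : ConvexAt E ε δ)
    (hR : R = 1 + 64 * c / δ)
    {N : ℝ} (k : ℕ) (l : List (ℕ × ℝ)) (hk : l.length = k)
    (hl : l.Pairwise fun p q => q.1 < p.1) (hN : k ≤ N) (hln : ∀ p ∈ l, p.1 < n) :
    ‖prodX x z l * (prodY y l * K.band z)‖ ≤
      2 * c * (1 - δ / 8) ^ k +
        4 * (2 * c + 2 * (1 + 8 * c / a + 2 * c) * (16 * c ^ 2)) * (N * η) / δ := by
  have hc1 := hc.one_le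
  have hc0 : 0 < c := by linarith
  have ha0 : 0 < a := by rw [ha]; positivity
  have hR2 : 2 ≤ R := by
    have : 64 * c ≤ 64 * c / δ := by rw [le_div_iff₀ hδ0]; nlinarith
    rw [hR]; linarith
  set D := 2 * c + 2 * (1 + 8 * c / a + 2 * c) * (16 * c ^ 2) with hD
  have hD0 : 0 ≤ D := by positivity
  have hN0 : 0 ≤ N := (Nat.cast_nonneg k).trans hN
  set M := 4 * D * (N * η) / δ with hM
  have hM0 : 0 ≤ M := by positivity
  set ρ := 1 - δ / 8 with hρ
  have hρ0 : 0 ≤ ρ := by rw [hρ]; linarith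
  have hρ1 : ρ ≤ 1 := by rw [hρ]; linarith
  -- A step refers to lists shorter by one and by two, in which some phases are shifted; hence
  -- strong induction over all lists with arbitrary phases.
  induction k using Nat.strong_induction_on generalizing l with
  | _ k ih =>
  rcases l with _ | ⟨⟨j, t⟩, l⟩
  · simp only [List.length_nil] at hk
    subst hk
    have : ‖prodX x z [] * (prodY y [] * K.band z)‖ ≤ 2 * c := by
      simpa [prodX, prodY] using K.norm_band_le hc z
    simpa using this.trans (by linarith)
  rw [List.length_cons] at hk
  rw [List.pairwise_cons] at hl
  have hk1 : (l.length : ℝ) ≤ N := by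
    rw [← hk] at hN; push_cast at hN; linarith
  have hN1 : 1 ≤ N := by
    rw [← hk] at hN; push_cast at hN; linarith [Nat.cast_nonneg (α := ℝ) l.length]
  have hj : j < n := hln (j, t) List.mem_cons_self
  have hlj : ∀ p ∈ l, p.1 < j := hl.1
  have hmix (l₁ l₂ : List (ℕ × ℝ)) (h : (l₁ ++ l₂).Sublist l) (hlt : (l₁ ++ l₂).length < k) :
      ‖prodX x z (l₁ ++ l₂.map (shift a R j)) *
        (prodY y (l₁ ++ l₂.map (shift a R j)) * K.band z)‖ ≤
        2 * c * ρ ^ (l₁ ++ l₂).length + M := by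
    have hfst : (l₁ ++ l₂.map (shift a R j)).map Prod.fst = (l₁ ++ l₂).map Prod.fst := by
      simp [shift, Function.comp_def]
    refine ih _ hlt _ (by simp) ?_ ((Nat.cast_le.2 hlt.le).trans hN) ?_
    · have h1 := hl.2.sublist h
      rw [← List.pairwise_map (f := Prod.fst) (R := fun p q : ℕ => q < p)] at h1 ⊢
      rw [hfst]; exact h1
    · intro p hp
      have : p.1 ∈ (l₁ ++ l₂).map Prod.fst := by
        rw [← hfst]; exact List.mem_map_of_mem hp
      obtain ⟨q, hq, hqp⟩ := List.mem_map.1 this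
      rw [← hqp]
      exact (hlj q (h.subset hq)).trans hj
  have hstep := H.norm_prod_cons_le K hc hη hR2 ha hε hδ hE (A := 2 * c * ρ ^ (k - 1) + M)
    (B := 2 * c * ρ ^ (k - 2) + M) hN1 l hl.2 t hj hlj hk1 (by positivity)
    (by
      gcongr 2 * c * ?_ + M
      exact pow_le_pow_of_le_one hρ0 hρ1 (by omega))
    (fun l₁ l₂ h => by
      have h1 : (l₁ ++ l₂).length = k - 1 := by rw [← h]; omega
      have := hmix l₁ l₂ (by rw [h]) (by omega)
      rwa [h1] at this)
    (fun l₁ p l₂ h => by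
      have h1 : (l₁ ++ l₂).length = k - 2 := by
        have := congrArg List.length h
        simp only [List.length_append, List.length_cons] at this ⊢
        omega
      have := hmix l₁ l₂ (by rw [h]; simp) (by
        rw [h1]; omega)
      rwa [h1] at this)
  refine hstep.trans ?_
  have hR' : 8 * c / (R - 1) = δ / 8 := by
    rw [hR]; field_simp; ring
  rw [hR', ← hD]
  have hMδ : D * (N * η) = δ / 4 * M := by
    rw [hM]; field_simp
  -- With ρ = 1 - δ/8 the recursion closes. For k = 1 the exponent k - 2 truncates to 0, which is
  -- harmless, as then the bound `B` concerns no list at all.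
  have hpow : (1 - δ / 2) * ρ ^ (k - 1) + δ / 8 * ρ ^ (k - 2) ≤ ρ ^ k := by
    rcases k with _ | _ | k
    · omega
    · simp only [zero_add, Nat.sub_self, pow_zero, pow_one]
      rw [show (1 - 2 : ℕ) = 0 from rfl, pow_zero, hρ]
      linarith
    · rw [show k + 1 + 1 - 1 = k + 1 by omega, show k + 1 + 1 - 2 = k by omega, pow_succ, pow_succ,
        pow_succ]
      have h1 : (1 - δ / 2) * ρ + δ / 8 ≤ ρ * ρ := by rw [hρ]; nlinarith
      have h2 : 0 ≤ ρ ^ k := by positivity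
      nlinarith
  rw [hMδ]
  have := mul_le_mul_of_nonneg_left hpow (by positivity : 0 ≤ 2 * c)
  nlinarith

end ApproxHeisenberg

end ApproximateHeisenberg

/-! ### Decay of averages over approximate Heisenberg groups -/

section HeisenbergEstimate

section

variable {E : Type*} [NormedAddCommGroup E] [NormedSpace ℝ E] {ι : Type*}

theorem norm_mul_list_prod_sub_le {f : ι → E →L[ℝ] E} (hf : ∀ i, ‖f i‖ ≤ 1) (B : E →L[ℝ] E)
    {e : ℝ} (l : List ι) (h : ∀ i ∈ l, ‖B * f i - B‖ ≤ e) :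
    ‖B * (l.map f).prod - B‖ ≤ l.length * e := by
  induction l with
  | nil => simp
  | cons i l ih =>
    have h1 := ih fun i hi => h i (List.mem_cons_of_mem _ hi)
    have h2 := h i List.mem_cons_self
    simp only [List.map_cons, List.prod_cons, List.length_cons]
    have key : B * (f i * (l.map f).prod) - B =
        (B * f i - B) * (l.map f).prod + (B * (l.map f).prod - B) := by noncomm_ring
    rw [key]
    calc _ ≤ ‖B * f i - B‖ * ‖(l.map f).prod‖ + ‖B * (l.map f).prod - B‖ :=
          (norm_add_le _ _).trans (add_le_add (norm_mul_le _ _) le_rfl)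
      _ ≤ e * 1 + l.length * e := by
          gcongr
          · exact (norm_nonneg _).trans h2
          · exact norm_list_map_prod_le_one hf l
      _ = _ := by push_cast; ring

theorem norm_list_prod_mul_sub_self_le {f : ι → E →L[ℝ] E} (hf : ∀ i, ‖f i‖ ≤ 1) (B : E →L[ℝ] E)
    {e : ℝ} (l : List ι) (h : ∀ i ∈ l, ‖f i * B - B‖ ≤ e) :
    ‖(l.map f).prod * B - B‖ ≤ l.length * e := by
  induction l with
  | nil => simp
  | cons i l ih =>
    have h1 := ih fun i hi => h i (List.mem_cons_of_mem _ hi)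
    have h2 := h i List.mem_cons_self
    simp only [List.map_cons, List.prod_cons, List.length_cons]
    have key : f i * (l.map f).prod * B - B =
        f i * ((l.map f).prod * B - B) + (f i * B - B) := by noncomm_ring
    rw [key]
    calc _ ≤ ‖f i‖ * ‖(l.map f).prod * B - B‖ + ‖f i * B - B‖ :=
          (norm_add_le _ _).trans (add_le_add (norm_mul_le _ _) le_rfl)
      _ ≤ 1 * (l.length * e) + e := by
          gcongr
          exact hf i
      _ = _ := by push_cast; ring

end

variable {φ : ℝ → ℝ} (K : AveragingKernel φ) {c : ℝ} (hc : KernelBound φ c)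

section

variable {E : Type*} [NormedAddCommGroup E] [NormedSpace ℝ E] [CompleteSpace E]

include hc in
theorem AveragingKernel.norm_halfAdd_mul_op_sub_le (x : IsomFlow E) {l : ℝ} (hl : l ≠ 0) (h : ℝ) :
    ‖halfAdd (x h) * K.op x l - K.op x l‖ ≤ 2 * c * |h| / |l| := by
  have key : halfAdd (x h) * K.op x l - K.op x l = (1 / 2 : ℝ) • ((x h - 1) * K.op x l) := by
    simp only [halfAdd, smul_mul_assoc, add_mul, sub_mul, one_mul]
    module
  have h3 : ‖(1 / 2 : ℝ)‖ = 1 / 2 := by norm_num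
  rw [key, norm_smul, h3]
  have := K.norm_flow_sub_one_mul_op_le hc x hl h
  linarith [norm_nonneg ((x h - 1) * K.op x l)]

include hc in
theorem AveragingKernel.norm_op_mul_halfAdd_sub_le (x : IsomFlow E) {l : ℝ} (hl : l ≠ 0) (h : ℝ) :
    ‖K.op x l * halfAdd (x h) - K.op x l‖ ≤ 2 * c * |h| / |l| := by
  have h1 : Commute (K.op x l) (halfAdd (x h)) :=
    (K.commute_op _ x l fun t => x.commute h t).symm.halfAdd_right
  rw [h1.eq]
  exact K.norm_halfAdd_mul_op_sub_le hc x hl h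

end

include K hc

/-- The basic estimate for approximate Heisenberg groups: averages over two flows of long
range nearly annihilate the vectors on which the commutator has frequency of order `1`. -/
theorem exists_norm_op_mul_op_mul_diff_le {a ε δ : ℝ} (ha : a = 1 / (32 * c ^ 2))
    (hε : ε = a / (192 * c)) (hδ0 : 0 < δ) (hδ : δ ≤ 1) :
    ∃ R C ρ : ℝ, 2 ≤ R ∧ 0 ≤ C ∧ 0 < ρ ∧ ρ < 1 ∧
      ∀ {E : Type u} [NormedAddCommGroup E] [NormedSpace ℝ E] [CompleteSpace E],
      ConvexAt E ε δ → ∀ (x y z : IsomFlow E) (τ lx ly : ℝ) (n : ℕ), 0 ≤ τ →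
      (∀ s t, Commute (y s) (z t)) →
      (∀ p q, ‖x p * y q - y q * x p * z (p * q)‖ ≤ τ * |p| * |p * q|) →
      (∀ p t, ‖x p * z t - z t * x p‖ ≤ τ * |p| * |t|) →
      R ^ (2 * n) ≤ |lx| → R ^ (2 * n) ≤ |ly| → τ * R ^ (2 * n) ≤ 1 →
      ‖K.op x lx * K.op y ly * (K.op z 1 - K.op z 2)‖ ≤ C * ρ ^ n := by
  have hc1 := hc.one_le
  have hc0 : 0 < c := by linarith
  have ha0 : 0 < a := by rw [ha]; positivity
  have ha1 : a ≤ 1 := by rw [ha, div_le_one (by positivity)]; nlinarith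
  set R := 1 + 64 * c / δ with hR
  set D := 2 * c + 2 * (1 + 8 * c / a + 2 * c) * (16 * c ^ 2) with hD
  have hD0 : 0 ≤ D := by positivity
  have hR65 : 65 ≤ R := by
    have : 64 ≤ 64 * c / δ := by rw [le_div_iff₀ hδ0]; nlinarith
    rw [hR]; linarith
  have hR0 : 0 < R := by linarith
  set ρ := 1 - δ / 8 with hρ
  have hρ0 : 0 < ρ := by rw [hρ]; linarith
  refine ⟨R, 8 * c ^ 3 + 2 * c ^ 3 * (2 * c + 4 * D / δ), ρ, by linarith, by positivity, hρ0,
    by rw [hρ]; linarith, ?_⟩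
  intro E _ _ _ hE x y z τ lx ly n hτ hyz hxy hxz hlx hly hτR
  set r := R ^ n with hr
  have hr0 : 0 < r := by positivity
  have hr2 : R ^ (2 * n) = r * r := by rw [hr, ← pow_add, two_mul]
  rw [hr2] at hlx hly hτR
  -- There are O(n) errors of size 1/r each; since R ≥ 65 gives 2/R ≤ ρ, they do not spoil the
  -- exponential rate.
  have hrρ : n * (1 / r) ≤ ρ ^ n := by
    have h1 : (n : ℝ) ≤ 2 ^ n := by exact_mod_cast Nat.lt_two_pow_self.le
    calc n * (1 / r) ≤ 2 ^ n * (1 / r) := by gcongr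
      _ = (2 / R) ^ n := by rw [hr, div_pow]; ring
      _ ≤ ρ ^ n := by
        gcongr
        rw [div_le_iff₀ hR0, hρ]
        nlinarith
  have hlx0 : lx ≠ 0 := abs_pos.1 (lt_of_lt_of_le (by positivity) hlx)
  have hly0 : ly ≠ 0 := abs_pos.1 (lt_of_lt_of_le (by positivity) hly)
  have hη : τ * r ≤ 1 / r := by rw [le_div_iff₀ hr0]; linarith
  have hRle (i : ℕ) (hi : i < n) : R ^ i ≤ r := pow_le_pow_right₀ (by linarith) hi.le
  -- The times of `x` grow while those of `y` shrink: equal indices have commutator z(a), and i < j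
  -- gives the much shorter time a / R^(j - i).
  have H : ApproxHeisenberg z (fun i => x (R ^ i)) (fun i => y (a / R ^ i)) a R (τ * r) n :=
    { norm_x := fun i v => x.norm_map _ v
      norm_y := fun i v => y.norm_map _ v
      commute_yz := fun i t => hyz _ t
      commute_yy := fun i j => y.commute _ _
      comm_xz := fun i t hi => (hxz _ t).trans (by
        rw [abs_of_pos (by positivity : 0 < R ^ i)]
        have := hRle i hi
        gcongr)
      comm_xy := fun i j hij hj => by
        have h1 : R ^ i * (a / R ^ j) = a / R ^ (j - i) := by
          obtain ⟨k, rfl⟩ := Nat.exists_eq_add_of_le hij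
          rw [Nat.add_sub_cancel_left, pow_add]
          field_simp
        have h2 := hxy (R ^ i) (a / R ^ j)
        rw [h1] at h2
        refine h2.trans ?_
        rw [abs_of_pos (by positivity : 0 < R ^ i), abs_of_pos (by positivity)]
        have h3 := hRle i (hij.trans_lt hj)
        have h4 : a / R ^ (j - i) ≤ 1 := by
          rw [div_le_one (by positivity)]
          exact ha1.trans (one_le_pow₀ (by linarith))
        calc τ * R ^ i * (a / R ^ (j - i)) ≤ τ * r * 1 := by gcongr
          _ = _ := mul_one _ }
  set l : List (ℕ × ℝ) := (List.range n).reverse.map fun i => (i, 0) with hl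
  have hlen : l.length = n := by simp [hl]
  have hln : ∀ p ∈ l, p.1 < n := by
    intro p hp
    simp only [hl, List.mem_map, List.mem_reverse, List.mem_range] at hp
    obtain ⟨i, hi, rfl⟩ := hp
    exact hi
  have hl2 : ∀ p ∈ l, p.2 = 0 := by
    intro p hp
    simp only [hl, List.mem_map] at hp
    obtain ⟨i, -, rfl⟩ := hp
    rfl
  have hpw : l.Pairwise fun p q => q.1 < p.1 := by
    rw [hl, List.pairwise_map, List.pairwise_reverse]
    exact List.pairwise_lt_range
  have hmain := H.norm_prod_le K hc (by positivity) ha hε hδ0 hδ hE hR (N := n) n l hlen hpw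
    le_rfl hln
  set P := ApproxHeisenberg.prodX (fun i => x (R ^ i)) z l
  set Q := ApproxHeisenberg.prodY (fun i => y (a / R ^ i)) l
  set Ψ := K.op z 1 - K.op z 2
  have hΨ : ‖Ψ‖ ≤ 2 * c :=
    (norm_sub_le _ _).trans (by linarith [K.norm_op_le hc z 1, K.norm_op_le hc z 2])
  -- An average at a scale at least r² absorbs a mean over a time at most r with error O(1/r). This
  -- is the reason for the exponent 2n in the hypotheses.
  have hX : ‖K.op x lx * P - K.op x lx‖ ≤ n * (2 * c * (1 / r)) := by
    rw [← hlen]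
    refine norm_mul_list_prod_sub_le (f := fun p : ℕ × ℝ => halfAdd (x (R ^ p.1) * z p.2))
      (fun p => H.norm_halfAdd_xz_le p.1 p.2) _ l fun p hp => ?_
    rw [hl2 p hp, z.map_zero, mul_one]
    refine (K.norm_op_mul_halfAdd_sub_le hc x hlx0 _).trans ?_
    rw [abs_of_pos (by positivity : 0 < R ^ p.1), mul_div_assoc]
    refine mul_le_mul_of_nonneg_left ?_ (by positivity)
    rw [div_le_div_iff₀ (abs_pos.2 hlx0) hr0, one_mul]
    exact (mul_le_mul_of_nonneg_right (hRle _ (hln p hp)) hr0.le).trans hlx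
  have hY : ‖Q * K.op y ly - K.op y ly‖ ≤ n * (2 * c * (1 / r)) := by
    rw [← hlen]
    refine norm_list_prod_mul_sub_self_le (f := fun p : ℕ × ℝ => halfAdd (y (a / R ^ p.1)))
      (fun p => H.norm_halfAdd_y_le p.1) _ l fun p hp => ?_
    refine (K.norm_halfAdd_mul_op_sub_le hc y hly0 _).trans ?_
    rw [abs_of_pos (by positivity), mul_div_assoc]
    refine mul_le_mul_of_nonneg_left ?_ (by positivity)
    rw [div_le_div_iff₀ (abs_pos.2 hly0) hr0, one_mul]
    have h4 : a / R ^ p.1 ≤ 1 := by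
      rw [div_le_one (by positivity)]
      exact ha1.trans (one_le_pow₀ (by linarith))
    have h5 : 1 ≤ r := one_le_pow₀ (by linarith)
    nlinarith
  have hcomm : K.op y ly * Ψ = K.band z * (K.op y ly * Ψ) := by
    have h1 : Commute (K.op y ly) (K.band z) := K.commute_band _ z fun t =>
      (K.commute_op _ y ly fun s => (hyz s t).symm).symm
    rw [← mul_assoc, ← h1.eq, mul_assoc, K.band_mul_diff]
  have key : K.op x lx * K.op y ly * Ψ =
      -((K.op x lx * P - K.op x lx) * (K.op y ly * Ψ))
        - K.op x lx * P * ((Q * K.op y ly - K.op y ly) * Ψ)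
        + K.op x lx * (P * (Q * K.band z)) * (K.op y ly * Ψ) := by
    have h1 : K.op x lx * (P * (Q * K.band z)) * (K.op y ly * Ψ) =
        K.op x lx * P * (Q * (K.op y ly * Ψ)) := by
      conv_rhs => rw [hcomm]
      simp only [mul_assoc]
    rw [h1]
    noncomm_ring
  have hx := K.norm_op_le hc x lx
  have hyΨ : ‖K.op y ly * Ψ‖ ≤ c * (2 * c) :=
    (norm_mul_le _ _).trans (mul_le_mul (K.norm_op_le hc y ly) hΨ (norm_nonneg _) hc0.le)
  have hxP : ‖K.op x lx * P‖ ≤ c * 1 :=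
    (norm_mul_le _ _).trans (mul_le_mul hx (H.norm_prodX_le l) (norm_nonneg _) hc0.le)
  have t1 : ‖(K.op x lx * P - K.op x lx) * (K.op y ly * Ψ)‖ ≤
      n * (2 * c * (1 / r)) * (c * (2 * c)) :=
    (norm_mul_le _ _).trans (mul_le_mul hX hyΨ (norm_nonneg _) (by positivity))
  have t2 : ‖K.op x lx * P * ((Q * K.op y ly - K.op y ly) * Ψ)‖ ≤
      c * 1 * (n * (2 * c * (1 / r)) * (2 * c)) :=
    (norm_mul_le _ _).trans (mul_le_mul hxP ((norm_mul_le _ _).trans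
      (mul_le_mul hY hΨ (norm_nonneg _) (by positivity))) (norm_nonneg _) (by positivity))
  have hG : ‖P * (Q * K.band z)‖ ≤ (2 * c + 4 * D / δ) * ρ ^ n := by
    refine hmain.trans ?_
    rw [add_mul]
    refine add_le_add le_rfl ?_
    have h1 : (n : ℝ) * (τ * r) ≤ ρ ^ n := le_trans (by gcongr) hrρ
    calc 4 * D * (n * (τ * r)) / δ = 4 * D / δ * (n * (τ * r)) := by ring
      _ ≤ _ := by gcongr
  have t3 : ‖K.op x lx * (P * (Q * K.band z)) * (K.op y ly * Ψ)‖ ≤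
      c * ((2 * c + 4 * D / δ) * ρ ^ n) * (c * (2 * c)) :=
    (norm_mul_le _ _).trans (mul_le_mul ((norm_mul_le _ _).trans
      (mul_le_mul hx hG (norm_nonneg _) hc0.le)) hyΨ (norm_nonneg _) (by positivity))
  rw [key]
  refine (norm_add_le _ _).trans ((add_le_add ((norm_sub_le _ _).trans
    (add_le_add ((norm_neg _).le.trans t1) t2)) t3).trans ?_)
  have h5 := mul_le_mul_of_nonneg_left hrρ (by positivity : 0 ≤ 8 * c ^ 3)
  have h6 : n * (2 * c * (1 / r)) * (c * (2 * c)) + c * 1 * (n * (2 * c * (1 / r)) * (2 * c)) =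
      8 * c ^ 3 * (n * (1 / r)) := by ring
  rw [h6]
  refine (add_le_add h5 le_rfl).trans (le_of_eq ?_)
  ring

/-- The estimate of `exists_norm_op_mul_op_mul_diff_le` at all time scales. -/
theorem exists_norm_op_mul_op_mul_diff_le_rpow {a ε δ : ℝ} (ha : a = 1 / (32 * c ^ 2))
    (hε : ε = a / (192 * c)) (hδ0 : 0 < δ) (hδ : δ ≤ 1) :
    ∃ C κ : ℝ, 0 ≤ C ∧ 0 < κ ∧
      ∀ {E : Type u} [NormedAddCommGroup E] [NormedSpace ℝ E] [CompleteSpace E],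
      ConvexAt E ε δ → ∀ (x y z : IsomFlow E) (b τ lx ly lz μ L : ℝ), b ≠ 0 → 0 ≤ τ →
      (∀ s t, Commute (y s) (z t)) →
      (∀ p q, ‖x p * y q - y q * x p * z (b * p * q)‖ ≤ τ * |p| * |b * p * q|) →
      (∀ p t, ‖x p * z t - z t * x p‖ ≤ τ * |p| * |t|) →
      0 < lz → 0 < μ → 1 ≤ L →
      L * μ ≤ |lx| → L * lz ≤ |b| * μ * |ly| → τ * μ * lz * L ≤ 1 →
      ‖K.op x lx * K.op y ly * (K.op z lz - K.op z (2 * lz))‖ ≤ C * L ^ (-κ) := by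
  obtain ⟨R, C, ρ, hR, hC, hρ0, hρ1, h⟩ := exists_norm_op_mul_op_mul_diff_le.{u} K hc ha hε hδ0 hδ
  have hlogR : 0 < Real.log (R ^ 2) := Real.log_pos (by nlinarith)
  have hlogρ : Real.log ρ < 0 := Real.log_neg hρ0 hρ1
  set κ := -Real.log ρ / Real.log (R ^ 2) with hκ
  have hκ0 : 0 < κ := div_pos (by linarith) hlogR
  refine ⟨C / ρ, κ, by positivity, hκ0, ?_⟩
  intro E _ _ _ hE x y z b τ lx ly lz μ L hb hτ hyz hxy hxz hlz hμ hL hx hy hτL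
  obtain ⟨n, hn1, hn2⟩ := exists_nat_pow_near hL (by nlinarith : 1 < R ^ 2)
  rw [← pow_mul] at hn1
  have hb' := abs_pos.2 hb
  -- Rescaling brings `z` to scale 1 and the commutator constant to 1. The free parameter `μ`
  -- distributes the range between `x` and `y`.
  have := h hE (x.scale μ) (y.scale (lz / (b * μ))) (z.scale lz) (τ * μ * lz) (lx / μ)
    (ly * (b * μ) / lz) n (by positivity) (fun s t => hyz _ _) (fun p q => ?_) (fun p t => ?_)
    ?_ ?_ ?_
  · rw [K.op_scale, K.op_scale, K.op_scale, K.op_scale] at this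
    have e1 : μ * (lx / μ) = lx := by field_simp
    have e2 : lz / (b * μ) * (ly * (b * μ) / lz) = ly := by field_simp
    rw [e1, e2, mul_one, mul_comm lz 2] at this
    refine this.trans ?_
    have h1 : ρ ^ (n + 1) ≤ L ^ (-κ) := by
      have h2 : L ^ κ ≤ ((R ^ 2) ^ (n + 1)) ^ κ :=
        Real.rpow_le_rpow (by linarith) hn2.le hκ0.le
      have h3 : ((R ^ 2) ^ (n + 1)) ^ κ = (ρ ^ (n + 1))⁻¹ := by
        rw [← Real.rpow_natCast (R ^ 2), ← Real.rpow_mul (by positivity),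
          Real.rpow_def_of_pos (by positivity), hκ]
        have : Real.log (R ^ 2) * (((n + 1 : ℕ) : ℝ) * (-Real.log ρ / Real.log (R ^ 2))) =
            -(((n + 1 : ℕ) : ℝ) * Real.log ρ) := by
          field_simp
        rw [this, Real.exp_neg, ← Real.log_pow, Real.exp_log (by positivity)]
      rw [Real.rpow_neg (by linarith)]
      rw [h3] at h2
      exact (le_inv_comm₀ (Real.rpow_pos_of_pos (by linarith) _) (by positivity)).1 h2
    calc C * ρ ^ n = C / ρ * ρ ^ (n + 1) := by rw [pow_succ]; field_simp
      _ ≤ _ := by gcongr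
  · have e : b * (μ * p) * (lz / (b * μ) * q) = lz * (p * q) := by field_simp
    have h1 := hxy (μ * p) (lz / (b * μ) * q)
    rw [e] at h1
    refine h1.trans (le_of_eq ?_)
    rw [abs_mul μ, abs_mul lz, abs_of_pos hμ, abs_of_pos hlz]
    ring
  · refine (hxz _ _).trans (le_of_eq ?_)
    rw [abs_mul μ, abs_mul lz, abs_of_pos hμ, abs_of_pos hlz]
    ring
  · rw [abs_div, abs_of_pos hμ, le_div_iff₀ hμ]
    exact (mul_le_mul_of_nonneg_right hn1 hμ.le).trans hx
  · rw [abs_div, abs_mul, abs_mul, abs_of_pos hμ, abs_of_pos hlz, le_div_iff₀ hlz]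
    refine (mul_le_mul_of_nonneg_right hn1 hlz.le).trans (hy.trans (le_of_eq ?_))
    ring
  · exact (mul_le_mul_of_nonneg_left hn1 (by positivity)).trans hτL

end HeisenbergEstimate

/-! ### Affine isometric actions and averages of orbits -/

section AffineAction

variable {G : Type*} [Group G] {E : Type*} [NormedAddCommGroup E] [NormedSpace ℝ E]
  [MulAction G E] [IsIsometricSMul G E]

/-- The linear part of an isometry of the action, which is affine by the Mazur–Ulam theorem. -/
noncomputable def linPart (E : Type*) [NormedAddCommGroup E] [NormedSpace ℝ E]
    [MulAction G E] [IsIsometricSMul G E] (g : G) : E →L[ℝ] E :=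
  (IsometryEquiv.constSMul (X := E) g).toRealAffineIsometryEquiv.linearIsometryEquiv

theorem smul_add_eq (g : G) (v w : E) : g • (v + w) = g • v + linPart E g w := by
  have h := (IsometryEquiv.constSMul (X := E) g).toRealAffineIsometryEquiv.map_vadd v w
  simp only [vadd_eq_add] at h
  rw [add_comm w v] at h
  rw [add_comm (g • v)]
  exact h

theorem linPart_apply (g : G) (v w : E) : linPart E g (v - w) = g • v - g • w := by
  have h := smul_add_eq g w (v - w)
  rw [add_sub_cancel] at h
  rw [h, add_sub_cancel_left]

theorem norm_linPart (g : G) (v : E) : ‖linPart E g v‖ = ‖v‖ :=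
  LinearIsometryEquiv.norm_map _ v

theorem linPart_eq (g : G) (v : E) : linPart E g v = g • v - g • (0 : E) := by
  rw [← linPart_apply, sub_zero]

theorem linPart_mul (g h : G) : linPart E (g * h) = linPart E g * linPart E h := by
  ext v
  rw [mul_apply_eq_comp, linPart_eq h, linPart_apply, linPart_eq, mul_smul, mul_smul]

theorem linPart_one : linPart E (1 : G) = 1 := by
  ext v
  rw [linPart_eq, one_smul, one_smul, sub_zero, one_apply_eq_self]

theorem Commute.linPart {g h : G} (hgh : Commute g h) :
    Commute (_root_.linPart E g) (_root_.linPart E h) := by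
  rw [Commute, SemiconjBy, ← linPart_mul, ← linPart_mul, hgh.eq]

theorem norm_smul_sub_smul (g : G) (v w : E) : ‖g • v - g • w‖ = ‖v - w‖ := by
  rw [← linPart_apply, norm_linPart]

/-- A one-parameter subgroup that acts strongly continuously. -/
structure ActionFlow (G : Type*) [Group G] (E : Type*) [NormedAddCommGroup E]
    [MulAction G E] where
  toFun : ℝ → G
  map_add : ∀ s t, toFun (s + t) = toFun s * toFun t
  continuous : ∀ v : E, Continuous fun t => toFun t • v

instance : CoeFun (ActionFlow G E) fun _ => ℝ → G := ⟨ActionFlow.toFun⟩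

namespace ActionFlow

variable (x : ActionFlow G E)

omit [NormedSpace ℝ E] [IsIsometricSMul G E] in
theorem map_zero : x 0 = 1 := by
  have := x.map_add 0 0
  rw [add_zero] at this
  exact left_eq_mul.1 this

omit [NormedSpace ℝ E] [IsIsometricSMul G E] in
theorem commute (s t : ℝ) : Commute (x s) (x t) := by
  rw [Commute, SemiconjBy, ← x.map_add, ← x.map_add, add_comm]

/-- The flow of the linear parts. -/
noncomputable def lin : IsomFlow E where
  toFun t := linPart E (x t)
  map_add s t := by rw [x.map_add, linPart_mul]
  map_zero := by rw [x.map_zero, linPart_one]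
  norm_map t v := norm_linPart _ v
  continuous v := by
    simp only [linPart_eq]
    exact (x.continuous v).sub (x.continuous 0)

theorem lin_apply (t : ℝ) : x.lin t = linPart E (x t) := rfl

theorem norm_nat_mul_smul_sub_le (n : ℕ) (t : ℝ) (v : E) :
    ‖x (n * t) • v - v‖ ≤ n * ‖x t • v - v‖ := by
  induction n with
  | zero => simp [x.map_zero]
  | succ n ih =>
    have h : x ((n + 1 : ℕ) * t) • v - v =
        (x (n * t) • x t • v - x (n * t) • v) + (x (n * t) • v - v) := by
      push_cast
      rw [add_mul, one_mul, x.map_add, mul_smul]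
      abel
    rw [h]
    refine (norm_add_le _ _).trans ?_
    rw [norm_smul_sub_smul]
    push_cast
    linarith

theorem norm_smul_sub_le_of_small {B r : ℝ} (hr : 0 < r) {v : E}
    (h : ∀ t, |t| ≤ r → ‖x t • v - v‖ ≤ B * |t|) (t : ℝ) : ‖x t • v - v‖ ≤ B * |t| := by
  set n := ⌈|t| / r⌉₊ + 1 with hn
  have hn0 : (0 : ℝ) < n := by positivity
  have h1 : |t| / r ≤ n := (Nat.le_ceil _).trans (by exact_mod_cast Nat.le_succ _)
  have h2 : |t / n| ≤ r := by
    rw [abs_div, abs_of_pos hn0, div_le_iff₀ hn0]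
    rw [div_le_iff₀ hr] at h1
    linarith
  have h3 := x.norm_nat_mul_smul_sub_le n (t / n) v
  rw [mul_div_cancel₀ _ hn0.ne'] at h3
  refine h3.trans ((mul_le_mul_of_nonneg_left (h _ h2) hn0.le).trans (le_of_eq ?_))
  rw [abs_div, abs_of_pos hn0]
  field_simp

theorem exists_norm_smul_sub_le (v : E) : ∃ B, 0 ≤ B ∧ ∀ t, ‖x t • v - v‖ ≤ B * (1 + |t|) := by
  have hcont : Continuous fun t => ‖x t • v - v‖ := ((x.continuous v).sub continuous_const).norm
  obtain ⟨B, hB⟩ := (isCompact_Icc (a := (-1 : ℝ)) (b := 1)).bddAbove_image hcont.continuousOn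
  have hB' : ∀ t : ℝ, |t| ≤ 1 → ‖x t • v - v‖ ≤ B := fun t ht =>
    hB ⟨t, abs_le.1 ht, rfl⟩
  have hB0 : 0 ≤ B := (norm_nonneg _).trans (hB' 0 (by simp))
  refine ⟨2 * B, by positivity, fun t => ?_⟩
  set n := ⌈|t|⌉₊ + 1 with hn
  have hn0 : (0 : ℝ) < n := by positivity
  have h1 : |t| ≤ n := (Nat.le_ceil _).trans (by exact_mod_cast Nat.le_succ _)
  have h4 : (n : ℝ) ≤ 2 * (1 + |t|) := by
    have := (Nat.ceil_lt_add_one (abs_nonneg t)).le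
    rw [hn]; push_cast
    linarith [abs_nonneg t]
  have h3 := x.norm_nat_mul_smul_sub_le n (t / n) v
  rw [mul_div_cancel₀ _ hn0.ne'] at h3
  have h5 := hB' (t / n) (by rw [abs_div, abs_of_pos hn0, div_le_one hn0]; exact h1)
  calc _ ≤ n * B := h3.trans (by gcongr)
    _ ≤ 2 * (1 + |t|) * B := by gcongr
    _ = _ := by ring

omit [NormedSpace ℝ E] [IsIsometricSMul G E] in
theorem quadGrowth_smul_sub {l B : ℝ} {v : E} (h : ∀ t, ‖x (l * t) • v - v‖ ≤ B * (1 + |t|)) :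
    QuadGrowth (fun t => x (l * t) • v - v) B :=
  .of_linear (((x.continuous v).comp (by fun_prop)).sub continuous_const) h

theorem exists_quadGrowth (l : ℝ) (v : E) : ∃ B, 0 ≤ B ∧
    QuadGrowth (fun t => x (l * t) • v) B := by
  obtain ⟨B, hB0, hB⟩ := x.exists_norm_smul_sub_le v
  have h2 : 0 ≤ ‖v‖ + B * (1 + |l|) := by positivity
  refine ⟨‖v‖ + B * (1 + |l|), h2, .of_linear ((x.continuous v).comp (by fun_prop)) fun t => ?_⟩
  have h1 : ‖x (l * t) • v‖ ≤ ‖v‖ + B * (1 + |l * t|) := by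
    have := norm_add_le v (x (l * t) • v - v)
    rw [add_sub_cancel] at this
    linarith [hB (l * t)]
  refine h1.trans ?_
  rw [abs_mul]
  have h3 := mul_nonneg (norm_nonneg v) (abs_nonneg t)
  have h4 : B * (1 + |l| * |t|) ≤ B * ((1 + |l|) * (1 + |t|)) := by
    gcongr
    nlinarith [abs_nonneg l, abs_nonneg t]
  nlinarith

theorem continuous_smul_uncurry {f : ℝ → E} (hf : Continuous f) (l : ℝ) :
    Continuous fun p : ℝ × ℝ => x (l * p.1) • f p.2 := by
  rw [continuous_iff_continuousAt]
  rintro ⟨s, t⟩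
  have h1 : Filter.Tendsto (fun p : ℝ × ℝ => ‖f p.2 - f t‖) (nhds (s, t)) (nhds 0) := by
    have : Continuous fun p : ℝ × ℝ => ‖f p.2 - f t‖ := by fun_prop
    simpa using this.tendsto (s, t)
  have h2 : Filter.Tendsto (fun p : ℝ × ℝ => ‖x (l * p.1) • f t - x (l * s) • f t‖)
      (nhds (s, t)) (nhds 0) := by
    have h3 : Continuous fun r : ℝ => x (l * r) • f t := (x.continuous (f t)).comp (by fun_prop)
    have : Continuous fun p : ℝ × ℝ => ‖x (l * p.1) • f t - x (l * s) • f t‖ := by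
      have := h3.comp (continuous_fst (X := ℝ) (Y := ℝ))
      simp only [Function.comp_def] at this
      fun_prop
    simpa using this.tendsto (s, t)
  rw [ContinuousAt, tendsto_iff_norm_sub_tendsto_zero]
  refine squeeze_zero (fun _ => norm_nonneg _) (fun p => ?_) (by simpa using h1.add h2)
  have h4 := norm_add_le (x (l * p.1) • f p.2 - x (l * p.1) • f t)
    (x (l * p.1) • f t - x (l * s) • f t)
  rw [sub_add_sub_cancel, norm_smul_sub_smul] at h4
  exact h4

end ActionFlow

/-- The average of the orbit of `v` under `x` at the time scale `l`. -/
noncomputable def affAvg (φ : ℝ → ℝ) (x : ActionFlow G E) (l : ℝ) (v : E) : E :=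
  kavg φ fun t => x (l * t) • v

namespace AveragingKernel

variable {φ : ℝ → ℝ} (K : AveragingKernel φ) {c : ℝ} (hc : KernelBound φ c) [CompleteSpace E]

include K

/-- An affine map commutes with averages because the kernel has integral 1. -/
theorem smul_kavg (g : G) {f : ℝ → E} {B : ℝ} (hf : QuadGrowth f B) :
    g • kavg φ f = kavg φ fun t => g • f t := by
  have h1 (v : E) : g • v = linPart E g v + g • (0 : E) := by rw [linPart_eq, sub_add_cancel]
  have h2 : kavg φ (fun t => g • f t) = kavg φ fun t => linPart E g (f t) + g • (0 : E) := by
    congr 1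
    funext t
    exact h1 _
  have h3 : QuadGrowth (fun t => linPart E g (f t)) B :=
    ⟨(linPart E g).continuous.comp hf.continuous, fun t => by
      rw [norm_linPart]; exact hf.norm_le t⟩
  rw [h1, h2, K.kavg_add h3 (QuadGrowth.of_bounded continuous_const fun _ => le_rfl),
    K.kavg_const, K.map_kavg _ hf]

omit [CompleteSpace E] in
theorem affAvg_sub (x : ActionFlow G E) (l : ℝ) (v w : E) :
    affAvg φ x l v - affAvg φ x l w = K.op x.lin l (v - w) := by
  obtain ⟨A, -, hA⟩ := x.exists_quadGrowth l v
  obtain ⟨B, -, hB⟩ := x.exists_quadGrowth l w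
  rw [affAvg, affAvg, ← K.kavg_sub hA hB, K.op_apply]
  congr 1
  funext t
  rw [x.lin_apply, linPart_apply]

theorem smul_affAvg (g : G) (x : ActionFlow G E) (l : ℝ) (v : E) (h : ∀ t, Commute g (x t)) :
    g • affAvg φ x l v = affAvg φ x l (g • v) := by
  obtain ⟨A, -, hA⟩ := x.exists_quadGrowth l v
  rw [affAvg, K.smul_kavg g hA, affAvg]
  congr 1
  funext t
  rw [← mul_smul, (h _).eq, mul_smul]

theorem affAvg_affAvg_eq (x y : ActionFlow G E) (l m : ℝ) (v : E) :
    affAvg φ x l (affAvg φ y m v) = kavg φ fun s => kavg φ fun t => x (l * s) • y (m * t) • v := by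
  obtain ⟨A, -, hA⟩ := y.exists_quadGrowth m v
  rw [affAvg]
  congr 1
  funext s
  rw [affAvg, K.smul_kavg _ hA]

omit K [CompleteSpace E] in
theorem exists_norm_smul_smul_le (x y : ActionFlow G E) (l m : ℝ) (v : E) : ∃ B, ∀ s t,
    ‖x (l * s) • y (m * t) • v‖ ≤ B * ((1 + |s|) ^ 2 * (1 + |t|) ^ 2) := by
  obtain ⟨A, hA0, hA⟩ := x.exists_quadGrowth l v
  obtain ⟨B, hB0, hB⟩ := y.exists_quadGrowth m v
  refine ⟨A + (B + ‖v‖), fun s t => ?_⟩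
  have h1 : ‖x (l * s) • y (m * t) • v‖ ≤ ‖x (l * s) • v‖ + (‖y (m * t) • v‖ + ‖v‖) := by
    have h2 := norm_add_le (x (l * s) • v) (x (l * s) • y (m * t) • v - x (l * s) • v)
    rw [add_sub_cancel, norm_smul_sub_smul] at h2
    linarith [norm_sub_le (y (m * t) • v) v]
  have h3 := hA.norm_le s
  have h4 := hB.norm_le t
  set S := (1 + |s|) ^ 2
  set T := (1 + |t|) ^ 2
  have hS : 1 ≤ S := one_le_one_add_abs_sq s
  have hT : 1 ≤ T := one_le_one_add_abs_sq t
  have e1 : A * S ≤ A * (S * T) := by gcongr; nlinarith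
  have e2 : B * T ≤ B * (S * T) := by gcongr; nlinarith
  have e3 : ‖v‖ ≤ ‖v‖ * (S * T) := le_mul_of_one_le_right (norm_nonneg v) (by nlinarith)
  linarith

theorem affAvg_affAvg_eq' (x y : ActionFlow G E) (l m : ℝ) (v : E) :
    affAvg φ x l (affAvg φ y m v) = kavg φ fun t => kavg φ fun s => x (l * s) • y (m * t) • v := by
  obtain ⟨B, hB⟩ := exists_norm_smul_smul_le x y l m v
  rw [K.affAvg_affAvg_eq]
  exact K.kavg_comm (F := fun s t => x (l * s) • y (m * t) • v)
    (x.continuous_smul_uncurry ((y.continuous v).comp (by fun_prop)) l) hB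

theorem affAvg_comm (x y : ActionFlow G E) (l m : ℝ) (v : E) (h : ∀ s t, Commute (x s) (y t)) :
    affAvg φ x l (affAvg φ y m v) = affAvg φ y m (affAvg φ x l v) := by
  rw [K.affAvg_affAvg_eq', K.affAvg_affAvg_eq]
  congr 1
  funext t
  congr 1
  funext s
  rw [← mul_smul, (h _ _).eq, mul_smul]

theorem affAvg_half_affAvg (x : ActionFlow G E) (l : ℝ) (v : E) :
    affAvg φ x (l / 2) (affAvg φ x l v) = affAvg φ x l v := by
  obtain ⟨B, -, hB⟩ := x.exists_quadGrowth l v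
  rw [K.affAvg_affAvg_eq]
  refine Eq.trans ?_ (K.kavg_kavg_half hB)
  congr 1
  funext s
  congr 1
  funext t
  rw [← mul_smul, ← x.map_add]
  congr 2
  ring

theorem affAvg_affAvg_of_lt (x : ActionFlow G E) (k : ℕ) {l m : ℝ} (h : l = m * 2 ^ (k + 1))
    (v : E) : affAvg φ x m (affAvg φ x l v) = affAvg φ x l v ∧
      affAvg φ x l (affAvg φ x m v) = affAvg φ x l v := by
  have h1 : ∀ k : ℕ, affAvg φ x (l / 2 ^ (k + 1)) (affAvg φ x l v) = affAvg φ x l v := by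
    intro k
    induction k with
    | zero => simpa using K.affAvg_half_affAvg x l v
    | succ k ih =>
      have h := K.affAvg_half_affAvg x (l / 2 ^ (k + 1)) (affAvg φ x l v)
      rwa [ih, div_div, ← pow_succ] at h
  have h2 : l / 2 ^ (k + 1) = m := by rw [h]; field_simp
  have h3 := h1 k
  rw [h2] at h3
  exact ⟨h3, by rw [K.affAvg_comm x x l m v fun s t => x.commute s t, h3]⟩

/-- The difference of averages at successive scales in terms of linear operators. -/
theorem affAvg_sub_affAvg_two_mul (x : ActionFlow G E) (l : ℝ) (v : E) :
    affAvg φ x l v - affAvg φ x (2 * l) v =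
      (K.op x.lin l - K.op x.lin (2 * l)) (affAvg φ x (l / 2) v - affAvg φ x (4 * l) v) := by
  -- Averages at scales l and 2l absorb the one at l/2 and are absorbed by the one at 4l, so the two
  -- contributions of 4l cancel. The gain is that the linear operator now acts on a difference of
  -- averages of `v`, whose size is bounded by the growth of the orbit.
  rw [sub_apply, ← K.affAvg_sub, ← K.affAvg_sub,
    (K.affAvg_affAvg_of_lt x 0 (l := l) (m := l / 2) (by ring) v).2,
    (K.affAvg_affAvg_of_lt x 1 (l := 4 * l) (m := l) (by ring) v).1,
    (K.affAvg_affAvg_of_lt x 1 (l := 2 * l) (m := l / 2) (by ring) v).2,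
    (K.affAvg_affAvg_of_lt x 0 (l := 4 * l) (m := 2 * l) (by ring) v).1]
  abel

include hc

omit [CompleteSpace E] in
theorem norm_affAvg_sub_affAvg_le (x : ActionFlow G E) (l : ℝ) (v w : E) :
    ‖affAvg φ x l v - affAvg φ x l w‖ ≤ c * ‖v - w‖ := by
  rw [K.affAvg_sub]
  exact (ContinuousLinearMap.le_opNorm _ _).trans
    (mul_le_mul_of_nonneg_right (K.norm_op_le hc _ _) (norm_nonneg _))

theorem norm_affAvg_sub_le (x : ActionFlow G E) {l B : ℝ} {v : E}
    (h : ∀ t, ‖x (l * t) • v - v‖ ≤ B * (1 + |t|)) : ‖affAvg φ x l v - v‖ ≤ B * c := by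
  obtain ⟨A, -, hA⟩ := x.exists_quadGrowth l v
  have h1 : affAvg φ x l v - v = kavg φ fun t => x (l * t) • v - v := by
    rw [K.kavg_sub hA (QuadGrowth.of_bounded continuous_const fun _ => le_rfl), K.kavg_const]
    rfl
  rw [h1]
  exact K.norm_kavg_le hc (x.quadGrowth_smul_sub h).norm_le

/-- The affine Bernstein inequality: the size of `v` is replaced by the growth `B` of its orbit at
scale `l`. Only |r| ≤ l has to be checked, since Lipschitz bounds for orbits extend to all times. -/
theorem norm_smul_affAvg_sub_le (x : ActionFlow G E) {l B : ℝ} (hl : 0 < l) {v : E}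
    (h : ∀ t, ‖x (l * t) • v - v‖ ≤ B * (1 + |t|)) (r : ℝ) :
    ‖x r • affAvg φ x l v - affAvg φ x l v‖ ≤ B * c / l * |r| := by
  refine x.norm_smul_sub_le_of_small hl (fun r hr => ?_) r
  obtain ⟨A, -, hA⟩ := x.exists_quadGrowth l v
  have hconst : QuadGrowth (fun _ : ℝ => v) ‖v‖ :=
    QuadGrowth.of_bounded continuous_const fun _ => le_rfl
  have hr' : |r / l| ≤ 1 := by
    rw [abs_div, abs_of_pos hl, div_le_one hl]; exact hr
  have h1 := K.norm_kavg_shift_sub_le hc (x.quadGrowth_smul_sub h) hr'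
  have hA' : QuadGrowth (fun t => x (l * (t + r / l)) • v) (A * (1 + |r / l|) ^ 2) :=
    ⟨hA.continuous.comp (f := fun t => t + r / l) (by fun_prop), fun t => (hA.norm_le _).trans (by
      have := mul_le_mul_of_nonneg_left (one_add_abs_add_sq_le t (r / l)) hA.nonneg
      linarith)⟩
  rw [K.kavg_sub hA' hconst, K.kavg_sub hA hconst, sub_sub_sub_cancel_right] at h1
  have h2 : x r • affAvg φ x l v = kavg φ fun t => x (l * (t + r / l)) • v := by
    rw [affAvg, K.smul_kavg _ hA]
    congr 1
    funext t
    rw [← mul_smul, ← x.map_add]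
    congr 2
    field_simp
    ring
  rw [h2, affAvg]
  refine h1.trans (le_of_eq ?_)
  rw [abs_div, abs_of_pos hl]
  ring

end AveragingKernel

/-- At most logarithmic growth of the orbit of `v` under `x`. -/
def LogGrowth (x : ActionFlow G E) (v : E) (B : ℝ) : Prop :=
  ∀ (k : ℕ) (l : ℝ), |l| ≤ 2 ^ k → ∀ s, ‖x (l * s) • v - v‖ ≤ B * (1 + k) * (1 + |s|)

theorem norm_pow_smul_sub_le (g : G) (n : ℕ) (v : E) : ‖g ^ n • v - v‖ ≤ n * ‖g • v - v‖ := by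
  induction n with
  | zero => simp
  | succ n ih =>
    have h : g ^ (n + 1) • v - v = (g ^ n • g • v - g ^ n • v) + (g ^ n • v - v) := by
      rw [pow_succ, mul_smul]; abel
    rw [h]
    refine (norm_add_le _ _).trans ?_
    rw [norm_smul_sub_smul]
    push_cast
    linarith

/-- Conjugation by h^k shortens the time by the factor 2^k, and h^k displaces `v` by at most k times
what `h` does. -/
theorem ActionFlow.exists_logGrowth (x : ActionFlow G E) {h : G}
    (hx : ∀ t, h * x t * h⁻¹ = x (2 * t)) (v : E) : ∃ B, 0 ≤ B ∧ LogGrowth x v B := by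
  obtain ⟨B, hB0, hB⟩ := x.exists_norm_smul_sub_le v
  set D := ‖h • v - v‖
  refine ⟨B + 2 * D, by positivity, fun k l hl s => ?_⟩
  have hconj : ∀ (k : ℕ) (t : ℝ), h ^ k * x t * (h ^ k)⁻¹ = x (2 ^ k * t) := by
    intro k t
    induction k with
    | zero => simp
    | succ k ih =>
      have : h ^ (k + 1) * x t * (h ^ (k + 1))⁻¹ = h * (h ^ k * x t * (h ^ k)⁻¹) * h⁻¹ := by
        rw [pow_succ']; group
      rw [this, ih, hx]
      congr 1
      ring
  set r := l / 2 ^ k with hr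
  have hlr : l * s = 2 ^ k * (r * s) := by rw [hr]; field_simp
  have hr1 : |r| ≤ 1 := by
    rw [hr, abs_div, abs_of_pos (by positivity : (0 : ℝ) < 2 ^ k), div_le_one (by positivity)]
    exact hl
  set g := h ^ k
  have hg : ‖g⁻¹ • v - v‖ ≤ k * D := by
    rw [← norm_smul_sub_smul g, smul_inv_smul, norm_sub_rev]
    exact norm_pow_smul_sub_le h k v
  have h1 : ‖x (l * s) • v - v‖ = ‖x (r * s) • g⁻¹ • v - g⁻¹ • v‖ := by
    rw [hlr, ← hconj, mul_smul, mul_smul, ← norm_smul_sub_smul g⁻¹, inv_smul_smul]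
  have h2 : x (r * s) • g⁻¹ • v - g⁻¹ • v =
      (x (r * s) • g⁻¹ • v - x (r * s) • v) + (x (r * s) • v - v) - (g⁻¹ • v - v) := by abel
  have h3 : ‖x (l * s) • v - v‖ ≤ k * D + B * (1 + |r * s|) + k * D := by
    rw [h1, h2]
    refine (norm_sub_le _ _).trans (add_le_add ((norm_add_le _ _).trans
      (add_le_add ?_ (hB _))) hg)
    rw [norm_smul_sub_smul]
    exact hg
  have h4 : |r * s| ≤ |s| := by
    rw [abs_mul]; exact mul_le_of_le_one_left (abs_nonneg s) hr1
  have hD : 0 ≤ D := norm_nonneg _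
  have hk : (0 : ℝ) ≤ k := Nat.cast_nonneg k
  have hs := abs_nonneg s
  refine h3.trans ?_
  have e1 : B * (1 + |r * s|) ≤ B * ((1 + k) * (1 + |s|)) := by
    gcongr
    nlinarith
  have e2 : k * D ≤ D * ((1 + k) * (1 + |s|)) := by
    rw [mul_comm]
    gcongr
    nlinarith
  linarith

end AffineAction

/-! ### Restriction to invariant subspaces; absorbing constants -/

section Restriction

variable {E : Type u} [NormedAddCommGroup E] [NormedSpace ℝ E]

/-- The restriction of a flow to an invariant subspace. -/
def IsomFlow.restrict (x : IsomFlow E) (V : Submodule ℝ E) (h : ∀ t, ∀ v ∈ V, x t v ∈ V) :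
    IsomFlow V where
  toFun t := ((x t).comp V.subtypeL).codRestrict V fun v => h t v v.2
  map_add s t := by
    ext v
    change x (s + t) v = x s (x t v)
    rw [x.map_add, mul_apply_eq_comp]
  map_zero := by
    ext v
    change x 0 v = v
    rw [x.map_zero, one_apply_eq_self]
  norm_map t v := x.norm_map t v
  continuous v := (x.continuous (v : E)).subtype_mk _

theorem ConvexAt.submodule {ε δ : ℝ} (hE : ConvexAt E ε δ) (V : Submodule ℝ E) :
    ConvexAt V ε δ := fun u v hu hv h => hE (u : E) (v : E) hu hv h

namespace AveragingKernel

variable {φ : ℝ → ℝ} (K : AveragingKernel φ) {c : ℝ} (hc : KernelBound φ c) [CompleteSpace E]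

theorem coe_op_restrict (x : IsomFlow E) (V : Submodule ℝ E) [CompleteSpace V]
    (h : ∀ t, ∀ v ∈ V, x t v ∈ V) (l : ℝ) (v : V) :
    (K.op (x.restrict V h) l v : E) = K.op x l v := by
  have := K.map_kavg V.subtypeL (AveragingKernel.quadGrowth_flow (x.restrict V h) l v)
  rw [op_apply, op_apply]
  exact this

include hc

/-- The estimate `exists_norm_op_mul_op_mul_diff_le_rpow` with arbitrary constants. -/
theorem exists_norm_op_mul_op_mul_diff_le_pow {a ε δ : ℝ} (ha : a = 1 / (32 * c ^ 2))
    (hε : ε = a / (192 * c)) (hδ0 : 0 < δ) (hδ : δ ≤ 1) {b : ℝ} (hb : b ≠ 0) {D : ℝ}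
    (hD : 0 ≤ D) :
    ∃ C q : ℝ, 0 ≤ C ∧ 0 < q ∧ q < 1 ∧
      ∀ {E : Type u} [NormedAddCommGroup E] [NormedSpace ℝ E] [CompleteSpace E],
      ConvexAt E ε δ → ∀ (x y z : IsomFlow E) (τ lx ly lz μ : ℝ) (n : ℕ), 0 ≤ τ →
      (∀ s t, Commute (y s) (z t)) →
      (∀ p q, ‖x p * y q - y q * x p * z (b * p * q)‖ ≤ τ * |p| * |b * p * q|) →
      (∀ p t, ‖x p * z t - z t * x p‖ ≤ τ * |p| * |t|) →
      0 < lx → 0 < ly → 0 < lz → 0 < μ →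
      √2 ^ n * μ ≤ lx → √2 ^ n * lz ≤ μ * ly → τ * μ * lz * √2 ^ n ≤ D →
      ‖K.op x lx * K.op y ly * (K.op z lz - K.op z (2 * lz))‖ ≤ C * q ^ n := by
  obtain ⟨C, κ, hC, hκ, h⟩ :=
    exists_norm_op_mul_op_mul_diff_le_rpow.{u} K hc ha hε hδ0 hδ
  have hc1 := hc.one_le
  have hb' : 0 < |b| := abs_pos.2 hb
  -- The constants `b` and `D` are absorbed by weakening the range √2^n to θ√2^n, at the price of
  -- the factor θ^(-κ). If θ√2^n < 1, the trivial bound 2c³ suffices.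
  set θ := min 1 (min |b| (1 / (1 + D))) with hθ
  have hθ0 : 0 < θ := by positivity
  have hθ1 : θ ≤ 1 := min_le_left _ _
  have hθb : θ ≤ |b| := (min_le_right _ _).trans (min_le_left _ _)
  have hθD : θ * (1 + D) ≤ 1 := by
    rw [← le_div_iff₀ (by positivity)]
    exact (min_le_right _ _).trans (min_le_right _ _)
  have h2 : 1 < √2 := Real.lt_sqrt_of_sq_lt (by norm_num)
  refine ⟨(C + 2 * c ^ 3) * θ ^ (-κ), √2 ^ (-κ), by positivity, by positivity,
    Real.rpow_lt_one_of_one_lt_of_neg h2 (by linarith), ?_⟩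
  intro E _ _ _ hE x y z τ lx ly lz μ n hτ hyz hxy hxz hlx hly hlz hμ h3 h4 h5
  have hΛ : (0 : ℝ) < √2 ^ n := by positivity
  have e1 : (√2 ^ (-κ)) ^ n = (√2 ^ n) ^ (-κ) := by
    rw [← Real.rpow_natCast, ← Real.rpow_mul (by positivity), ← Real.rpow_natCast √2 n,
      ← Real.rpow_mul (by positivity), mul_comm]
  have e2 : (C + 2 * c ^ 3) * θ ^ (-κ) * (√2 ^ (-κ)) ^ n =
      (C + 2 * c ^ 3) * (θ * √2 ^ n) ^ (-κ) := by
    rw [e1, Real.mul_rpow hθ0.le hΛ.le, mul_assoc]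
  rw [e2]
  have hpos : 0 < (θ * √2 ^ n) ^ (-κ) := by positivity
  rcases le_or_gt 1 (θ * √2 ^ n) with hL | hL
  · have := h hE x y z b τ lx ly lz μ (θ * √2 ^ n) hb hτ hyz hxy hxz hlz hμ hL ?_ ?_ ?_
    · exact this.trans (mul_le_mul_of_nonneg_right (by linarith [pow_pos (by linarith : 0 < c) 3])
        hpos.le)
    · rw [abs_of_pos hlx, mul_assoc]
      exact (mul_le_of_le_one_left (by positivity) hθ1).trans h3
    · rw [abs_of_pos hly, mul_assoc, mul_assoc]
      gcongr
    · calc τ * μ * lz * (θ * √2 ^ n) = θ * (τ * μ * lz * √2 ^ n) := by ring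
        _ ≤ θ * D := by gcongr
        _ ≤ 1 := by linarith
  · have h6 : 1 ≤ (θ * √2 ^ n) ^ (-κ) :=
      Real.one_le_rpow_of_pos_of_le_one_of_nonpos (by positivity) hL.le (by linarith)
    have h7 : ‖K.op x lx * K.op y ly * (K.op z lz - K.op z (2 * lz))‖ ≤ c * c * (c + c) := by
      refine (norm_mul_le _ _).trans (mul_le_mul ((norm_mul_le _ _).trans ?_)
        ((norm_sub_le _ _).trans ?_) (norm_nonneg _) (by positivity))
      · exact mul_le_mul (K.norm_op_le hc _ _) (K.norm_op_le hc _ _) (norm_nonneg _) (by positivity)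
      · exact add_le_add (K.norm_op_le hc _ _) (K.norm_op_le hc _ _)
    have h8 : c * c * (c + c) ≤ C + 2 * c ^ 3 := by linarith [(by ring : c * c * (c + c) = 2 * c ^ 3)]
    exact h7.trans (h8.trans (le_mul_of_one_le_right (by positivity) h6))

end AveragingKernel

end Restriction

/-! ### Chains of root subgroups -/

section RootChain

/-- Five one-parameter subgroups that satisfy the commutator relations of the root subgroups for
consecutive roots of a root system of type `C₂`; the roots `2` and `0` are long. The subgroup of
the root between the roots `1` and `3` is `x₂`, that of the root between `1` and `7` is `x₀`. -/
structure RootChain (G : Type*) [Group G] (E : Type*) [NormedAddCommGroup E] [MulAction G E] where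
  x₃ : ActionFlow G E
  x₂ : ActionFlow G E
  x₁ : ActionFlow G E
  x₀ : ActionFlow G E
  x₇ : ActionFlow G E
  b₂ : ℝ
  b₁ : ℝ
  b₀ : ℝ
  d : ℝ
  b₂_ne : b₂ ≠ 0
  b₁_ne : b₁ ≠ 0
  b₀_ne : b₀ ≠ 0
  comm₂₁ : ∀ s t, Commute (x₂ s) (x₁ t)
  comm₂₃ : ∀ s t, Commute (x₂ s) (x₃ t)
  comm₂₀ : ∀ s t, Commute (x₂ s) (x₀ t)
  comm₁₀ : ∀ s t, Commute (x₁ s) (x₀ t)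
  comm₀₇ : ∀ s t, Commute (x₀ s) (x₇ t)
  rel₃₁ : ∀ p q, x₃ p * x₁ q = x₁ q * x₃ p * x₂ (b₂ * p * q)
  rel₁₇ : ∀ p q, x₁ p * x₇ q = x₇ q * x₁ p * x₀ (b₀ * p * q)
  rel₃₀ : ∀ p q, x₃ p * x₀ q = x₀ q * x₃ p * x₁ (b₁ * p * q) * x₂ (d * p ^ 2 * q)

variable {G : Type*} [Group G] {E : Type u} [NormedAddCommGroup E] [NormedSpace ℝ E]
  [MulAction G E] [IsIsometricSMul G E]

theorem ActionFlow.lin_commute {x y : ActionFlow G E} {s t : ℝ} (h : Commute (x s) (y t)) :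
    Commute (x.lin s) (y.lin t) := h.linPart

namespace AveragingKernel

variable {φ : ℝ → ℝ} (K : AveragingKernel φ) {c : ℝ} (hc : KernelBound φ c) [CompleteSpace E]

theorem op_lin_commute {x y : ActionFlow G E} (h : ∀ s t, Commute (x s) (y t)) (l m : ℝ) :
    Commute (K.op x.lin l) (K.op y.lin m) :=
  K.commute_op _ _ _ fun _ => (K.commute_op _ _ _ fun _ =>
    (ActionFlow.lin_commute (h _ _)).symm).symm

/-- Exponential decay of averages over `x` and `y` of differences of averages over `z`. -/
def DiffBound (x y z : ActionFlow G E) (C q : ℝ) : Prop :=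
  ∀ (n : ℕ) (lx ly lz μ : ℝ), 0 < lx → 0 < ly → 0 < lz → 0 < μ →
    √2 ^ n * μ ≤ lx → √2 ^ n * lz ≤ μ * ly →
    ‖K.op x.lin lx * K.op y.lin ly * (K.op z.lin lz - K.op z.lin (2 * lz))‖ ≤ C * q ^ n

variable {K} in
omit [CompleteSpace E] in
theorem DiffBound.mono {x y z : ActionFlow G E} {C q C' q' : ℝ} (h : K.DiffBound x y z C q)
    (hC : C ≤ C') (hC0 : 0 ≤ C) (hq0 : 0 ≤ q) (hq : q ≤ q') : K.DiffBound x y z C' q' :=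
  fun n lx ly lz μ h1 h2 h3 h4 h5 h6 =>
    (h n lx ly lz μ h1 h2 h3 h4 h5 h6).trans (by have := hC0.trans hC; gcongr)

include hc

theorem exists_diffBound {a ε δ : ℝ} (ha : a = 1 / (32 * c ^ 2))
    (hε : ε = a / (192 * c)) (hδ0 : 0 < δ) (hδ : δ ≤ 1) (hE : ConvexAt E ε δ)
    {x y z : ActionFlow G E} {b : ℝ} (hb : b ≠ 0) (hyz : ∀ s t, Commute (y s) (z t))
    (hxz : ∀ s t, Commute (x s) (z t)) (hxy : ∀ p q, x p * y q = y q * x p * z (b * p * q)) :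
    ∃ C q : ℝ, 0 ≤ C ∧ 0 < q ∧ q < 1 ∧ K.DiffBound x y z C q := by
  obtain ⟨C, q, hC, hq0, hq1, h⟩ :=
    exists_norm_op_mul_op_mul_diff_le_pow.{u} K hc ha hε hδ0 hδ hb le_rfl
  refine ⟨C, q, hC, hq0, hq1, fun n lx ly lz μ h1 h2 h3 h4 h5 h6 =>
    h hE x.lin y.lin z.lin 0 lx ly lz μ n le_rfl (fun s t => ActionFlow.lin_commute (hyz s t))
      (fun p r => ?_) (fun p t => ?_) h1 h2 h3 h4 h5 h6 (by simp)⟩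
  · simp only [ActionFlow.lin_apply, ← linPart_mul]
    rw [hxy, sub_self]
    simp
  · rw [(ActionFlow.lin_commute (hxz p t)).eq, sub_self]
    simp

/-- Exponential decay of averages of differences of averages over `x₁`, derived from the
commutators of `x₃` and `x₀`. -/
theorem exists_norm_op_mul_op_mul_op_mul_diff_le {a ε δ : ℝ} (ha : a = 1 / (32 * c ^ 2))
    (hε : ε = a / (192 * c)) (hδ0 : 0 < δ) (hδ : δ ≤ 1) (hE : ConvexAt E ε δ)
    (X : RootChain G E) :
    ∃ C q : ℝ, 0 ≤ C ∧ 0 < q ∧ q < 1 ∧ ∀ (n : ℕ) (l₃ l₂ l₁ l₀ μ : ℝ), 0 < l₃ → 0 < l₂ → 0 < l₁ →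
      0 < l₀ → 0 < μ → √2 ^ n * μ ≤ l₃ → √2 ^ n * l₁ ≤ μ * l₀ → μ * l₁ * √2 ^ n ≤ l₂ →
      ‖K.op X.x₃.lin l₃ * K.op X.x₂.lin l₂ * (K.op X.x₀.lin l₀ *
        (K.op X.x₁.lin l₁ - K.op X.x₁.lin (2 * l₁)))‖ ≤ C * q ^ n := by
  have hc1 := hc.one_le
  have hc0 : 0 < c := by linarith
  set D := 4 * c * (|X.d / X.b₁| + |X.b₂|) with hD
  have hD0 : 0 ≤ D := by positivity
  obtain ⟨C, q, hC, hq0, hq1, h⟩ :=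
    exists_norm_op_mul_op_mul_diff_le_pow.{u} K hc ha hε hδ0 hδ X.b₁_ne hD0
  refine ⟨C * c, q, by positivity, hq0, hq1, fun n l₃ l₂ l₁ l₀ μ h3 h2 h1 h0 hμ h4 h5 h6 => ?_⟩
  set P := K.op X.x₂.lin (l₂ / 2) with hP
  -- On this space `x₂` is Lipschitz with constant O(1/l₂), so the factors `x₂` in `rel₃₀` and
  -- `rel₃₁` are errors with τ = D/l₂, and `x₃`, `x₀`, `x₁` form an approximate Heisenberg group.
  -- The space is invariant under these flows because they commute with `x₂`, and it contains the
  -- range of the average over `x₂` at scale `l₂`.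
  set V : Submodule ℝ E := LinearMap.ker ((P - 1 : E →L[ℝ] E) : E →ₗ[ℝ] E) with hV
  have hmem (v : E) : v ∈ V ↔ P v = v := by
    rw [hV, LinearMap.mem_ker]
    change P v - v = 0 ↔ _
    exact sub_eq_zero
  have hVc : IsClosed (V : Set E) := (P - 1 : E →L[ℝ] E).isClosed_ker
  have : CompleteSpace V := hVc.completeSpace_coe
  have inv {x : ActionFlow G E} (hx : ∀ s t, Commute (X.x₂ s) (x t)) (t : ℝ) :
      ∀ v ∈ V, x.lin t v ∈ V := by
    intro v hv
    rw [hmem] at hv ⊢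
    have hcomm : Commute (x.lin t) P :=
      K.commute_op _ _ _ fun s => ActionFlow.lin_commute (hx s t).symm
    rw [← mul_apply_eq_comp, ← hcomm.eq, mul_apply_eq_comp, hv]
  have hsmall (r : ℝ) (v : V) : ‖X.x₂.lin r v - v‖ ≤ 4 * c * |r| / l₂ * ‖v‖ := by
    have e := K.norm_flow_sub_one_mul_op_le hc X.x₂.lin (half_pos h2).ne' r
    have e2 := ((X.x₂.lin r - 1) * K.op X.x₂.lin (l₂ / 2)).le_opNorm v
    rw [← hP, mul_apply_eq_comp, (hmem v).1 v.2, sub_apply, one_apply_eq_self] at e2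
    refine e2.trans ((mul_le_mul_of_nonneg_right e (norm_nonneg _)).trans (le_of_eq ?_))
    rw [abs_of_pos (half_pos h2), Submodule.coe_norm]
    field_simp
    ring
  set x := X.x₃.lin.restrict V (inv X.comm₂₃)
  set y := X.x₀.lin.restrict V (inv X.comm₂₀)
  set z := X.x₁.lin.restrict V (inv X.comm₂₁)
  have key := h (hE.submodule V) x y z (D / l₂) l₃ l₀ l₁ μ n (by positivity) (fun s t => ?_)
    (fun p r => ?_) (fun p t => ?_) h3 h0 h1 hμ h4 h5 ?_
  · refine ContinuousLinearMap.opNorm_le_bound _ (by positivity) fun v => ?_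
    have hw : K.op X.x₂.lin l₂ v ∈ V := by
      rw [hmem, hP, ← mul_apply_eq_comp, K.op_half_mul_op]
    have hval : (K.op X.x₃.lin l₃ * K.op X.x₂.lin l₂ * (K.op X.x₀.lin l₀ *
        (K.op X.x₁.lin l₁ - K.op X.x₁.lin (2 * l₁)))) v =
        (((K.op x l₃ * K.op y l₀ * (K.op z l₁ - K.op z (2 * l₁))) ⟨_, hw⟩ : V) : E) := by
      have hcom : Commute (K.op X.x₂.lin l₂)
          (K.op X.x₀.lin l₀ * (K.op X.x₁.lin l₁ - K.op X.x₁.lin (2 * l₁))) :=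
        (K.op_lin_commute X.comm₂₀ _ _).mul_right
          ((K.op_lin_commute X.comm₂₁ _ _).sub_right (K.op_lin_commute X.comm₂₁ _ _))
      rw [mul_assoc, hcom.eq]
      simp only [mul_apply_eq_comp, sub_apply, K.coe_op_restrict, Submodule.coe_sub, x, y, z]
    rw [hval, ← Submodule.coe_norm]
    refine (ContinuousLinearMap.le_opNorm _ _).trans ?_
    have hwn : ‖(⟨_, hw⟩ : V)‖ ≤ c * ‖v‖ :=
      (ContinuousLinearMap.le_opNorm _ _).trans
        (mul_le_mul_of_nonneg_right (K.norm_op_le hc _ _) (norm_nonneg _))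
    calc _ ≤ C * q ^ n * (c * ‖v‖) := by gcongr
      _ = _ := by ring
  · refine ContinuousLinearMap.ext fun v => Subtype.ext ?_
    have := congrArg (fun T : E →L[ℝ] E => T v) (ActionFlow.lin_commute (X.comm₁₀ t s)).symm.eq
    exact this
  · refine ContinuousLinearMap.opNorm_le_bound _ (by positivity) fun v => ?_
    have e : (((x p * y r - y r * x p * z (X.b₁ * p * r)) v : V) : E) =
        X.x₀.lin r (X.x₃.lin p (X.x₁.lin (X.b₁ * p * r)
          (X.x₂.lin (X.d * p ^ 2 * r) v - v))) := by
      change X.x₃.lin p (X.x₀.lin r v) -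
        X.x₀.lin r (X.x₃.lin p (X.x₁.lin (X.b₁ * p * r) v)) = _
      simp only [map_sub]
      congr 1
      have := congrArg (fun g => linPart E g v) (X.rel₃₀ p r)
      simpa only [linPart_mul, mul_apply_eq_comp, ActionFlow.lin_apply] using this
    rw [Submodule.coe_norm, e, IsomFlow.norm_map, IsomFlow.norm_map, IsomFlow.norm_map]
    refine (hsmall _ v).trans ?_
    gcongr
    -- The quadratic term is |p| times the commutator time, which is exactly the form of error that
    -- the estimate admits.
    have e3 : |X.d * p ^ 2 * r| = |X.d / X.b₁| * (|p| * |X.b₁ * p * r|) := by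
      rw [← abs_mul, ← abs_mul]
      congr 1
      field_simp [X.b₁_ne]
    rw [e3, hD]
    have : 0 ≤ 4 * c / l₂ * (|X.b₂| * (|p| * |X.b₁ * p * r|)) := by positivity
    calc 4 * c * (|X.d / X.b₁| * (|p| * |X.b₁ * p * r|)) / l₂
        ≤ 4 * c * (|X.d / X.b₁| * (|p| * |X.b₁ * p * r|)) / l₂ +
          4 * c / l₂ * (|X.b₂| * (|p| * |X.b₁ * p * r|)) := by linarith
      _ = _ := by ring
  · refine ContinuousLinearMap.opNorm_le_bound _ (by positivity) fun v => ?_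
    have e : (((x p * z t - z t * x p) v : V) : E) =
        X.x₁.lin t (X.x₃.lin p (X.x₂.lin (X.b₂ * p * t) v - v)) := by
      change X.x₃.lin p (X.x₁.lin t v) - X.x₁.lin t (X.x₃.lin p v) = _
      simp only [map_sub]
      congr 1
      have := congrArg (fun g => linPart E g v) (X.rel₃₁ p t)
      simpa only [linPart_mul, mul_apply_eq_comp, ActionFlow.lin_apply] using this
    rw [Submodule.coe_norm, e, IsomFlow.norm_map, IsomFlow.norm_map]
    refine (hsmall _ v).trans ?_
    gcongr
    rw [abs_mul, abs_mul, hD]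
    have : 0 ≤ 4 * c / l₂ * (|X.d / X.b₁| * (|p| * |t|)) := by positivity
    calc 4 * c * (|X.b₂| * |p| * |t|) / l₂
        ≤ 4 * c * (|X.b₂| * |p| * |t|) / l₂ + 4 * c / l₂ * (|X.d / X.b₁| * (|p| * |t|)) := by
          linarith
      _ = _ := by ring
  · calc D / l₂ * μ * l₁ * √2 ^ n = D * (μ * l₁ * √2 ^ n / l₂) := by ring
      _ ≤ D * 1 := by
        gcongr
        rw [div_le_one h2]
        exact h6
      _ = D := mul_one D

end AveragingKernel

end RootChain

/-! ### The effect of doubling one scale of the averages -/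

section ChainEstimate

open Filter Topology

variable {G : Type*} [Group G] {E : Type u} [NormedAddCommGroup E] [NormedSpace ℝ E]
  [MulAction G E] [IsIsometricSMul G E]

omit [NormedSpace ℝ E] [IsIsometricSMul G E] in
theorem LogGrowth.mono {x : ActionFlow G E} {v : E} {B B' : ℝ} (h : LogGrowth x v B)
    (hB : B ≤ B') : LogGrowth x v B' := fun k l hl s => (h k l hl s).trans (by gcongr)

namespace AveragingKernel

variable {φ : ℝ → ℝ} (K : AveragingKernel φ) {c : ℝ} (hc : KernelBound φ c) [CompleteSpace E]

include K in
theorem tendsto_affAvg (x : ActionFlow G E) (v : E) :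
    Tendsto (fun l => affAvg φ x l v) (𝓝 0) (𝓝 v) := by
  obtain ⟨B, hB0, hB⟩ := x.exists_norm_smul_sub_le v
  have h0 : kavg φ (fun _ : ℝ => v) = v := K.kavg_const v
  have hφ := K.continuous
  have key : Tendsto (fun l => kavg φ fun t => x (l * t) • v) (𝓝 0) (𝓝 (kavg φ fun _ => v)) := by
    refine MeasureTheory.tendsto_integral_filter_of_dominated_convergence
      (fun t => (‖v‖ + B) * ((1 + |t|) ^ 2 * |φ t|)) ?_ ?_ (K.integrable_sq_mul.const_mul _) ?_
    · refine Eventually.of_forall fun l => Continuous.aestronglyMeasurable ?_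
      exact hφ.smul ((x.continuous v).comp (by fun_prop))
    · have h1 : ∀ᶠ l : ℝ in 𝓝 0, |l| ≤ 1 := by
        have : ∀ᶠ l : ℝ in 𝓝 0, |l| < 1 :=
          (continuous_abs.tendsto' (0 : ℝ) 0 abs_zero).eventually_lt_const one_pos
        exact this.mono fun l hl => hl.le
      filter_upwards [h1] with l hl
      refine Eventually.of_forall fun t => ?_
      rw [norm_smul, Real.norm_eq_abs]
      have h2 : ‖x (l * t) • v‖ ≤ ‖v‖ + B * (1 + |l * t|) := by
        have := norm_add_le v (x (l * t) • v - v)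
        rw [add_sub_cancel] at this
        linarith [hB (l * t)]
      have h3 : |l * t| ≤ |t| := by
        rw [abs_mul]
        exact mul_le_of_le_one_left (abs_nonneg t) hl
      have h4 := one_add_abs_le_sq t
      have h5 := one_le_one_add_abs_sq t
      have h6 : ‖x (l * t) • v‖ ≤ (‖v‖ + B) * (1 + |t|) ^ 2 := by
        refine h2.trans ?_
        rw [add_mul]
        exact add_le_add (le_mul_of_one_le_right (norm_nonneg v) h5)
          (mul_le_mul_of_nonneg_left (by linarith) hB0)
      calc |φ t| * ‖x (l * t) • v‖ ≤ |φ t| * ((‖v‖ + B) * (1 + |t|) ^ 2) := by gcongr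
        _ = _ := by ring
    · refine Eventually.of_forall fun t => ?_
      have : Continuous fun l : ℝ => φ t • x (l * t) • v :=
        ((x.continuous v).comp (by fun_prop)).const_smul _
      have h := this.tendsto 0
      rwa [zero_mul, x.map_zero, one_smul] at h
  rwa [h0] at key

theorem affAvg_sub_affAvg_of_commute {x y : ActionFlow G E} (h : ∀ s t, Commute (x s) (y t))
    (l m m' : ℝ) (v : E) :
    affAvg φ y m (affAvg φ x l v) - affAvg φ y m' (affAvg φ x l v) =
      K.op x.lin l (affAvg φ y m v - affAvg φ y m' v) := by
  rw [← K.affAvg_comm x y l m v h, ← K.affAvg_comm x y l m' v h, K.affAvg_sub]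

include K hc

theorem norm_affAvg_sub_le_of_logGrowth {x : ActionFlow G E} {v : E} {B : ℝ}
    (h : LogGrowth x v B) (k : ℕ) {l : ℝ} (hl0 : 0 ≤ l) (hl : l ≤ 2 ^ k) :
    ‖affAvg φ x l v - v‖ ≤ B * (1 + k) * c :=
  K.norm_affAvg_sub_le hc x (h k l (by rwa [abs_of_nonneg hl0]))

theorem norm_affAvg_sub_affAvg_le_of_logGrowth {x : ActionFlow G E} {v : E} {B : ℝ}
    (h : LogGrowth x v B) (k : ℕ) {l m : ℝ} (hl0 : 0 ≤ l) (hl : l ≤ 2 ^ k)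
    (hm0 : 0 ≤ m) (hm : m ≤ 2 ^ k) :
    ‖affAvg φ x l v - affAvg φ x m v‖ ≤ 2 * (B * (1 + k) * c) := by
  rw [← sub_sub_sub_cancel_right _ _ v]
  refine (norm_sub_le _ _).trans ?_
  linarith [K.norm_affAvg_sub_le_of_logGrowth hc h k hl0 hl,
    K.norm_affAvg_sub_le_of_logGrowth hc h k hm0 hm]

theorem norm_affAvg_sub_le_of_lipschitz {x : ActionFlow G E} {v : E} {B : ℝ}
    (hB : 0 ≤ B) (h : ∀ t, ‖x t • v - v‖ ≤ B * |t|) {l : ℝ} (hl0 : 0 ≤ l) :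
    ‖affAvg φ x l v - v‖ ≤ B * l * c := by
  refine K.norm_affAvg_sub_le hc x fun t => (h _).trans ?_
  rw [abs_mul, abs_of_nonneg hl0, mul_assoc]
  gcongr
  linarith

end AveragingKernel

variable {φ : ℝ → ℝ}

/-- The average over `x₁`, then `x₂`, then `x₃`. -/
noncomputable def RootChain.avg (X : RootChain G E) (φ : ℝ → ℝ) (l₃ l₂ l₁ : ℝ) (v : E) : E :=
  affAvg φ X.x₃ l₃ (affAvg φ X.x₂ l₂ (affAvg φ X.x₁ l₁ v))

/-- Bounds for a chain of root subgroups and a vector. -/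
structure ChainEstimate [CompleteSpace E] (K : AveragingKernel φ) (X : RootChain G E) (v : E)
    (B C q : ℝ) : Prop where
  B_nonneg : 0 ≤ B
  C_nonneg : 0 ≤ C
  half_le : 1 / 2 ≤ q
  lt_one : q < 1
  log₂ : LogGrowth X.x₂ v B
  log₁ : LogGrowth X.x₁ v B
  log₀ : LogGrowth X.x₀ v B
  lip₇ : ∀ t, ‖X.x₇ t • v - v‖ ≤ B * |t|
  diff₂ : K.DiffBound X.x₃ X.x₁ X.x₂ C q
  diff₀ : K.DiffBound X.x₁ X.x₇ X.x₀ C q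
  diff₁ : ∀ (n : ℕ) (l₃ l₂ l₁ l₀ μ : ℝ), 0 < l₃ → 0 < l₂ → 0 < l₁ → 0 < l₀ → 0 < μ →
    √2 ^ n * μ ≤ l₃ → √2 ^ n * l₁ ≤ μ * l₀ → μ * l₁ * √2 ^ n ≤ l₂ →
    ‖K.op X.x₃.lin l₃ * K.op X.x₂.lin l₂ * (K.op X.x₀.lin l₀ *
      (K.op X.x₁.lin l₁ - K.op X.x₁.lin (2 * l₁)))‖ ≤ C * q ^ n

namespace ChainEstimate

variable [CompleteSpace E] {K : AveragingKernel φ} {X : RootChain G E} {v : E} {B C q c : ℝ}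
  (h : ChainEstimate K X v B C q) (hc : KernelBound φ c)

theorem sqrt_two_pow_two_mul (m : ℕ) : √2 ^ (2 * m) = (2 : ℝ) ^ m := by
  rw [pow_mul, Real.sq_sqrt (by norm_num)]

include h hc

/-- One halving on the way of the scale of `x₀` from 2^(10m) down to 0. The Heisenberg group of
`x₁`, `x₇`, `x₀` gains q^(2m + j + 1), enough for a bound summable in `j` and still small in `m`;
the logarithmic growth costs only 1 + m. -/
theorem norm_affAvg₀_sub_le (m j : ℕ) {l₁ : ℝ} (hl₁ : 2 ^ (13 * m) ≤ l₁) :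
    ‖affAvg φ X.x₁ l₁ (affAvg φ X.x₀ (2 ^ (10 * m) / 2 ^ j) (affAvg φ X.x₇ (1 / 2 ^ m) v)) -
      affAvg φ X.x₁ l₁ (affAvg φ X.x₀ (2 ^ (10 * m) / 2 ^ (j + 1))
        (affAvg φ X.x₇ (1 / 2 ^ m) v))‖ ≤ C * (24 * B * (1 + m) * c) * q ^ m * q ^ j := by
  have hc0 : 0 < c := zero_lt_one.trans_le hc.one_le
  have hB := h.B_nonneg
  have hC := h.C_nonneg
  have hq : 0 < q := by linarith [h.half_le]
  set l : ℝ := 2 ^ (10 * m) / 2 ^ (j + 1) with hl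
  have hl0 : 0 < l := by positivity
  have hl2 : (2 : ℝ) ^ (10 * m) / 2 ^ j = 2 * l := by rw [hl, pow_succ]; field_simp
  have hl4 : 4 * l ≤ 2 ^ (10 * m + 1) := by
    have h1 : (1 : ℝ) ≤ 2 ^ j := one_le_pow₀ (by norm_num)
    have h2 : 4 * l * 2 ^ j = 2 ^ (10 * m + 1) := by
      rw [hl, pow_succ, pow_succ]; field_simp; ring
    nlinarith
  rw [hl2, norm_sub_rev, K.affAvg_sub, K.affAvg_sub_affAvg_two_mul,
    K.affAvg_sub_affAvg_of_commute fun s t => (X.comm₀₇ t s).symm]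
  set w := affAvg φ X.x₀ (l / 2) v - affAvg φ X.x₀ (4 * l) v with hw
  have hwn : ‖w‖ ≤ 24 * B * (1 + m) * c := by
    refine (K.norm_affAvg_sub_affAvg_le_of_logGrowth hc h.log₀ (10 * m + 1) (by positivity)
      (by linarith) (by positivity) hl4).trans ?_
    push_cast
    have : 0 ≤ B * c := by positivity
    have hm : (0 : ℝ) ≤ m := by positivity
    nlinarith [mul_nonneg this hm]
  have hcomm : Commute (K.op X.x₀.lin l - K.op X.x₀.lin (2 * l)) (K.op X.x₇.lin (1 / 2 ^ m)) :=
    (K.op_lin_commute X.comm₀₇ _ _).sub_left (K.op_lin_commute X.comm₀₇ _ _)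
  rw [← mul_apply_eq_comp, ← mul_apply_eq_comp, ← mul_assoc, mul_assoc, hcomm.eq,
    ← mul_assoc]
  -- With this value of μ the condition on `x₁` reads 2^(13m) ≤ l₁, and that on `x₇` is an equality.
  have hd := h.diff₀ (2 * m + (j + 1)) l₁ (1 / 2 ^ m) l (2 ^ (12 * m) / √2 ^ (j + 1))
    (lt_of_lt_of_le (by positivity) hl₁) (by positivity) hl0 (by positivity) ?_ ?_
  · refine (ContinuousLinearMap.le_opNorm _ _).trans ((mul_le_mul hd hwn (norm_nonneg _)
      (by positivity)).trans ?_)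
    have hqq : q ^ (2 * m + (j + 1)) ≤ q ^ m * q ^ j := by
      rw [← pow_add]
      exact pow_le_pow_of_le_one hq.le h.lt_one.le (by omega)
    calc C * q ^ (2 * m + (j + 1)) * (24 * B * (1 + m) * c)
        = C * (24 * B * (1 + m) * c) * q ^ (2 * m + (j + 1)) := by ring
      _ ≤ C * (24 * B * (1 + m) * c) * (q ^ m * q ^ j) := by gcongr
      _ = _ := by ring
  · rw [pow_add, sqrt_two_pow_two_mul]
    refine le_trans (le_of_eq ?_) hl₁
    field_simp
    rw [← pow_add]
    congr 1
    omega
  · have hs : √2 ^ (j + 1) * √2 ^ (j + 1) = (2 : ℝ) ^ (j + 1) := by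
      rw [← pow_add, ← two_mul, sqrt_two_pow_two_mul]
    rw [pow_add, sqrt_two_pow_two_mul, hl, ← hs]
    refine le_of_eq ?_
    field_simp
    rw [← pow_mul, ← pow_add]
    congr 1
    omega

/-- Averages over `x₁` at large scales hardly change under a preliminary average over `x₀`. -/
theorem norm_affAvg₁_sub_le (m : ℕ) {l₁ : ℝ} (hl₁ : 2 ^ (13 * m) ≤ l₁) :
    ‖affAvg φ X.x₁ l₁ (affAvg φ X.x₀ (2 ^ (10 * m)) (affAvg φ X.x₇ (1 / 2 ^ m) v)) -
      affAvg φ X.x₁ l₁ v‖ ≤ (24 * B * C * c / (1 - q) + B * c ^ 2) * (1 + m) * q ^ m := by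
  have hc0 : 0 < c := zero_lt_one.trans_le hc.one_le
  have hB := h.B_nonneg
  have hC := h.C_nonneg
  have hq : 0 < q := by linarith [h.half_le]
  have hq1 : 0 < 1 - q := by linarith [h.lt_one]
  set u := affAvg φ X.x₇ (1 / 2 ^ m) v with hu
  have hun : ‖u - v‖ ≤ B * (1 / 2 ^ m) * c :=
    K.norm_affAvg_sub_le_of_lipschitz hc hB h.lip₇ (by positivity)
  set f : ℕ → E := fun j => affAvg φ X.x₁ l₁ (affAvg φ X.x₀ (2 ^ (10 * m) / 2 ^ j) u) with hf
  -- At scale 0 the average over `x₀` is the identity. The average over `x₇` that remains then moves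
  -- `v` by O(2^(-m)), at most O(q^m) as q ≥ 1/2.
  have hlim : Tendsto f atTop (𝓝 (affAvg φ X.x₁ l₁ u)) := by
    have h1 : Tendsto (fun j : ℕ => (2 : ℝ) ^ (10 * m) / 2 ^ j) atTop (𝓝 0) := by
      have := (tendsto_pow_atTop_nhds_zero_of_lt_one (r := (1 / 2 : ℝ)) (by norm_num)
        (by norm_num)).const_mul ((2 : ℝ) ^ (10 * m))
      simpa [div_eq_mul_inv] using this
    have h2 := (K.tendsto_affAvg X.x₀ u).comp h1
    rw [tendsto_iff_norm_sub_tendsto_zero] at h2 ⊢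
    refine squeeze_zero (fun _ => norm_nonneg _)
      (fun j => K.norm_affAvg_sub_affAvg_le hc X.x₁ l₁ _ _) ?_
    simpa using h2.const_mul c
  have h1 := dist_le_of_le_geometric_of_tendsto₀ q (C * (24 * B * (1 + m) * c) * q ^ m) h.lt_one
    (fun j => by rw [dist_eq_norm]; exact h.norm_affAvg₀_sub_le hc m j hl₁) hlim
  rw [dist_eq_norm] at h1
  have h2 : f 0 = affAvg φ X.x₁ l₁ (affAvg φ X.x₀ (2 ^ (10 * m)) u) := by simp [hf]
  rw [h2] at h1
  have h3 := K.norm_affAvg_sub_affAvg_le hc X.x₁ l₁ u v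
  have h4 : (1 / 2 : ℝ) ^ m ≤ q ^ m := by
    have := h.half_le
    gcongr
  rw [one_div_pow] at h4
  have h5 : c * ‖u - v‖ ≤ B * c ^ 2 * (1 + m) * q ^ m := by
    calc c * ‖u - v‖ ≤ c * (B * (1 / 2 ^ m) * c) := by gcongr
      _ ≤ c * (B * q ^ m * c) := by gcongr
      _ = B * c ^ 2 * 1 * q ^ m := by ring
      _ ≤ B * c ^ 2 * (1 + m) * q ^ m := by
        gcongr
        have : (0 : ℝ) ≤ m := by positivity
        linarith
  rw [← sub_add_sub_cancel _ (affAvg φ X.x₁ l₁ u)]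
  refine (norm_add_le _ _).trans ((add_le_add h1 (h3.trans h5)).trans (le_of_eq ?_))
  field_simp

omit h [CompleteSpace E] in
include K in
theorem norm_avg_sub_avg_le {l₃ l₂ l₁ : ℝ} (w w' : E) :
    ‖X.avg φ l₃ l₂ l₁ w - X.avg φ l₃ l₂ l₁ w'‖ ≤
      c ^ 2 * ‖affAvg φ X.x₁ l₁ w - affAvg φ X.x₁ l₁ w'‖ := by
  have hc0 : 0 < c := zero_lt_one.trans_le hc.one_le
  refine (K.norm_affAvg_sub_affAvg_le hc _ _ _ _).trans ?_
  rw [pow_two, mul_assoc]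
  gcongr
  exact K.norm_affAvg_sub_affAvg_le hc _ _ _ _

omit hc in
theorem norm_avg_affAvg_sub_le (n : ℕ) {l₃ l₂ l₁ l₀ μ : ℝ} (h3 : 0 < l₃) (h2 : 0 < l₂)
    (h1 : 0 < l₁) (h0 : 0 < l₀) (hμ : 0 < μ) (h4 : √2 ^ n * μ ≤ l₃) (h5 : √2 ^ n * l₁ ≤ μ * l₀)
    (h6 : μ * l₁ * √2 ^ n ≤ l₂) (u : E) :
    ‖X.avg φ l₃ l₂ l₁ (affAvg φ X.x₀ l₀ u) - X.avg φ l₃ l₂ (2 * l₁) (affAvg φ X.x₀ l₀ u)‖ ≤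
      C * q ^ n * ‖affAvg φ X.x₁ (l₁ / 2) u - affAvg φ X.x₁ (4 * l₁) u‖ := by
  rw [RootChain.avg, RootChain.avg, K.affAvg_sub, K.affAvg_sub,
    K.affAvg_sub_affAvg_of_commute fun s t => (X.comm₁₀ t s).symm,
    K.affAvg_sub_affAvg_two_mul]
  refine le_trans (le_of_eq ?_) ((ContinuousLinearMap.le_opNorm _ _).trans
    (mul_le_mul_of_nonneg_right (h.diff₁ n l₃ l₂ l₁ l₀ μ h3 h2 h1 h0 hμ h4 h5 h6) (norm_nonneg _)))
  rfl

/-- Doubling the scale of the average over `x₁`. -/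
theorem norm_avg_sub_avg_two_mul₁_le {m k₃ k₂ k₁ : ℕ} (h3 : 13 * m ≤ k₃) (h2 : 27 * m ≤ k₂)
    (h1 : 13 * m ≤ k₁) (h1' : k₁ < 17 * m) :
    ‖X.avg φ (2 ^ k₃) (2 ^ k₂) (2 ^ k₁) v - X.avg φ (2 ^ k₃) (2 ^ k₂) (2 ^ (k₁ + 1)) v‖ ≤
      (2 * c ^ 2 * (24 * B * C * c / (1 - q) + B * c ^ 2) + C * (2 * B * c ^ 2 + 38 * B * c)) *
        (1 + m) * q ^ m := by
  have hc0 : 0 < c := zero_lt_one.trans_le hc.one_le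
  have hB := h.B_nonneg
  have hC := h.C_nonneg
  have hq : 0 < q := by linarith [h.half_le]
  have hm : (0 : ℝ) ≤ m := by positivity
  have two_pow_le {a b : ℕ} (hab : a ≤ b) : (2 : ℝ) ^ a ≤ 2 ^ b :=
    pow_le_pow_right₀ (by norm_num) hab
  set u := affAvg φ X.x₇ (1 / 2 ^ m) v with hu
  -- Replacing `v` by `w` changes both averages little, and for `w` the average over `x₀` required
  -- by `diff₁` is present.
  set w := affAvg φ X.x₀ (2 ^ (10 * m)) u with hw
  set T := 24 * B * C * c / (1 - q) + B * c ^ 2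
  have hun : ‖u - v‖ ≤ B * (1 / 2 ^ m) * c :=
    K.norm_affAvg_sub_le_of_lipschitz hc hB h.lip₇ (by positivity)
  have hun' : ‖u - v‖ ≤ B * c := by
    refine hun.trans ?_
    have : (1 : ℝ) / 2 ^ m ≤ 1 := by
      rw [div_le_one (by positivity)]
      exact one_le_pow₀ (by norm_num)
    calc B * (1 / 2 ^ m) * c ≤ B * 1 * c := by gcongr
      _ = _ := by ring
  have e1 := (norm_avg_sub_avg_le (K := K) (X := X) hc (l₃ := 2 ^ k₃) (l₂ := 2 ^ k₂) w v).trans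
    (mul_le_mul_of_nonneg_left (h.norm_affAvg₁_sub_le hc m (two_pow_le h1)) (by positivity))
  have e2 := (norm_avg_sub_avg_le (K := K) (X := X) hc (l₃ := 2 ^ k₃) (l₂ := 2 ^ k₂) w v).trans
    (mul_le_mul_of_nonneg_left (h.norm_affAvg₁_sub_le hc m
      (two_pow_le (h1.trans (Nat.le_succ k₁)))) (by positivity))
  -- In exponents of 2 the conditions are 9m ≤ k₃, m + k₁ ≤ 18m and 9m + k₁ ≤ k₂; the last two are
  -- where k₁ < 17m and 27m ≤ k₂ enter.
  have e3 := h.norm_avg_affAvg_sub_le (2 * m) (l₃ := 2 ^ k₃) (l₂ := 2 ^ k₂) (l₁ := 2 ^ k₁)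
    (l₀ := 2 ^ (10 * m)) (μ := 2 ^ (8 * m)) (by positivity) (by positivity) (by positivity)
    (by positivity) (by positivity)
    (by rw [sqrt_two_pow_two_mul, ← pow_add]; exact two_pow_le (by omega))
    (by rw [sqrt_two_pow_two_mul, ← pow_add, ← pow_add]; exact two_pow_le (by omega))
    (by rw [sqrt_two_pow_two_mul, ← pow_add, ← pow_add]; exact two_pow_le (by omega)) u
  rw [← pow_succ'] at e3
  have e4 : ‖affAvg φ X.x₁ (2 ^ k₁ / 2) u - affAvg φ X.x₁ (4 * 2 ^ k₁) u‖ ≤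
      (2 * B * c ^ 2 + 38 * B * c) * (1 + m) := by
    have hk : (4 : ℝ) * 2 ^ k₁ ≤ 2 ^ (17 * m + 1) := by
      have : (4 : ℝ) * 2 ^ k₁ = 2 ^ (k₁ + 2) := by rw [pow_add]; ring
      rw [this]
      exact two_pow_le (by omega)
    have hk0 : (0 : ℝ) < 2 ^ k₁ := by positivity
    have f1 := K.norm_affAvg_sub_affAvg_le hc X.x₁ (2 ^ k₁ / 2) u v
    have f2 := K.norm_affAvg_sub_affAvg_le hc X.x₁ (4 * 2 ^ k₁) u v
    have f3 := K.norm_affAvg_sub_affAvg_le_of_logGrowth hc h.log₁ (17 * m + 1)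
      (l := 2 ^ k₁ / 2) (m := 4 * 2 ^ k₁) (by positivity) (by linarith) (by positivity) hk
    have f4 : c * ‖u - v‖ ≤ B * c ^ 2 := by
      calc c * ‖u - v‖ ≤ c * (B * c) := by gcongr
        _ = _ := by ring
    have f5 : affAvg φ X.x₁ (2 ^ k₁ / 2) u - affAvg φ X.x₁ (4 * 2 ^ k₁) u =
        (affAvg φ X.x₁ (2 ^ k₁ / 2) u - affAvg φ X.x₁ (2 ^ k₁ / 2) v) +
        (affAvg φ X.x₁ (2 ^ k₁ / 2) v - affAvg φ X.x₁ (4 * 2 ^ k₁) v) -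
        (affAvg φ X.x₁ (4 * 2 ^ k₁) u - affAvg φ X.x₁ (4 * 2 ^ k₁) v) := by abel
    rw [f5]
    refine (norm_sub_le _ _).trans ((add_le_add (norm_add_le _ _) le_rfl).trans ?_)
    push_cast at f3
    have f6 : 0 ≤ B * c := by positivity
    have f7 : 0 ≤ B * c ^ 2 := by positivity
    nlinarith [mul_nonneg f6 hm, mul_nonneg f7 hm]
  have e5 : C * q ^ (2 * m) * ‖affAvg φ X.x₁ (2 ^ k₁ / 2) u - affAvg φ X.x₁ (4 * 2 ^ k₁) u‖ ≤
      C * (2 * B * c ^ 2 + 38 * B * c) * (1 + m) * q ^ m := by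
    have : q ^ (2 * m) ≤ q ^ m := pow_le_pow_of_le_one hq.le h.lt_one.le (by omega)
    calc _ ≤ C * q ^ m * ((2 * B * c ^ 2 + 38 * B * c) * (1 + m)) := by gcongr
      _ = _ := by ring
  have e6 : X.avg φ (2 ^ k₃) (2 ^ k₂) (2 ^ k₁) v - X.avg φ (2 ^ k₃) (2 ^ k₂) (2 ^ (k₁ + 1)) v =
      (X.avg φ (2 ^ k₃) (2 ^ k₂) (2 ^ k₁) w - X.avg φ (2 ^ k₃) (2 ^ k₂) (2 ^ (k₁ + 1)) w) -
      (X.avg φ (2 ^ k₃) (2 ^ k₂) (2 ^ k₁) w - X.avg φ (2 ^ k₃) (2 ^ k₂) (2 ^ k₁) v) +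
      (X.avg φ (2 ^ k₃) (2 ^ k₂) (2 ^ (k₁ + 1)) w -
        X.avg φ (2 ^ k₃) (2 ^ k₂) (2 ^ (k₁ + 1)) v) := by abel
  rw [e6]
  refine (norm_add_le _ _).trans ((add_le_add (norm_sub_le _ _) le_rfl).trans ?_)
  have e7 := e3.trans e5
  calc _ ≤ C * (2 * B * c ^ 2 + 38 * B * c) * (1 + m) * q ^ m + c ^ 2 * (T * (1 + m) * q ^ m) +
        c ^ 2 * (T * (1 + m) * q ^ m) := add_le_add (add_le_add e7 e1) e2
    _ = _ := by ring

/-- Doubling the scale of the average over `x₂`. -/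
theorem norm_avg_sub_avg_two_mul₂_le {m k₃ k₂ k₁ : ℕ} (hm : 26 ≤ m) (h3 : 13 * m ≤ k₃)
    (h1 : 17 * m ≤ k₁) (h2 : k₂ < 27 * m + 27) :
    ‖X.avg φ (2 ^ k₃) (2 ^ k₂) (2 ^ k₁) v - X.avg φ (2 ^ k₃) (2 ^ (k₂ + 1)) (2 ^ k₁) v‖ ≤
      C * (58 * B * c) * (1 + m) * q ^ m := by
  have hc0 : 0 < c := zero_lt_one.trans_le hc.one_le
  have hB := h.B_nonneg
  have hC := h.C_nonneg
  have hq : 0 < q := by linarith [h.half_le]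
  have hm0 : (0 : ℝ) ≤ m := by positivity
  have two_pow_le {a b : ℕ} (hab : a ≤ b) : (2 : ℝ) ^ a ≤ 2 ^ b :=
    pow_le_pow_right₀ (by norm_num) hab
  -- In exponents of 2: 13m ≤ k₃ and m + k₂ ≤ 12m + k₁. As k₂ may reach 27m + 26, the latter needs
  -- k₁ ≥ 17m together with m ≥ 26.
  have hd := h.diff₂ (2 * m) (2 ^ k₃) (2 ^ k₁) (2 ^ k₂) (2 ^ (12 * m)) (by positivity)
    (by positivity) (by positivity) (by positivity)
    (by rw [sqrt_two_pow_two_mul, ← pow_add]; exact two_pow_le (by omega))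
    (by rw [sqrt_two_pow_two_mul, ← pow_add, ← pow_add]; exact two_pow_le (by omega))
  rw [RootChain.avg, RootChain.avg, K.affAvg_sub, pow_succ', K.affAvg_sub_affAvg_two_mul,
    K.affAvg_sub_affAvg_of_commute fun s t => (X.comm₂₁ t s).symm]
  have hcomm : Commute (K.op X.x₂.lin (2 ^ k₂) - K.op X.x₂.lin (2 * 2 ^ k₂))
      (K.op X.x₁.lin (2 ^ k₁)) :=
    (K.op_lin_commute X.comm₂₁ _ _).sub_left (K.op_lin_commute X.comm₂₁ _ _)
  rw [← mul_apply_eq_comp, ← mul_apply_eq_comp, ← mul_assoc, mul_assoc, hcomm.eq, ← mul_assoc]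
  have hk : (4 : ℝ) * 2 ^ k₂ ≤ 2 ^ (27 * m + 28) := by
    have : (4 : ℝ) * 2 ^ k₂ = 2 ^ (k₂ + 2) := by rw [pow_add]; ring
    rw [this]
    exact two_pow_le (by omega)
  have hk0 : (0 : ℝ) < 2 ^ k₂ := by positivity
  have f3 : ‖affAvg φ X.x₂ (2 ^ k₂ / 2) v - affAvg φ X.x₂ (4 * 2 ^ k₂) v‖ ≤
      58 * B * c * (1 + m) := by
    refine (K.norm_affAvg_sub_affAvg_le_of_logGrowth hc h.log₂ (27 * m + 28)
      (by positivity) (by linarith) (by positivity) hk).trans ?_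
    push_cast
    have f6 : 0 ≤ B * c := by positivity
    nlinarith [mul_nonneg f6 hm0]
  have hqq : q ^ (2 * m) ≤ q ^ m := pow_le_pow_of_le_one hq.le h.lt_one.le (by omega)
  refine (ContinuousLinearMap.le_opNorm _ _).trans ((mul_le_mul hd f3 (norm_nonneg _)
    (by positivity)).trans ?_)
  calc _ ≤ C * q ^ m * (58 * B * c * (1 + m)) := by gcongr
    _ = _ := by ring

end ChainEstimate

end ChainEstimate

/-! ### Convergence of the averages and the fixed point -/

section FixedPoint

open Filter Topology

variable {G : Type*} [Group G] {E : Type u} [NormedAddCommGroup E] [NormedSpace ℝ E]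
  [MulAction G E] [IsIsometricSMul G E]

namespace AveragingKernel

variable {φ : ℝ → ℝ} (K : AveragingKernel φ) {c : ℝ} (hc : KernelBound φ c) [CompleteSpace E]

include K hc

omit [CompleteSpace E] in
theorem lipschitzWith_affAvg (x : ActionFlow G E) (l : ℝ) :
    LipschitzWith c.toNNReal (affAvg φ x l : E → E) :=
  LipschitzWith.of_dist_le_mul fun v w => by
    rw [dist_eq_norm, dist_eq_norm, Real.coe_toNNReal c (zero_le_one.trans hc.one_le)]
    exact K.norm_affAvg_sub_affAvg_le hc x l v w

/-- Averages over flows that nearly commute at `w` nearly commute. -/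
theorem norm_affAvg_affAvg_sub_affAvg_affAvg_le {x y : ActionFlow G E} {l m D : ℝ} {w : E}
    (h : ∀ s t, ‖x (l * s) • y (m * t) • w - y (m * t) • x (l * s) • w‖ ≤ D * (|s| * |t|)) :
    ‖affAvg φ x l (affAvg φ y m w) - affAvg φ y m (affAvg φ x l w)‖ ≤ D * c ^ 2 := by
  have hc0 : 0 < c := zero_lt_one.trans_le hc.one_le
  have hD : 0 ≤ D := by simpa using (norm_nonneg _).trans (h 1 1)
  have abs_le_sq (t : ℝ) : |t| ≤ (1 + |t|) ^ 2 := by nlinarith [abs_nonneg t]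
  rw [K.affAvg_affAvg_eq, K.affAvg_affAvg_eq']
  obtain ⟨A₁, -, hA₁⟩ := x.exists_quadGrowth l (affAvg φ y m w)
  obtain ⟨A₂, hA₂0, hA₂⟩ := x.exists_quadGrowth l w
  have e1 : (fun s => kavg φ fun t => x (l * s) • y (m * t) • w) =
      fun s => x (l * s) • affAvg φ y m w := by
    funext s
    obtain ⟨A, -, hA⟩ := y.exists_quadGrowth m w
    rw [affAvg, K.smul_kavg _ hA]
  have g1 : QuadGrowth (fun s => kavg φ fun t => x (l * s) • y (m * t) • w) A₁ := by
    rw [e1]; exact hA₁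
  have g2 : QuadGrowth (fun s => kavg φ fun t => y (m * t) • x (l * s) • w)
      (c * A₂ + ‖affAvg φ y m (0 : E)‖) := by
    refine ⟨(K.lipschitzWith_affAvg hc y m).continuous.comp hA₂.continuous, fun s => ?_⟩
    have h1 := K.norm_affAvg_sub_affAvg_le hc y m (x (l * s) • w) 0
    have h2 := norm_sub_norm_le (affAvg φ y m (x (l * s) • w)) (affAvg φ y m 0)
    rw [sub_zero] at h1
    have h3 := mul_le_mul_of_nonneg_left (hA₂.norm_le s) hc0.le
    have h4 := le_mul_of_one_le_right (norm_nonneg (affAvg φ y m (0 : E)))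
      (one_le_one_add_abs_sq s)
    change ‖affAvg φ y m (x (l * s) • w)‖ ≤ _
    nlinarith
  rw [← K.kavg_sub g1 g2]
  refine (K.norm_kavg_le hc (B := D * c) fun s => ?_).trans (le_of_eq (by ring))
  obtain ⟨A₃, -, hA₃⟩ := y.exists_quadGrowth m w
  obtain ⟨A₄, -, hA₄⟩ := y.exists_quadGrowth m (x (l * s) • w)
  have g3 : QuadGrowth (fun t => x (l * s) • y (m * t) • w) (A₃ + ‖x (l * s) • (0 : E)‖) := by
    refine ⟨(isometry_smul E (x (l * s))).continuous.comp hA₃.continuous, fun t => ?_⟩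
    have h1 := norm_sub_norm_le (x (l * s) • y (m * t) • w) (x (l * s) • (0 : E))
    rw [norm_smul_sub_smul, sub_zero] at h1
    have h3 := hA₃.norm_le t
    have h4 := le_mul_of_one_le_right (norm_nonneg (x (l * s) • (0 : E)))
      (one_le_one_add_abs_sq t)
    nlinarith
  rw [← K.kavg_sub g3 hA₄]
  refine (K.norm_kavg_le hc (B := D * |s|) fun t => (h s t).trans ?_).trans ?_
  · rw [← mul_assoc]
    have := abs_le_sq t
    gcongr
  · rw [mul_right_comm]
    have := abs_le_sq s
    gcongr

end AveragingKernel

variable {φ : ℝ → ℝ} [CompleteSpace E] {K : AveragingKernel φ} {X Y : RootChain G E} {v : E}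
  {B C q c : ℝ}

namespace ChainEstimate

variable (h : ChainEstimate K X v B C q) (hc : KernelBound φ c)

include h hc

theorem norm_smul₂_affAvg_sub_le (k : ℕ) (r : ℝ) :
    ‖X.x₂ r • affAvg φ X.x₂ (2 ^ k) v - affAvg φ X.x₂ (2 ^ k) v‖ ≤
      B * (1 + k) * c / 2 ^ k * |r| :=
  K.norm_smul_affAvg_sub_le hc X.x₂ (by positivity)
    (h.log₂ k (2 ^ k) (by rw [abs_of_pos (by positivity)])) r

/-- Reversing the order of the averages. -/
theorem norm_avg_sub_reverse_le {m k₃ k₂ k₁ : ℕ} (hk : k₁ + k₃ + m ≤ k₂ + 13)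
    (hk₂ : k₂ ≤ 27 * m + 27) :
    ‖X.avg φ (2 ^ k₃) (2 ^ k₂) (2 ^ k₁) v -
      affAvg φ X.x₁ (2 ^ k₁) (affAvg φ X.x₂ (2 ^ k₂) (affAvg φ X.x₃ (2 ^ k₃) v))‖ ≤
      2 ^ 13 * (28 * B * c ^ 3 * |X.b₂|) * (1 + m) * q ^ m := by
  have hc0 : 0 < c := zero_lt_one.trans_le hc.one_le
  have hB := h.B_nonneg
  rw [RootChain.avg, K.affAvg_comm X.x₂ X.x₁ _ _ v X.comm₂₁,
    K.affAvg_comm X.x₂ X.x₃ _ _ v X.comm₂₃]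
  set w := affAvg φ X.x₂ (2 ^ k₂) v with hw
  set D := B * (1 + k₂) * c / 2 ^ k₂ * (|X.b₂| * (2 ^ k₃ * 2 ^ k₁))
  -- The commutator of `x₃` and `x₁` lies in `x₂` and barely moves `w`, an average over `x₂`: the
  -- error is of order k₂ 2^(k₁ + k₃ - k₂).
  have hsw : ‖affAvg φ X.x₃ (2 ^ k₃) (affAvg φ X.x₁ (2 ^ k₁) w) -
      affAvg φ X.x₁ (2 ^ k₁) (affAvg φ X.x₃ (2 ^ k₃) w)‖ ≤ D * c ^ 2 := by
    refine K.norm_affAvg_affAvg_sub_affAvg_affAvg_le hc fun s t => ?_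
    rw [← mul_smul, X.rel₃₁, mul_smul, mul_smul, norm_smul_sub_smul, norm_smul_sub_smul]
    refine (h.norm_smul₂_affAvg_sub_le hc k₂ _).trans (le_of_eq ?_)
    rw [abs_mul, abs_mul, abs_mul, abs_mul, abs_of_pos (by positivity : (0 : ℝ) < 2 ^ k₃),
      abs_of_pos (by positivity : (0 : ℝ) < 2 ^ k₁)]
    ring
  refine hsw.trans ?_
  have h1 : (2 : ℝ) ^ k₃ * 2 ^ k₁ / 2 ^ k₂ ≤ 2 ^ 13 * (1 / 2) ^ m := by
    rw [div_le_iff₀ (by positivity), one_div_pow, mul_one_div, div_mul_eq_mul_div,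
      le_div_iff₀ (by positivity), ← pow_add, ← pow_add, ← pow_add]
    exact pow_le_pow_right₀ (by norm_num) (by omega)
  have h2 : (1 / 2 : ℝ) ^ m ≤ q ^ m := by
    have := h.half_le
    gcongr
  have h3 : (1 + k₂ : ℝ) ≤ 28 * (1 + m) := by
    have : (k₂ : ℝ) ≤ 27 * m + 27 := by exact_mod_cast hk₂
    have : (0 : ℝ) ≤ m := by positivity
    linarith
  calc D * c ^ 2 = B * c ^ 3 * |X.b₂| * (1 + k₂) * (2 ^ k₃ * 2 ^ k₁ / 2 ^ k₂) := by
        simp only [D]; field_simp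
    _ ≤ B * c ^ 3 * |X.b₂| * (28 * (1 + m)) * (2 ^ 13 * q ^ m) := by
        gcongr
        exact h1.trans (by gcongr)
    _ = _ := by ring

theorem norm_smul_avg_sub_le (k₃ k₂ k₁ : ℕ) (r : ℝ) :
    ‖X.x₂ r • X.avg φ (2 ^ k₃) (2 ^ k₂) (2 ^ k₁) v - X.avg φ (2 ^ k₃) (2 ^ k₂) (2 ^ k₁) v‖ ≤
      B * c ^ 3 * |r| * ((1 + k₂) / 2 ^ k₂) := by
  have hc0 : 0 < c := zero_lt_one.trans_le hc.one_le
  rw [RootChain.avg, K.affAvg_comm X.x₂ X.x₁ _ _ v X.comm₂₁,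
    K.smul_affAvg _ _ _ _ (X.comm₂₃ r), K.smul_affAvg _ _ _ _ (X.comm₂₁ r)]
  refine (K.norm_affAvg_sub_affAvg_le hc _ _ _ _).trans ?_
  refine (mul_le_mul_of_nonneg_left ((K.norm_affAvg_sub_affAvg_le hc _ _ _ _).trans
    (mul_le_mul_of_nonneg_left (h.norm_smul₂_affAvg_sub_le hc k₂ r) hc0.le)) hc0.le).trans
    (le_of_eq ?_)
  field_simp

end ChainEstimate

omit [NormedSpace ℝ E] [CompleteSpace E] in
theorem norm_sub_le_of_forall_succ {f : ℕ → E} {a b n : ℕ} {D : ℝ} (hab : a ≤ b)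
    (hn : b ≤ a + n) (hD : 0 ≤ D) (h : ∀ k, a ≤ k → k < b → ‖f k - f (k + 1)‖ ≤ D) :
    ‖f a - f b‖ ≤ n * D := by
  have := dist_le_Ico_sum_of_dist_le (f := f) (d := fun _ => D) hab
    fun {k} h1 h2 => by rw [dist_eq_norm]; exact h k h1 h2
  rw [Finset.sum_const, Nat.card_Ico, nsmul_eq_mul, dist_eq_norm] at this
  refine this.trans (mul_le_mul_of_nonneg_right ?_ hD)
  exact_mod_cast (by omega : b - a ≤ n)

/-- Two chains of root subgroups, symmetric about their common second root, whose averages of `v`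
at suitable scales form a Cauchy sequence. -/
theorem ChainEstimate.cauchySeq_avg {B' C' q' : ℝ} (h : ChainEstimate K X v B C q)
    (h' : ChainEstimate K Y v B' C' q') (hc : KernelBound φ c) (e₁ : Y.x₁ = X.x₃)
    (e₂ : Y.x₂ = X.x₂) (e₃ : Y.x₃ = X.x₁) :
    CauchySeq fun n => X.avg φ (2 ^ (13 * (n + 26))) (2 ^ (27 * (n + 26))) (2 ^ (13 * (n + 26))) v := by
  have hc0 : 0 < c := zero_lt_one.trans_le hc.one_le
  obtain ⟨A, hA0, Q, hQ0, hQ1, hM1, hM2, hM1', hM3⟩ : ∃ A : ℝ, 0 ≤ A ∧ ∃ Q : ℝ, 0 < Q ∧ Q < 1 ∧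
      (∀ m k₃ k₂ k₁ : ℕ, 13 * m ≤ k₃ → 27 * m ≤ k₂ → 13 * m ≤ k₁ → k₁ < 17 * m →
        ‖X.avg φ (2 ^ k₃) (2 ^ k₂) (2 ^ k₁) v - X.avg φ (2 ^ k₃) (2 ^ k₂) (2 ^ (k₁ + 1)) v‖ ≤
          A * (1 + m) * Q ^ m) ∧
      (∀ m k₃ k₂ k₁ : ℕ, 26 ≤ m → 13 * m ≤ k₃ → 17 * m ≤ k₁ → k₂ < 27 * m + 27 →
        ‖X.avg φ (2 ^ k₃) (2 ^ k₂) (2 ^ k₁) v - X.avg φ (2 ^ k₃) (2 ^ (k₂ + 1)) (2 ^ k₁) v‖ ≤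
          A * (1 + m) * Q ^ m) ∧
      (∀ m k₃ k₂ k₁ : ℕ, 13 * m ≤ k₃ → 27 * m ≤ k₂ → 13 * m ≤ k₁ → k₁ < 17 * m →
        ‖Y.avg φ (2 ^ k₃) (2 ^ k₂) (2 ^ k₁) v - Y.avg φ (2 ^ k₃) (2 ^ k₂) (2 ^ (k₁ + 1)) v‖ ≤
          A * (1 + m) * Q ^ m) ∧
      (∀ m k₃ k₂ k₁ : ℕ, k₁ + k₃ + m ≤ k₂ + 13 → k₂ ≤ 27 * m + 27 →
        ‖X.avg φ (2 ^ k₃) (2 ^ k₂) (2 ^ k₁) v - Y.avg φ (2 ^ k₁) (2 ^ k₂) (2 ^ k₃) v‖ ≤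
          A * (1 + m) * Q ^ m) := by
    obtain ⟨A₁, hA₁⟩ : ∃ A₁, A₁ = 2 * c ^ 2 * (24 * B * C * c / (1 - q) + B * c ^ 2) +
      C * (2 * B * c ^ 2 + 38 * B * c) := ⟨_, rfl⟩
    obtain ⟨A₂, hA₂⟩ : ∃ A₂, A₂ = C * (58 * B * c) := ⟨_, rfl⟩
    obtain ⟨A₃, hA₃⟩ : ∃ A₃, A₃ = 2 * c ^ 2 * (24 * B' * C' * c / (1 - q') + B' * c ^ 2) +
      C' * (2 * B' * c ^ 2 + 38 * B' * c) := ⟨_, rfl⟩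
    obtain ⟨A₄, hA₄⟩ : ∃ A₄, A₄ = 2 ^ 13 * (28 * B * c ^ 3 * |X.b₂|) := ⟨_, rfl⟩
    have hq0 : 0 < q := by linarith [h.half_le]
    have hq'0 : 0 < q' := by linarith [h'.half_le]
    set A := max 0 (max (max A₁ A₂) (max A₃ A₄))
    have hA : 0 ≤ A := le_max_left _ _
    have i1 : A₁ ≤ A := ((le_max_left _ _).trans (le_max_left _ _)).trans (le_max_right _ _)
    have i2 : A₂ ≤ A := ((le_max_right _ _).trans (le_max_left _ _)).trans (le_max_right _ _)
    have i3 : A₃ ≤ A := ((le_max_left _ _).trans (le_max_right _ _)).trans (le_max_right _ _)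
    have i4 : A₄ ≤ A := ((le_max_right _ _).trans (le_max_right _ _)).trans (le_max_right _ _)
    have j1 : q ≤ max q q' := le_max_left _ _
    have j2 : q' ≤ max q q' := le_max_right _ _
    refine ⟨A, hA, max q q', by positivity, max_lt h.lt_one h'.lt_one,
      fun m k₃ k₂ k₁ t3 t2 t1 t0 => (h.norm_avg_sub_avg_two_mul₁_le hc t3 t2 t1 t0).trans ?_,
      fun m k₃ k₂ k₁ t3 t2 t1 t0 => (h.norm_avg_sub_avg_two_mul₂_le hc t3 t2 t1 t0).trans ?_,
      fun m k₃ k₂ k₁ t3 t2 t1 t0 => (h'.norm_avg_sub_avg_two_mul₁_le hc t3 t2 t1 t0).trans ?_,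
      fun m k₃ k₂ k₁ t1 t2 => ?_⟩
    · rw [← hA₁]; gcongr
    · rw [← hA₂]; gcongr
    · rw [← hA₃]; gcongr
    · refine le_trans (le_of_eq ?_) ((h.norm_avg_sub_reverse_le hc t1 t2).trans ?_)
      · rw [RootChain.avg, RootChain.avg, e₁, e₂, e₃]
      · rw [← hA₄]; gcongr
  have hstep (m : ℕ) (hm : 26 ≤ m) :
      ‖X.avg φ (2 ^ (13 * m)) (2 ^ (27 * m)) (2 ^ (13 * m)) v -
        X.avg φ (2 ^ (13 * (m + 1))) (2 ^ (27 * (m + 1))) (2 ^ (13 * (m + 1))) v‖ ≤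
        42 * A * ((1 + m) ^ 2 * Q ^ m) := by
    set D := A * (1 + m) * Q ^ m with hD
    have hD0 : 0 ≤ D := by positivity
    -- The path, in exponents of l₃, l₂, l₁: from (13m, 27m, 13m) raise l₁ to 17m, which is needed
    -- for raising l₂ to 27(m + 1); lower l₁ to 13(m + 1); reverse the order, which turns l₃ into
    -- the innermost scale of `Y`; raise it to 13(m + 1); reverse again.
    have s1 := norm_sub_le_of_forall_succ (n := 4 * m)
      (f := fun k => X.avg φ (2 ^ (13 * m)) (2 ^ (27 * m)) (2 ^ k) v)
      (a := 13 * m) (b := 17 * m) (by omega) (by omega) hD0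
      fun k k1 k2 => hM1 m _ _ k le_rfl le_rfl k1 k2
    have s2 := norm_sub_le_of_forall_succ (n := 27)
      (f := fun k => X.avg φ (2 ^ (13 * m)) (2 ^ k) (2 ^ (17 * m)) v)
      (a := 27 * m) (b := 27 * (m + 1)) (by omega) (by omega) hD0
      fun k k1 k2 => hM2 m _ k _ hm le_rfl le_rfl (by omega)
    have s3 := norm_sub_le_of_forall_succ (n := 4 * m)
      (f := fun k => X.avg φ (2 ^ (13 * m)) (2 ^ (27 * (m + 1))) (2 ^ k) v)
      (a := 13 * (m + 1)) (b := 17 * m) (by omega) (by omega) hD0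
      fun k k1 k2 => hM1 m _ _ k le_rfl (by omega) (by omega) k2
    have s4 := hM3 m (13 * m) (27 * (m + 1)) (13 * (m + 1)) (by omega) (by omega)
    have s5 := norm_sub_le_of_forall_succ (n := 13)
      (f := fun k => Y.avg φ (2 ^ (13 * (m + 1))) (2 ^ (27 * (m + 1))) (2 ^ k) v)
      (a := 13 * m) (b := 13 * (m + 1)) (by omega) (by omega) hD0
      fun k k1 k2 => hM1' m _ _ k (by omega) (by omega) k1 (by omega)
    have s6 := hM3 m (13 * (m + 1)) (27 * (m + 1)) (13 * (m + 1)) (by omega) (by omega)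
    have hm0 : (0 : ℝ) ≤ m := by positivity
    have total := (norm_sub_le_norm_sub_add_norm_sub
      (X.avg φ (2 ^ (13 * m)) (2 ^ (27 * m)) (2 ^ (13 * m)) v)
      (X.avg φ (2 ^ (13 * m)) (2 ^ (27 * m)) (2 ^ (17 * m)) v)
      (X.avg φ (2 ^ (13 * (m + 1))) (2 ^ (27 * (m + 1))) (2 ^ (13 * (m + 1))) v))
    have total2 := (norm_sub_le_norm_sub_add_norm_sub
      (X.avg φ (2 ^ (13 * m)) (2 ^ (27 * m)) (2 ^ (17 * m)) v)
      (X.avg φ (2 ^ (13 * m)) (2 ^ (27 * (m + 1))) (2 ^ (17 * m)) v)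
      (X.avg φ (2 ^ (13 * (m + 1))) (2 ^ (27 * (m + 1))) (2 ^ (13 * (m + 1))) v))
    have total3 := (norm_sub_le_norm_sub_add_norm_sub
      (X.avg φ (2 ^ (13 * m)) (2 ^ (27 * (m + 1))) (2 ^ (17 * m)) v)
      (X.avg φ (2 ^ (13 * m)) (2 ^ (27 * (m + 1))) (2 ^ (13 * (m + 1))) v)
      (X.avg φ (2 ^ (13 * (m + 1))) (2 ^ (27 * (m + 1))) (2 ^ (13 * (m + 1))) v))
    have total4 := (norm_sub_le_norm_sub_add_norm_sub
      (X.avg φ (2 ^ (13 * m)) (2 ^ (27 * (m + 1))) (2 ^ (13 * (m + 1))) v)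
      (Y.avg φ (2 ^ (13 * (m + 1))) (2 ^ (27 * (m + 1))) (2 ^ (13 * m)) v)
      (X.avg φ (2 ^ (13 * (m + 1))) (2 ^ (27 * (m + 1))) (2 ^ (13 * (m + 1))) v))
    have total5 := (norm_sub_le_norm_sub_add_norm_sub
      (Y.avg φ (2 ^ (13 * (m + 1))) (2 ^ (27 * (m + 1))) (2 ^ (13 * m)) v)
      (Y.avg φ (2 ^ (13 * (m + 1))) (2 ^ (27 * (m + 1))) (2 ^ (13 * (m + 1))) v)
      (X.avg φ (2 ^ (13 * (m + 1))) (2 ^ (27 * (m + 1))) (2 ^ (13 * (m + 1))) v))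
    rw [norm_sub_rev] at s3 s6
    push_cast at s1 s2 s3 s5
    -- The path has 4m + 27 + 4m + 1 + 13 + 1 = 8m + 42 moves of cost at most `D`.
    have : 42 * A * ((1 + m) ^ 2 * Q ^ m) = 42 * (1 + m) * D := by rw [hD]; ring
    rw [this]
    have := mul_nonneg hm0 hD0
    linarith
  refine cauchySeq_of_dist_le_of_summable
    (fun n => 42 * A / Q * (((n + 27 : ℕ) : ℝ) ^ 2 * Q ^ (n + 27))) (fun n => ?_) ?_
  · rw [dist_eq_norm]
    refine (hstep (n + 26) (by omega)).trans (le_of_eq ?_)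
    rw [pow_succ Q (n + 26)]
    push_cast
    field_simp
    ring
  · refine Summable.mul_left _ ((summable_nat_add_iff 27 (f := fun n : ℕ => (n : ℝ) ^ 2 * Q ^ n)).2 ?_)
    exact summable_pow_mul_geometric_of_norm_lt_one 2
      (by rw [Real.norm_eq_abs, abs_of_pos hQ0]; exact hQ1)

theorem ChainEstimate.exists_fixed {B' C' q' : ℝ} (h : ChainEstimate K X v B C q)
    (h' : ChainEstimate K Y v B' C' q') (hc : KernelBound φ c) (e₁ : Y.x₁ = X.x₃)
    (e₂ : Y.x₂ = X.x₂) (e₃ : Y.x₃ = X.x₁) : ∃ w : E, ∀ t, X.x₂ t • w = w := by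
  obtain ⟨w, hw⟩ := cauchySeq_tendsto_of_complete (h.cauchySeq_avg h' hc e₁ e₂ e₃)
  refine ⟨w, fun t => ?_⟩
  have h1 : Tendsto (fun k : ℕ => (1 + k : ℝ) / 2 ^ k) atTop (𝓝 0) := by
    have h2 := (summable_geometric_of_lt_one (r := (1 / 2 : ℝ)) (by norm_num)
      (by norm_num)).tendsto_atTop_zero
    have h3 := (summable_pow_mul_geometric_of_norm_lt_one (R := ℝ) 1 (r := 1 / 2)
      (by norm_num)).tendsto_atTop_zero
    refine (by simpa using h2.add h3 : Tendsto _ _ _).congr fun k => ?_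
    field_simp
  have h4 : Tendsto (fun n : ℕ => 27 * (n + 26)) atTop atTop :=
    tendsto_atTop_mono (fun n => by rw [id]; omega) tendsto_id
  have h5 := (h1.comp h4).const_mul (B * c ^ 3 * |t|)
  rw [mul_zero] at h5
  have h6 := squeeze_zero (fun _ => norm_nonneg _)
    (fun n => h.norm_smul_avg_sub_le hc (13 * (n + 26)) (27 * (n + 26)) (13 * (n + 26)) t) h5
  have h7 := (((isometry_smul E (X.x₂ t)).continuous.tendsto w).comp hw).sub hw
  have h8 := tendsto_nhds_unique h7.norm h6
  rwa [norm_eq_zero, sub_eq_zero] at h8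

end FixedPoint

/-! ### Uniformly convex spaces and the abstract fixed point theorem -/

section UniformlyConvex

variable {G : Type*} [Group G] {E : Type u} [NormedAddCommGroup E] [NormedSpace ℝ E]
  [MulAction G E] [IsIsometricSMul G E]

theorem exists_convexAt (E : Type*) [NormedAddCommGroup E] [NormedSpace ℝ E]
    [UniformConvexSpace E] {ε : ℝ} (hε : 0 < ε) : ∃ δ, 0 < δ ∧ δ ≤ 1 ∧ ConvexAt E ε δ := by
  obtain ⟨δ, hδ, h⟩ := exists_forall_closed_ball_dist_add_le_two_sub E hε
  refine ⟨min δ 1, by positivity, min_le_right _ _, fun u v hu hv huv => (h hu hv huv).trans ?_⟩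
  linarith [min_le_left δ 1]

namespace AveragingKernel

variable {φ : ℝ → ℝ} (K : AveragingKernel φ) [CompleteSpace E]

include K

/-- There is a vector at which two flows that generate a Heisenberg group are Lipschitz. -/
theorem exists_lipschitz {x y z : ActionFlow G E} {b : ℝ}
    (hyz : ∀ s t, Commute (z s) (y t)) (hxy : ∀ s t, y s * x t = x t * y s * z (b * s * t)) :
    ∃ (v : E) (B : ℝ), 0 ≤ B ∧ (∀ t, ‖x t • v - v‖ ≤ B * |t|) ∧ ∀ t, ‖y t • v - v‖ ≤ B * |t| := by
  obtain ⟨c, hc⟩ := K.exists_kernelBound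
  have hc0 : 0 < c := zero_lt_one.trans_le hc.one_le
  have smooth (x : ActionFlow G E) (w : E) : ∃ B, 0 ≤ B ∧ ∀ t,
      ‖x t • affAvg φ x 1 w - affAvg φ x 1 w‖ ≤ B * |t| := by
    obtain ⟨B, hB0, hB⟩ := x.exists_norm_smul_sub_le w
    refine ⟨B * c / 1, by positivity, K.norm_smul_affAvg_sub_le hc x one_pos fun t => ?_⟩
    rw [one_mul]
    exact hB t
  -- Average along `z`, then `y`, then `x`. The average over `y` keeps the Lipschitz bound for `z`,
  -- which commutes with it. Moving y(t) past x(s) in the last average creates z(bst), whose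
  -- displacement is linear in `s` and is absorbed by the moment of the kernel.
  obtain ⟨A, hA0, hA⟩ := smooth z 0
  set w := affAvg φ z 1 (0 : E)
  obtain ⟨B, hB0, hB⟩ := smooth y w
  have hA' (t : ℝ) : ‖z t • affAvg φ y 1 w - affAvg φ y 1 w‖ ≤ c * (A * |t|) := by
    rw [K.smul_affAvg _ _ _ _ (hyz t)]
    exact (K.norm_affAvg_sub_affAvg_le hc _ _ _ _).trans
      (mul_le_mul_of_nonneg_left (hA t) hc0.le)
  set u := affAvg φ y 1 w
  obtain ⟨D, hD0, hD⟩ := smooth x u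
  refine ⟨affAvg φ x 1 u, max D ((B + c * A * |b|) * c), le_max_of_le_left hD0,
    fun t => (hD t).trans (by gcongr; exact le_max_left _ _), fun t => ?_⟩
  refine le_trans ?_ (mul_le_mul_of_nonneg_right (le_max_right _ _) (abs_nonneg t))
  obtain ⟨M, -, hM⟩ := x.exists_quadGrowth 1 u
  have hM' : QuadGrowth (fun s => y t • x (1 * s) • u) (M + ‖y t • (0 : E)‖) := by
    refine ⟨(isometry_smul E (y t)).continuous.comp hM.continuous, fun s => ?_⟩
    have h1 := norm_sub_norm_le (y t • x (1 * s) • u) (y t • (0 : E))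
    rw [norm_smul_sub_smul, sub_zero] at h1
    have h3 := hM.norm_le s
    have h4 := le_mul_of_one_le_right (norm_nonneg (y t • (0 : E))) (one_le_one_add_abs_sq s)
    nlinarith
  rw [affAvg, K.smul_kavg _ hM, ← K.kavg_sub hM' hM]
  refine (K.norm_kavg_le hc (B := (B + c * A * |b|) * |t|) fun s => ?_).trans
    (le_of_eq (by ring))
  have h1 : y t • x (1 * s) • u - x (1 * s) • u =
      (x (1 * s) • y t • z (b * t * (1 * s)) • u - x (1 * s) • y t • u) +
        (x (1 * s) • y t • u - x (1 * s) • u) := by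
    rw [sub_add_sub_cancel, ← mul_smul, hxy, mul_smul, mul_smul]
  rw [h1]
  refine (norm_add_le _ _).trans ?_
  rw [norm_smul_sub_smul, norm_smul_sub_smul, norm_smul_sub_smul]
  have h2 := hA' (b * t * (1 * s))
  have h3 := hB t
  rw [one_mul, abs_mul, abs_mul] at h2
  have h4 : |s| ≤ (1 + |s|) ^ 2 := by nlinarith [abs_nonneg s]
  have h5 := one_le_one_add_abs_sq s
  rw [one_mul]
  calc _ ≤ c * (A * (|b| * |t| * |s|)) + B * |t| := add_le_add h2 h3
    _ ≤ c * (A * (|b| * |t| * (1 + |s|) ^ 2)) + B * |t| * (1 + |s|) ^ 2 := by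
      refine add_le_add (by gcongr) (le_mul_of_one_le_right (by positivity) h5)
    _ = _ := by ring

theorem exists_chainEstimate {c : ℝ} (hc : KernelBound φ c) {a ε δ : ℝ}
    (ha : a = 1 / (32 * c ^ 2)) (hε : ε = a / (192 * c)) (hδ0 : 0 < δ) (hδ : δ ≤ 1)
    (hE : ConvexAt E ε δ) (X : RootChain G E) {v : E} {B₂ B₁ B₀ B₇ : ℝ}
    (h₂ : LogGrowth X.x₂ v B₂) (h₁ : LogGrowth X.x₁ v B₁) (h₀ : LogGrowth X.x₀ v B₀)
    (h₇ : ∀ t, ‖X.x₇ t • v - v‖ ≤ B₇ * |t|) : ∃ B C q, ChainEstimate K X v B C q := by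
  obtain ⟨C₂, q₂, hC₂, hq₂, hq₂', d₂⟩ := K.exists_diffBound hc ha hε hδ0 hδ hE X.b₂_ne
    (fun s t => (X.comm₂₁ t s).symm) (fun s t => (X.comm₂₃ t s).symm) X.rel₃₁
  obtain ⟨C₀, q₀, hC₀, hq₀, hq₀', d₀⟩ := K.exists_diffBound hc ha hε hδ0 hδ hE X.b₀_ne
    (fun s t => (X.comm₀₇ t s).symm) X.comm₁₀ X.rel₁₇
  obtain ⟨C₁, q₁, hC₁, hq₁, hq₁', d₁⟩ :=
    K.exists_norm_op_mul_op_mul_op_mul_diff_le hc ha hε hδ0 hδ hE X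
  set B := max (max 0 B₂) (max (max B₁ B₀) B₇)
  set C := max (max C₂ C₀) C₁
  set q := max (max (1 / 2) q₂) (max q₀ q₁)
  have i2 : C₂ ≤ C := (le_max_left _ _).trans (le_max_left _ _)
  have i0 : C₀ ≤ C := (le_max_right _ _).trans (le_max_left _ _)
  have i1 : C₁ ≤ C := le_max_right _ _
  have j2 : q₂ ≤ q := (le_max_right _ _).trans (le_max_left _ _)
  have j0 : q₀ ≤ q := (le_max_left _ _).trans (le_max_right _ _)
  have j1 : q₁ ≤ q := (le_max_right _ _).trans (le_max_right _ _)
  have hC : 0 ≤ C := hC₁.trans i1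
  have k7 : B₇ ≤ B := (le_max_right _ _).trans (le_max_right _ _)
  exact ⟨B, C, q,
    { B_nonneg := (le_max_left _ _).trans (le_max_left _ _)
      C_nonneg := hC
      half_le := (le_max_left _ _).trans (le_max_left _ _)
      lt_one := max_lt (max_lt (by norm_num) hq₂') (max_lt hq₀' hq₁')
      log₂ := h₂.mono ((le_max_right _ _).trans (le_max_left _ _))
      log₁ := h₁.mono (((le_max_left _ _).trans (le_max_left _ _)).trans (le_max_right _ _))
      log₀ := h₀.mono (((le_max_right _ _).trans (le_max_left _ _)).trans (le_max_right _ _))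
      lip₇ := fun t => (h₇ t).trans (by gcongr)
      diff₂ := d₂.mono i2 hC₂ hq₂.le j2
      diff₀ := d₀.mono i0 hC₀ hq₀.le j0
      diff₁ := fun n l₃ l₂ l₁ l₀ μ t3 t2 t1 t0 tμ t4 t5 t6 =>
        (d₁ n l₃ l₂ l₁ l₀ μ t3 t2 t1 t0 tμ t4 t5 t6).trans (by gcongr) }⟩

end AveragingKernel

/-- An isometric action of a group that contains the root subgroups of a root system of type `C₂`,
normalized by a torus, on a uniformly convex Banach space has a vector fixed by the root subgroup
of a long root. -/
theorem RootChain.exists_fixed [CompleteSpace E] [UniformConvexSpace E] (X Y : RootChain G E)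
    (e₁ : Y.x₁ = X.x₃) (e₂ : Y.x₂ = X.x₂) (e₃ : Y.x₃ = X.x₁) {x₆ : ActionFlow G E} {b : ℝ}
    (h₆ : ∀ s t, Commute (x₆ s) (Y.x₇ t))
    (h₇ : ∀ s t, Y.x₇ s * X.x₇ t = X.x₇ t * Y.x₇ s * x₆ (b * s * t)) {g₀ g₁ g₂ g₃ g₄ : G}
    (hg₀ : ∀ t, g₀ * X.x₀ t * g₀⁻¹ = X.x₀ (2 * t)) (hg₁ : ∀ t, g₁ * X.x₁ t * g₁⁻¹ = X.x₁ (2 * t))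
    (hg₂ : ∀ t, g₂ * X.x₂ t * g₂⁻¹ = X.x₂ (2 * t)) (hg₃ : ∀ t, g₃ * X.x₃ t * g₃⁻¹ = X.x₃ (2 * t))
    (hg₄ : ∀ t, g₄ * Y.x₀ t * g₄⁻¹ = Y.x₀ (2 * t)) : ∃ v : E, ∀ t, X.x₂ t • v = v := by
  obtain ⟨φ, K⟩ := exists_averagingKernel
  obtain ⟨c, hc⟩ := K.exists_kernelBound
  have hc0 : 0 < c := zero_lt_one.trans_le hc.one_le
  obtain ⟨δ, hδ0, hδ, hE⟩ := exists_convexAt E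
    (by positivity : 0 < 1 / (32 * c ^ 2) / (192 * c))
  -- The flows `x₇` of the two chains generate with `x₆` a Heisenberg group, so one vector serves
  -- both chains.
  obtain ⟨v, B, -, hX, hY⟩ := K.exists_lipschitz h₆ h₇
  obtain ⟨B₀, -, l₀⟩ := X.x₀.exists_logGrowth hg₀ v
  obtain ⟨B₁, -, l₁⟩ := X.x₁.exists_logGrowth hg₁ v
  obtain ⟨B₂, -, l₂⟩ := X.x₂.exists_logGrowth hg₂ v
  obtain ⟨B₃, -, l₃⟩ := X.x₃.exists_logGrowth hg₃ v
  obtain ⟨B₄, -, l₄⟩ := Y.x₀.exists_logGrowth hg₄ v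
  obtain ⟨_, _, _, h⟩ := K.exists_chainEstimate hc rfl rfl hδ0 hδ hE X l₂ l₁ l₀ hX
  obtain ⟨_, _, _, h'⟩ := K.exists_chainEstimate hc rfl rfl hδ0 hδ hE Y (by rwa [e₂])
    (by rwa [e₁]) l₄ hY
  exact h.exists_fixed h' hc e₁ e₂ e₃

end UniformlyConvex

/-! ### Conjugation in the universal cover -/

section Conjugation

variable {G : Type*} [Group G] [TopologicalSpace G] [IsTopologicalGroup G]

/-- Conjugation by the class of a path `γ` depends only on `γ 1`. -/
theorem mk_mul_mk_eq_of_forall (γ δ δ' : basedPaths G)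
    (h : ∀ s, (γ : C(I, G)) 1 * (δ : C(I, G)) s = (δ' : C(I, G)) s * (γ : C(I, G)) 1) :
    (γ : UniversalCover G) * (δ : UniversalCover G) = δ' * γ := by
  rw [← mul_inv_eq_iff_eq_mul, ← QuotientGroup.mk_mul, ← QuotientGroup.mk_inv,
    ← QuotientGroup.mk_mul, QuotientGroup.eq]
  -- ρ(u, s) = 1 - (1 - u)(1 - s) slides the conjugating element from γ(s) at u = 0 to γ(1) at u = 1
  -- while fixing the value at s = 1. At s = 0 the paths δ and δ' are trivial, so the end points of
  -- the homotopy stay put.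
  let ρ : C(I × I, I) := ⟨fun p => unitInterval.symm (unitInterval.symm p.1 * unitInterval.symm p.2),
    by fun_prop⟩
  let F : C(I × I, G) := ((γ : C(I, G)).comp ρ * (δ : C(I, G)).comp ContinuousMap.snd *
    ((γ : C(I, G)).comp ρ)⁻¹)⁻¹ * (δ' : C(I, G)).comp ContinuousMap.snd
  have h0 : (δ : C(I, G)) 0 = 1 := δ.2
  have h0' : (δ' : C(I, G)) 0 = 1 := δ'.2
  have h1 (u : I) : ρ (u, 1) = 1 := by simp [ρ]
  have h2 (s : I) : ρ (1, s) = 1 := by simp [ρ]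
  have h3 (s : I) : ρ (0, s) = s := by simp [ρ]
  have h4 (s : I) : ((γ : C(I, G)) 1 * (δ : C(I, G)) s * ((γ : C(I, G)) 1)⁻¹)⁻¹ *
      (δ' : C(I, G)) s = 1 := by
    rw [h]; group
  refine ⟨⟨⟨F, fun s => ?_, fun s => ?_⟩, fun u s hs => ?_⟩⟩
  · simp [F, h3]
  · simpa [F, h2] using h4 s
  · rcases hs with rfl | rfl
    · simp [F, h0, h0']
    · have h5 := h4 1
      simp only [mul_inv_rev, inv_inv] at h5
      simp [F, h1, h5]

end Conjugation

/-! ### Exponentials and commutator formulas in the universal cover -/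

section SymplecticExp

theorem Sp4.exp_add {A B : sp4} (h : Commute A.1 B.1) :
    Sp4.exp (A + B) = Sp4.exp A * Sp4.exp B :=
  Subtype.ext (Matrix.exp_add_of_commute _ _ h)

namespace Sp4Tilde

theorem exp_add {A B : sp4} (h : Commute A.1 B.1) : exp (A + B) = exp A * exp B := by
  rw [exp, exp, exp, ← QuotientGroup.mk_mul]
  congr 1
  refine Subtype.ext (ContinuousMap.ext fun s => ?_)
  change Sp4.exp ((s : ℝ) • (A + B)) = Sp4.exp ((s : ℝ) • A) * Sp4.exp ((s : ℝ) • B)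
  rw [smul_add]
  exact Sp4.exp_add ((h.smul_left _).smul_right _)

theorem exp_commute {A B : sp4} (h : Commute A.1 B.1) : Commute (exp A) (exp B) := by
  rw [Commute, SemiconjBy, ← exp_add h, ← exp_add h.symm, add_comm]

/-- Conjugation in the cover is determined by the end point of the path, so an identity of matrices
lifts without any ambiguity by the fundamental group. -/
theorem exp_mul_exp_of_semiconj {A B B' : sp4}
    (h : NormedSpace.exp A.1 * B.1 = B'.1 * NormedSpace.exp A.1) :
    exp A * exp B = exp B' * exp A := by
  refine mk_mul_mk_eq_of_forall _ _ _ fun s => Subtype.ext ?_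
  change NormedSpace.exp ((1 : ℝ) • A.1) * NormedSpace.exp ((s : ℝ) • B.1) =
    NormedSpace.exp ((s : ℝ) • B'.1) * NormedSpace.exp ((1 : ℝ) • A.1)
  rw [one_smul]
  have hu := Matrix.isUnit_exp A.1
  have hdet := (Matrix.isUnit_iff_isUnit_det _).1 hu
  have hB : (s : ℝ) • B'.1 = NormedSpace.exp A.1 * ((s : ℝ) • B.1) * (NormedSpace.exp A.1)⁻¹ := by
    rw [Matrix.mul_smul, Matrix.smul_mul, h, Matrix.mul_nonsing_inv_cancel_right _ _ hdet]
  rw [hB, Matrix.exp_conj _ _ hu, Matrix.nonsing_inv_mul_cancel_right _ _ hdet]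

theorem _root_.Matrix.exp_eq_one_add_of_mul_self_eq_zero {n : Type*} [Fintype n] [DecidableEq n]
    {A : Matrix n n ℝ} (h : A * A = 0) : NormedSpace.exp A = 1 + A := by
  rw [NormedSpace.exp_eq_tsum ℝ]
  have h2 (k : ℕ) (hk : k ∉ Finset.range 2) : ((k.factorial : ℝ)⁻¹) • A ^ k = 0 := by
    obtain ⟨j, rfl⟩ := Nat.exists_eq_add_of_le (not_lt.1 (mt Finset.mem_range.2 hk))
    rw [pow_add, pow_two, h, zero_mul, smul_zero]
  simp only
  rw [tsum_eq_sum h2, Finset.sum_range_succ, Finset.sum_range_one]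
  simp

/-- The commutator formula for exponentials. -/
theorem exp_mul_exp {A B C : sp4} (hA : A.1 * A.1 = 0) (hBC : Commute B.1 C.1)
    (h : B.1 * A.1 + C.1 + A.1 * C.1 = A.1 * B.1) : exp A * exp B = exp B * exp A * exp C := by
  -- As A² = 0, `h` says (1 + A)(B - C) = B(1 + A), that is, exp A conjugates B - C to B. Splitting
  -- off exp C is possible because B and C commute.
  have h1 : exp A * exp (B - C) = exp B * exp A := by
    refine exp_mul_exp_of_semiconj ?_
    rw [Matrix.exp_eq_one_add_of_mul_self_eq_zero hA]
    change (1 + A.1) * (B.1 - C.1) = B.1 * (1 + A.1)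
    rw [add_mul, mul_sub, mul_sub, mul_add, ← h]
    simp only [one_mul, mul_one]
    abel
  have h2 : exp B = exp (B - C) * exp C := by
    rw [← exp_add (hBC.sub_left (Commute.refl _)), sub_add_cancel]
  conv_lhs => rw [h2]
  rw [← mul_assoc, h1]

theorem continuous_exp_smul (A : sp4) : Continuous fun t : ℝ => exp (t • A) := by
  refine continuous_quotient_mk'.comp (Continuous.subtype_mk
    (ContinuousMap.continuous_of_continuous_uncurry _ ?_) _)
  change Continuous fun p : ℝ × I => Sp4.exp ((p.2 : ℝ) • p.1 • A)
  have := Sp4.continuous_exp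
  fun_prop

/-- The action of the one-parameter subgroup generated by `A`. -/
noncomputable def flow (E : Type*) [NormedAddCommGroup E] [MulAction Sp4Tilde E]
    [ContinuousSMul Sp4Tilde E] (A : sp4) : ActionFlow Sp4Tilde E where
  toFun t := exp (t • A)
  map_add s t := by
    rw [add_smul]
    exact exp_add (((Commute.refl A.1).smul_left s).smul_right t)
  continuous v := (continuous_exp_smul A).smul continuous_const

end Sp4Tilde

end SymplecticExp

/-! ### The root subgroups of the symplectic group -/

section RootSubgroups

namespace Sp4

/-- The element of `𝔰𝔭₄(ℝ)` with upper right block `(a, b; b, d)`. -/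
def upper (a b d : ℝ) : sp4 :=
  ⟨Matrix.fromBlocks 0 !![a, b; b, d] 0 0, by
    rw [mem_sp4_iff]
    ext (i | i) (j | j) <;> fin_cases i <;> fin_cases j <;>
      simp [Matrix.J, Matrix.fromBlocks_transpose, Matrix.fromBlocks_multiply]⟩

/-- The element of `𝔰𝔭₄(ℝ)` with lower left block `(a, b; b, d)`. -/
def lower (a b d : ℝ) : sp4 :=
  ⟨Matrix.fromBlocks 0 0 !![a, b; b, d] 0, by
    rw [mem_sp4_iff]
    ext (i | i) (j | j) <;> fin_cases i <;> fin_cases j <;>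
      simp [Matrix.J, Matrix.fromBlocks_transpose, Matrix.fromBlocks_multiply]⟩

/-- The element of `𝔰𝔭₄(ℝ)` with upper left block `(a, b; c, d)` and no off-diagonal blocks. -/
def levi (a b c d : ℝ) : sp4 :=
  ⟨Matrix.fromBlocks !![a, b; c, d] 0 0 !![-a, -c; -b, -d], by
    rw [mem_sp4_iff]
    ext (i | i) (j | j) <;> fin_cases i <;> fin_cases j <;>
      simp [Matrix.J, Matrix.fromBlocks_transpose, Matrix.fromBlocks_multiply]⟩

theorem smul_upper (t a b d : ℝ) : t • upper a b d = upper (t * a) (t * b) (t * d) := by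
  refine Subtype.ext ?_
  change t • Matrix.fromBlocks 0 !![a, b; b, d] 0 0 = _
  simp [upper, Matrix.fromBlocks_smul, Matrix.smul_of]

theorem smul_lower (t a b d : ℝ) : t • lower a b d = lower (t * a) (t * b) (t * d) := by
  refine Subtype.ext ?_
  change t • Matrix.fromBlocks 0 0 !![a, b; b, d] 0 = _
  simp [lower, Matrix.fromBlocks_smul, Matrix.smul_of]

theorem smul_levi (t a b c d : ℝ) : t • levi a b c d = levi (t * a) (t * b) (t * c) (t * d) := by
  refine Subtype.ext ?_
  change t • Matrix.fromBlocks !![a, b; c, d] 0 0 !![-a, -c; -b, -d] = _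
  simp [levi, Matrix.fromBlocks_smul, Matrix.smul_of]

theorem exp_levi (a d : ℝ) : NormedSpace.exp (levi a 0 0 d).1 =
    Matrix.fromBlocks !![Real.exp a, 0; 0, Real.exp d] 0 0
      !![Real.exp (-a), 0; 0, Real.exp (-d)] := by
  have h : (levi a 0 0 d).1 = Matrix.diagonal (Sum.elim ![a, d] ![-a, -d]) := by
    ext (i | i) (j | j) <;> fin_cases i <;> fin_cases j <;> simp [levi]
  rw [h, Matrix.exp_diagonal]
  ext (i | i) (j | j) <;> fin_cases i <;> fin_cases j <;>
    simp [Real.exp_eq_exp_ℝ, Pi.coe_exp]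

end Sp4

namespace Sp4Tilde

open Sp4

/-- Supplies the doubling of time that yields logarithmic growth of orbits: `A` will be in the
diagonal torus and `B` a root vector of eigenvalue 2. -/
theorem exp_mul_exp_smul_mul_inv {A B : sp4}
    (h : NormedSpace.exp A.1 * B.1 = (2 : ℝ) • (B.1 * NormedSpace.exp A.1)) (p : ℝ) :
    exp A * exp (p • B) * (exp A)⁻¹ = exp ((2 * p) • B) := by
  rw [mul_inv_eq_iff_eq_mul]
  refine exp_mul_exp_of_semiconj ?_
  change NormedSpace.exp A.1 * (p • B.1) = ((2 * p) • B.1) * NormedSpace.exp A.1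
  rw [Matrix.mul_smul, h, Matrix.smul_mul, smul_smul, mul_comm]

theorem upper_commute_upper (a b d a' b' d' : ℝ) :
    Commute (upper a b d).1 (upper a' b' d').1 := by
  simp [Commute, SemiconjBy, upper, Matrix.fromBlocks_multiply]

theorem lower_commute_lower (a b d a' b' d' : ℝ) :
    Commute (lower a b d).1 (lower a' b' d').1 := by
  simp [Commute, SemiconjBy, lower, Matrix.fromBlocks_multiply]

theorem upper_commute_levi (c d : ℝ) : Commute (upper 0 0 d).1 (levi 0 0 c 0).1 := by
  rw [Commute, SemiconjBy]
  ext (i | i) (j | j) <;> fin_cases i <;> fin_cases j <;>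
    simp [upper, levi, Matrix.fromBlocks_multiply]

theorem upper_commute_levi' (a b : ℝ) : Commute (upper a 0 0).1 (levi 0 b 0 0).1 := by
  rw [Commute, SemiconjBy]
  ext (i | i) (j | j) <;> fin_cases i <;> fin_cases j <;>
    simp [upper, levi, Matrix.fromBlocks_multiply]

theorem levi_commute_lower (c a : ℝ) : Commute (levi 0 0 c 0).1 (lower a 0 0).1 := by
  rw [Commute, SemiconjBy]
  ext (i | i) (j | j) <;> fin_cases i <;> fin_cases j <;>
    simp [lower, levi, Matrix.fromBlocks_multiply]

theorem upper_commute_lower (d a : ℝ) : Commute (upper 0 0 d).1 (lower a 0 0).1 := by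
  rw [Commute, SemiconjBy]
  ext (i | i) (j | j) <;> fin_cases i <;> fin_cases j <;>
    simp [upper, lower, Matrix.fromBlocks_multiply]

theorem upper_mul_self (a b d : ℝ) : (upper a b d).1 * (upper a b d).1 = 0 := by
  simp [upper, Matrix.fromBlocks_multiply]

theorem lower_mul_self (a b d : ℝ) : (lower a b d).1 * (lower a b d).1 = 0 := by
  simp [lower, Matrix.fromBlocks_multiply]

theorem levi_mul_self (c : ℝ) : (levi 0 0 c 0).1 * (levi 0 0 c 0).1 = 0 := by
  ext (i | i) (j | j) <;> fin_cases i <;> fin_cases j <;>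
    simp [levi, Matrix.fromBlocks_multiply]

theorem exp_upper_add (b d : ℝ) : exp (upper 0 b d) = exp (upper 0 b 0) * exp (upper 0 0 d) := by
  rw [← exp_add (upper_commute_upper _ _ _ _ _ _)]
  congr 1
  refine Subtype.ext ?_
  change _ = (upper 0 b 0).1 + (upper 0 0 d).1
  ext (i | i) (j | j) <;> fin_cases i <;> fin_cases j <;> simp [upper]

variable (E : Type*) [NormedAddCommGroup E] [MulAction Sp4Tilde E] [ContinuousSMul Sp4Tilde E]

theorem flow_commute {A B : sp4} (h : Commute A.1 B.1) (s t : ℝ) :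
    Commute (flow E A s) (flow E B t) :=
  exp_commute ((h.smul_left s).smul_right t)

/-- The root subgroups of `β - α`, `2β`, `α + β`, `2α` and `α - β`. -/
noncomputable def rootChain : RootChain Sp4Tilde E where
  x₃ := flow E (levi 0 0 1 0)
  x₂ := flow E (upper 0 0 1)
  x₁ := flow E (upper 0 1 0)
  x₀ := flow E (upper 1 0 0)
  x₇ := flow E (levi 0 1 0 0)
  b₂ := 2
  b₁ := 1
  b₀ := -2
  d := -1
  b₂_ne := by norm_num
  b₁_ne := by norm_num
  b₀_ne := by norm_num
  comm₂₁ := flow_commute E (upper_commute_upper _ _ _ _ _ _)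
  comm₂₃ := flow_commute E (upper_commute_levi _ _)
  comm₂₀ := flow_commute E (upper_commute_upper _ _ _ _ _ _)
  comm₁₀ := flow_commute E (upper_commute_upper _ _ _ _ _ _)
  comm₀₇ := flow_commute E (upper_commute_levi' _ _)
  rel₃₁ p q := by
    simp only [flow, smul_upper, smul_levi, mul_one, mul_zero]
    refine exp_mul_exp (levi_mul_self p) (upper_commute_upper _ _ _ _ _ _) ?_
    ext (i | i) (j | j) <;> fin_cases i <;> fin_cases j <;>
      simp [levi, upper, Matrix.fromBlocks_multiply, Matrix.fromBlocks_add]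
    ring
  rel₁₇ p q := by
    simp only [flow, smul_upper, smul_levi, mul_one, mul_zero]
    refine exp_mul_exp (upper_mul_self _ _ _) (upper_commute_levi' _ _).symm ?_
    ext (i | i) (j | j) <;> fin_cases i <;> fin_cases j <;>
      simp [levi, upper, Matrix.fromBlocks_multiply, Matrix.fromBlocks_add]
    ring
  rel₃₀ p q := by
    simp only [flow, smul_upper, smul_levi, mul_one, mul_zero]
    rw [mul_assoc _ (exp _) (exp _), ← exp_upper_add]
    refine exp_mul_exp (levi_mul_self p) (upper_commute_upper _ _ _ _ _ _) ?_
    ext (i | i) (j | j) <;> fin_cases i <;> fin_cases j <;>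
      simp [levi, upper, Matrix.fromBlocks_multiply, Matrix.fromBlocks_add]
    all_goals ring

/-- The root subgroups of `α + β`, `2β`, `β - α`, `-2α` and `-α - β`. -/
noncomputable def oppositeRootChain : RootChain Sp4Tilde E where
  x₃ := flow E (upper 0 1 0)
  x₂ := flow E (upper 0 0 1)
  x₁ := flow E (levi 0 0 1 0)
  x₀ := flow E (lower 1 0 0)
  x₇ := flow E (lower 0 1 0)
  b₂ := -2
  b₁ := 1
  b₀ := -2
  d := 1
  b₂_ne := by norm_num
  b₁_ne := by norm_num
  b₀_ne := by norm_num
  comm₂₁ := flow_commute E (upper_commute_levi _ _)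
  comm₂₃ := flow_commute E (upper_commute_upper _ _ _ _ _ _)
  comm₂₀ := flow_commute E (upper_commute_lower _ _)
  comm₁₀ := flow_commute E (levi_commute_lower _ _)
  comm₀₇ := flow_commute E (lower_commute_lower _ _ _ _ _ _)
  rel₃₁ p q := by
    simp only [flow, smul_upper, smul_levi, mul_one, mul_zero]
    refine exp_mul_exp (upper_mul_self _ _ _) (upper_commute_levi _ _).symm ?_
    ext (i | i) (j | j) <;> fin_cases i <;> fin_cases j <;>
      simp [levi, upper, Matrix.fromBlocks_multiply, Matrix.fromBlocks_add]
    ring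
  rel₁₇ p q := by
    simp only [flow, smul_lower, smul_levi, mul_one, mul_zero]
    refine exp_mul_exp (levi_mul_self p) (lower_commute_lower _ _ _ _ _ _) ?_
    ext (i | i) (j | j) <;> fin_cases i <;> fin_cases j <;>
      simp [levi, lower, Matrix.fromBlocks_multiply, Matrix.fromBlocks_add]
    ring
  rel₃₀ p q := by
    simp only [flow, smul_upper, smul_lower, smul_levi, mul_one, mul_zero]
    rw [mul_assoc _ (exp _) (exp _), ← exp_add (upper_commute_levi _ _).symm]
    refine exp_mul_exp (upper_mul_self _ _ _)
      ((levi_commute_lower _ _).symm.add_right (upper_commute_lower _ _).symm) ?_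
    change _ + ((levi _ _ _ _).1 + (upper _ _ _).1) +
      _ * ((levi _ _ _ _).1 + (upper _ _ _).1) = _
    ext (i | i) (j | j) <;> fin_cases i <;> fin_cases j <;>
      simp [levi, upper, lower, Matrix.fromBlocks_multiply, Matrix.fromBlocks_add]
    all_goals ring

theorem flow_mul_flow_levi (p q : ℝ) : flow E (lower 0 1 0) p * flow E (levi 0 1 0 0) q =
    flow E (levi 0 1 0 0) q * flow E (lower 0 1 0) p * flow E (lower 0 0 1) (2 * p * q) := by
  simp only [flow, smul_lower, smul_levi, mul_one, mul_zero]
  refine exp_mul_exp (lower_mul_self _ _ _) ?_ ?_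
  · rw [Commute, SemiconjBy]
    ext (i | i) (j | j) <;> fin_cases i <;> fin_cases j <;>
      simp [lower, levi, Matrix.fromBlocks_multiply]
  · ext (i | i) (j | j) <;> fin_cases i <;> fin_cases j <;>
      simp [levi, lower, Matrix.fromBlocks_multiply, Matrix.fromBlocks_add]
    ring

end Sp4Tilde

end RootSubgroups

theorem mainTheorem7 (E : Type*) [NormedAddCommGroup E] [NormedSpace ℝ E] [CompleteSpace E]
    [UniformConvexSpace E] [MulAction Sp4Tilde E] [ContinuousSMul Sp4Tilde E]
    [IsIsometricSMul Sp4Tilde E] :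
    ∃ x : E, ∀ t : ℝ, Sp4Tilde.exp (t • rootVector2Beta) • x = x := by
  -- Here e^(2L) = 2. The torus element exp(`levi a 0 0 d`) scales the roots 2α, α + β, 2β, β - α
  -- and -2α by the exponentials of 2a, a + d, 2d, d - a and -2a; the five elements below make each
  -- of these exponents 2L.
  obtain ⟨L, hL⟩ : ∃ L : ℝ, Real.exp L = 2 * Real.exp (-L) := by
    refine ⟨Real.log 2 / 2, ?_⟩
    have h : Real.exp (Real.log 2 / 2) * Real.exp (Real.log 2 / 2) = 2 := by
      rw [← Real.exp_add, add_halves, Real.exp_log two_pos]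
    rw [Real.exp_neg, ← div_eq_mul_inv, eq_div_iff (Real.exp_pos _).ne', h]
  have hroot : rootVector2Beta = Sp4.upper 0 0 1 := rfl
  rw [hroot]
  refine (Sp4Tilde.rootChain E).exists_fixed (Sp4Tilde.oppositeRootChain E) rfl rfl rfl
    (x₆ := Sp4Tilde.flow E (Sp4.lower 0 0 1))
    (Sp4Tilde.flow_commute E (Sp4Tilde.lower_commute_lower _ _ _ _ _ _))
    (Sp4Tilde.flow_mul_flow_levi E)
    (Sp4Tilde.exp_mul_exp_smul_mul_inv (A := Sp4.levi L 0 0 0) ?_)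
    (Sp4Tilde.exp_mul_exp_smul_mul_inv (A := Sp4.levi L 0 0 L) ?_)
    (Sp4Tilde.exp_mul_exp_smul_mul_inv (A := Sp4.levi 0 0 0 L) ?_)
    (Sp4Tilde.exp_mul_exp_smul_mul_inv (A := Sp4.levi (-L) 0 0 L) ?_)
    (Sp4Tilde.exp_mul_exp_smul_mul_inv (A := Sp4.levi (-L) 0 0 0) ?_)
  all_goals
    rw [Sp4.exp_levi]
    ext (i | i) (j | j) <;> fin_cases i <;> fin_cases j <;>
      simp [Sp4.upper, Sp4.lower, Sp4.levi, Matrix.fromBlocks_multiply, hL]
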